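/- **Theorem 6.5 (Sharp jump augmentation).** Let $d\ge 1$ and $\ell\ge 0$ be integers. Let $\omega=K_1\cup K_2$ be the union of two closed nondegenerate simplices $K_1,K_2\subset\mathbb{R}^d$ such that $E=K_1\cap K_2$ is a $(d-1)$-dimensional face of both. Put $$ \sigma_E=\frac{\max\{\operatorname{diam}K_1,\operatorname{diam}K_2\}}{\min\{\rho_1,\rho_2\}},\qquad h_E=\frac{\min\{|K_1|,|K_2|\}}{|E|}, $$ where $\rho_i$ is the maximum diameter of a ball contained in $K_i$, $|K_i|$ is the $d$-dimensional Lebesgue measure and $|E|$ the $(d-1)$-dimensional Hausdorff measure. For $\varepsilon>0$ let $$ |||v|||_A=\bigl(\|v\|_{A}^2+\varepsilon\|\nabla v\|_{A}^2\bigr)^{1/2}, $$ where $\|\cdot\|_A$ is the $L^2$-norm on $A$ (with respect to the $(d-1)$-dimensional Hausdorff measure when $A=E$) and $\nabla$ is the weak gradient in the interior of $A$. Let $\mathbb{P}_\ell(K_i)$ be the polynomials of total degree at most $\ell$ on $K_i$, and $S|_\omega$ the continuous functions on $\omega$ whose restrictions to $K_1$ and $K_2$ are polynomials of total degree at most $\ell$.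 For every $d$, $\ell$ and $\sigma$ there are constants $c,C>0$, depending only on $d$, $\ell$ and $\sigma$, such that for all $K_1,K_2$ as above with $\sigma_E\le\sigma$, all $\varepsilon>0$, all $u\in H^1(\omega)$ and all best approximations $P_i\in\mathbb{P}_\ell(K_i)$, i.e. with $|||u-P_i|||_{K_i}=\inf_{P\in\mathbb{P}_\ell(K_i)}|||u-P|||_{K_i}$ for $i=1,2$, $$ c\Bigl(h_E\|P_1-P_2\|_E^2+\sum_{i=1}^2|||u-P_i|||_{K_i}^2\Bigr)^{1/2} \le \inf_{P\in S|_\omega}|||u-P|||_\omega \le C\Bigl(h_E\|P_1-P_2\|_E^2+\sum_{i=1}^2|||u-P_i|||_{K_i}^2\Bigr)^{1/2}. $$ In particular, the constants do not depend on $\varepsilon$. -/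

import Mathlib

open MeasureTheory
open scoped ContDiff

noncomputable section

/-- `g` is the weak gradient of `u` in the open set `Ω`, tested in every direction `w` against
all smooth functions with compact support contained in `Ω`. -/
def IsWeakGradient {d : ℕ} (Ω : Set (EuclideanSpace ℝ (Fin d)))
    (u : EuclideanSpace ℝ (Fin d) → ℝ)
    (g : EuclideanSpace ℝ (Fin d) → EuclideanSpace ℝ (Fin d)) : Prop :=
  LocallyIntegrableOn u Ω volume ∧ LocallyIntegrableOn g Ω volume ∧
    ∀ φ : EuclideanSpace ℝ (Fin d) → ℝ, ContDiff ℝ ∞ φ → HasCompactSupport φ →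
      tsupport φ ⊆ Ω → ∀ w : EuclideanSpace ℝ (Fin d),
        ∫ x in Ω, u x * fderiv ℝ φ x w = -∫ x in Ω, inner ℝ (g x) w * φ x

/-- `u` belongs to the Sobolev space `H¹(Ω)`: it is square integrable on the open set `Ω` and has
a square integrable weak gradient there. Values of `u` outside `Ω` are irrelevant. -/
def MemH1 {d : ℕ} (Ω : Set (EuclideanSpace ℝ (Fin d)))
    (u : EuclideanSpace ℝ (Fin d) → ℝ) : Prop :=
  MemLp u 2 (volume.restrict Ω) ∧
    ∃ g : EuclideanSpace ℝ (Fin d) → EuclideanSpace ℝ (Fin d),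
      MemLp g 2 (volume.restrict Ω) ∧ IsWeakGradient Ω u g

open Classical in
/-- The weak gradient of `u` in `Ω` (determined almost everywhere in `Ω` when it exists; zero by
convention when there is none). -/
def weakGradient {d : ℕ} (Ω : Set (EuclideanSpace ℝ (Fin d)))
    (u : EuclideanSpace ℝ (Fin d) → ℝ) :
    EuclideanSpace ℝ (Fin d) → EuclideanSpace ℝ (Fin d) :=
  if h : ∃ g, IsWeakGradient Ω u g then h.choose else 0

/-- The reaction-diffusion norm `(‖u‖²_{L²(Ω)} + ε ‖∇u‖²_{L²(Ω)})^{1/2}` on the open set `Ω`. -/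
def rdNorm {d : ℕ} (ε : ℝ) (Ω : Set (EuclideanSpace ℝ (Fin d)))
    (u : EuclideanSpace ℝ (Fin d) → ℝ) : ℝ :=
  Real.sqrt ((∫ x in Ω, u x ^ 2) + ε * ∫ x in Ω, ‖weakGradient Ω u x‖ ^ 2)

/-- The polynomial functions of total degree at most `ℓ` in `d` real variables. On a
nondegenerate simplex they are determined by, and hence identified with, their restrictions. -/
def polySpace (d ℓ : ℕ) : Set (EuclideanSpace ℝ (Fin d) → ℝ) :=
  {f | ∃ p : MvPolynomial (Fin d) ℝ, p.totalDegree ≤ ℓ ∧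
    ∀ x : EuclideanSpace ℝ (Fin d), f x = MvPolynomial.eval (fun i => x i) p}

/-- The functions that are continuous on `K₁ ∪ K₂` and coincide on each of `K₁` and `K₂` with a
polynomial of degree at most `ℓ`. Their values outside `K₁ ∪ K₂` are irrelevant. -/
def pairSpace {d : ℕ} (ℓ : ℕ) (K₁ K₂ : Set (EuclideanSpace ℝ (Fin d))) :
    Set (EuclideanSpace ℝ (Fin d) → ℝ) :=
  {v | ContinuousOn v (K₁ ∪ K₂) ∧ (∃ p ∈ polySpace d ℓ, Set.EqOn v p K₁) ∧
    ∃ p ∈ polySpace d ℓ, Set.EqOn v p K₂}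

/-- The best error `inf_{Q ∈ V} |||u - Q|||_Ω` in the reaction-diffusion norm. -/
def bestError {d : ℕ} (ε : ℝ) (Ω : Set (EuclideanSpace ℝ (Fin d)))
    (V : Set (EuclideanSpace ℝ (Fin d) → ℝ)) (u : EuclideanSpace ℝ (Fin d) → ℝ) : ℝ :=
  ⨅ Q : V, rdNorm ε Ω (u - (Q : EuclideanSpace ℝ (Fin d) → ℝ))

/-- `P` is a best approximation to `u` from `V` in the reaction-diffusion norm on `Ω`. -/
def IsBestApprox {d : ℕ} (ε : ℝ) (Ω : Set (EuclideanSpace ℝ (Fin d)))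
    (V : Set (EuclideanSpace ℝ (Fin d) → ℝ)) (u P : EuclideanSpace ℝ (Fin d) → ℝ) : Prop :=
  P ∈ V ∧ ∀ Q ∈ V, rdNorm ε Ω (u - P) ≤ rdNorm ε Ω (u - Q)

/-- The two (closed, nondegenerate) `d`-simplices `T₁` and `T₂` share the face `F`: their
intersection is `F`, and `F` is a `(d-1)`-dimensional face of both of them. -/
def ShareFace {d : ℕ} [NeZero d] (T₁ T₂ : Affine.Simplex ℝ (EuclideanSpace ℝ (Fin d)) d)
    (F : Set (EuclideanSpace ℝ (Fin d))) : Prop :=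
  T₁.closedInterior ∩ T₂.closedInterior = F ∧
    (∃ i, F = (T₁.faceOpposite i).closedInterior) ∧
    ∃ j, F = (T₂.faceOpposite j).closedInterior

/-- The maximum diameter of a ball contained in `K`. -/
def inscribedDiam {d : ℕ} (K : Set (EuclideanSpace ℝ (Fin d))) : ℝ :=
  sSup {δ : ℝ | ∃ (c : EuclideanSpace ℝ (Fin d)) (r : ℝ),
    0 ≤ r ∧ Metric.closedBall c r ⊆ K ∧ δ = 2 * r}

/-- The shape parameter `max {diam K₁, diam K₂} / min {ρ₁, ρ₂}` of a pair, where `ρᵢ` is the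
maximum diameter of a ball contained in `Kᵢ`. -/
def shapeParam {d : ℕ} (K₁ K₂ : Set (EuclideanSpace ℝ (Fin d))) : ℝ :=
  max (Metric.diam K₁) (Metric.diam K₂) / min (inscribedDiam K₁) (inscribedDiam K₂)

/-- The height `min {|K₁|, |K₂|} / |F|`, with the `d`-dimensional Lebesgue measure of the `Kᵢ` and
the `(d-1)`-dimensional (Euclidean) Hausdorff measure of `F`. -/
def faceHeight {d : ℕ} (K₁ K₂ F : Set (EuclideanSpace ℝ (Fin d))) : ℝ :=
  min (volume.real K₁) (volume.real K₂) /
    (Measure.euclideanHausdorffMeasure (d - 1)).real F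

/-- The squared `L²(F)`-norm with respect to the `(d-1)`-dimensional Hausdorff measure. -/
def faceNormSq {d : ℕ} (F : Set (EuclideanSpace ℝ (Fin d)))
    (f : EuclideanSpace ℝ (Fin d) → ℝ) : ℝ :=
  ∫ x in F, f x ^ 2 ∂(Measure.euclideanHausdorffMeasure (d - 1))

end

/-! All estimates are proved for a pair of convex bodies on the two sides of a hyperplane, each
containing its half of a ball of radius `r` about a point `z` of that hyperplane and contained in
the ball of radius `R * r` (`TwoSided`). A bound on the shape parameter puts every pair of simplices
in this position, with `R` depending only on `d` and `σ` (`ShareFace.exists_twoSided`). Polynomials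
of fixed degree form a finite-dimensional space, so their values and gradients are controlled, with
the right powers of `r`, by their L² norm on one small ball (`exists_poly_bound`).

Lower bound. If `v` is continuous with pieces `p₁`, `p₂`, then on the face the jump `P₁ - P₂` equals
`(P₁ - p₁) - (P₂ - p₂)`. Each difference is a polynomial whose L² norm is at most the sum of the
errors of `Pᵢ` and `pᵢ`, and the error of `Pᵢ` is the smaller one. Only L² norms enter, so `ε` plays
no role.

Upper bound. Let `Q` be the jump `P₁ - P₂` evaluated at the orthogonal projection onto the
hyperplane. The function equal to `P₁ - Q` on the first body and to `P₂` on the second is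
continuous, and only `Q` has to be estimated. Its L² norm is bounded by the jump term, because the
face contains a `(d-1)`-dimensional ball of radius `r` and the height is at least of order `r`
(`exists_le_face`).

The delicate term is `ε ‖∇Q‖²`: an inverse inequality costs `r⁻²`, so bounding it by the jump term
would bring in `ε / r²`. Instead `Q` is bounded in L² by `r` times the gradient errors
(`TwoSided.integral_jump_sq_le`). Since `Q` is constant in the normal direction, it can be written
through a normal difference of `u - v` across the face and the errors `u - Pᵢ` on either side. The
difference costs `r` times a normal derivative, in which `Q` does not appear. The errors have mean
zero, because constants are admissible in the best approximation, and Poincaré's inequality applies.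
The powers of `r` cancel and `ε` multiplies only the gradients of `u - Pᵢ`. -/

noncomputable section

/-! ### Polynomial functions -/

/-- The polynomial function on Euclidean space defined by a polynomial. -/
def polyEval (d : ℕ) : MvPolynomial (Fin d) ℝ →ₗ[ℝ] (EuclideanSpace ℝ (Fin d) → ℝ) where
  toFun := fun p x => MvPolynomial.eval (fun i => x i) p
  map_add' := fun p q => by ext x; simp
  map_smul' := fun a p => by ext x; simp [MvPolynomial.smul_eval]

/-- The polynomial functions of degree at most `ℓ` as a submodule of all functions. -/
def polySubmodule (d ℓ : ℕ) : Submodule ℝ (EuclideanSpace ℝ (Fin d) → ℝ) :=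
  (MvPolynomial.restrictTotalDegree (Fin d) ℝ ℓ).map (polyEval d)

theorem mem_polySubmodule {d ℓ : ℕ} {f : EuclideanSpace ℝ (Fin d) → ℝ} :
    f ∈ polySubmodule d ℓ ↔ f ∈ polySpace d ℓ := by
  constructor
  · rintro ⟨p, hp, rfl⟩
    exact ⟨p, (MvPolynomial.mem_restrictTotalDegree _ _ _).1 hp, fun x => rfl⟩
  · rintro ⟨p, hp, h⟩
    exact ⟨p, (MvPolynomial.mem_restrictTotalDegree _ _ _).2 hp, funext fun x => (h x).symm⟩

instance (d ℓ : ℕ) : Module.Finite ℝ (polySubmodule d ℓ) := by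
  unfold polySubmodule
  infer_instance

theorem polySpace_sub {d ℓ : ℕ} {f g : EuclideanSpace ℝ (Fin d) → ℝ} (hf : f ∈ polySpace d ℓ)
    (hg : g ∈ polySpace d ℓ) : f - g ∈ polySpace d ℓ :=
  mem_polySubmodule.1 ((polySubmodule d ℓ).sub_mem (mem_polySubmodule.2 hf) (mem_polySubmodule.2 hg))

theorem polySpace_add {d ℓ : ℕ} {f g : EuclideanSpace ℝ (Fin d) → ℝ} (hf : f ∈ polySpace d ℓ)
    (hg : g ∈ polySpace d ℓ) : f + g ∈ polySpace d ℓ :=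
  mem_polySubmodule.1 ((polySubmodule d ℓ).add_mem (mem_polySubmodule.2 hf) (mem_polySubmodule.2 hg))

theorem const_mem_polySpace (d ℓ : ℕ) (t : ℝ) : (fun _ => t) ∈ polySpace d ℓ :=
  ⟨MvPolynomial.C t, by simp, fun x => by simp⟩

theorem analyticOnNhd_of_mem_polySpace {d ℓ : ℕ} {p : EuclideanSpace ℝ (Fin d) → ℝ}
    (hp : p ∈ polySpace d ℓ) : AnalyticOnNhd ℝ p Set.univ := by
  obtain ⟨P, -, hP⟩ := hp
  have h : AnalyticOnNhd ℝ (fun x : EuclideanSpace ℝ (Fin d) =>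
      MvPolynomial.aeval (fun i => x i) P) Set.univ := by
    refine AnalyticOnNhd.aeval_mvPolynomial (fun i x _ => ?_) P
    exact (EuclideanSpace.proj i : EuclideanSpace ℝ (Fin d) →L[ℝ] ℝ).analyticAt x
  have e : p = fun x : EuclideanSpace ℝ (Fin d) => MvPolynomial.aeval (fun i => x i) P := by
    funext x
    rw [hP x]
    rfl
  rw [e]
  exact h

theorem contDiff_of_mem_polySpace {d ℓ : ℕ} {p : EuclideanSpace ℝ (Fin d) → ℝ}
    (hp : p ∈ polySpace d ℓ) : ContDiff ℝ ∞ p :=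
  contDiff_iff_contDiffAt.2 fun x =>
    (analyticOnNhd_of_mem_polySpace hp x trivial).contDiffAt

theorem continuous_of_mem_polySpace {d ℓ : ℕ} {p : EuclideanSpace ℝ (Fin d) → ℝ}
    (hp : p ∈ polySpace d ℓ) : Continuous p := (contDiff_of_mem_polySpace hp).continuous

theorem differentiable_of_mem_polySpace {d ℓ : ℕ} {p : EuclideanSpace ℝ (Fin d) → ℝ}
    (hp : p ∈ polySpace d ℓ) : Differentiable ℝ p :=
  (contDiff_of_mem_polySpace hp).differentiable (by simp)

theorem eq_zero_of_mem_polySpace_of_eqOn_ball {d ℓ : ℕ} {p : EuclideanSpace ℝ (Fin d) → ℝ}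
    (hp : p ∈ polySpace d ℓ) {z : EuclideanSpace ℝ (Fin d)} {r : ℝ} (hr : 0 < r)
    (h : ∀ x ∈ Metric.ball z r, p x = 0) : p = 0 := by
  refine (analyticOnNhd_of_mem_polySpace hp).eq_of_eventuallyEq (z₀ := z)
    (fun x _ => analyticAt_const) ?_
  filter_upwards [Metric.ball_mem_nhds z hr] with x hx using h x hx

/-- Substituting polynomials of degree at most 1 for the variables does not raise the total degree.
This serves scaling, isometric coordinates on the hyperplane, and composition with the projection
onto it. -/
theorem polySpace_comp_affineMap {n d ℓ : ℕ} {p : EuclideanSpace ℝ (Fin d) → ℝ}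
    (hp : p ∈ polySpace d ℓ) (f : EuclideanSpace ℝ (Fin n) →ᵃ[ℝ] EuclideanSpace ℝ (Fin d)) :
    (fun x => p (f x)) ∈ polySpace n ℓ := by
  obtain ⟨P, hPd, hP⟩ := hp
  let l : Fin d → MvPolynomial (Fin n) ℝ := fun i =>
    MvPolynomial.C (f 0 i) +
      ∑ j, MvPolynomial.C (f.linear (EuclideanSpace.single j 1) i) * MvPolynomial.X j
  have hl : ∀ i, (l i).totalDegree ≤ 1 := by
    intro i
    refine (MvPolynomial.totalDegree_add _ _).trans (max_le (by simp) ?_)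
    refine MvPolynomial.totalDegree_finsetSum_le fun j _ => ?_
    refine (MvPolynomial.totalDegree_mul _ _).trans ?_
    simp
  have hle : ∀ i (x : EuclideanSpace ℝ (Fin n)), MvPolynomial.eval (fun j => x j) (l i) = f x i := by
    intro i x
    have hx : x = ∑ j, x j • EuclideanSpace.single j (1 : ℝ) := by
      ext k
      simp [Finset.sum_apply, Pi.single_apply]
    have h1 : f x = f.linear x + f 0 := by
      have := f.map_vadd 0 x
      simpa using this
    have h2 : f.linear x = ∑ j, x j • f.linear (EuclideanSpace.single j (1 : ℝ)) := by
      conv_lhs => rw [hx]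
      simp only [map_sum, map_smul]
    rw [h1, h2]
    simp [l, mul_comm, add_comm]
  refine ⟨MvPolynomial.eval₂ MvPolynomial.C l P, ?_, fun x => ?_⟩
  · rw [MvPolynomial.eval₂_eq']
    refine MvPolynomial.totalDegree_finsetSum_le fun s hs => ?_
    refine (MvPolynomial.totalDegree_mul _ _).trans ?_
    rw [MvPolynomial.totalDegree_C, zero_add]
    refine (MvPolynomial.totalDegree_finsetProd _ _).trans ?_
    have h1 : ∀ i ∈ Finset.univ, (l i ^ s i).totalDegree ≤ s i := fun i _ =>
      (MvPolynomial.totalDegree_pow _ _).trans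
        ((Nat.mul_le_mul_left _ (hl i)).trans (by simp))
    refine (Finset.sum_le_sum h1).trans ?_
    have h2 := (MvPolynomial.le_totalDegree hs).trans hPd
    rwa [Finsupp.sum_fintype _ _ (fun _ => rfl)] at h2
  · change p (f x) = _
    rw [hP, MvPolynomial.eval₂_eq', MvPolynomial.eval_eq']
    simp [hle]

/-- In coordinates with respect to a basis, the squared L² norm on the unit ball is continuous,
homogeneous of degree two, and positive on the unit sphere, since a polynomial vanishing on a ball
is zero. By compactness it dominates the squared coordinate norm, while values and derivatives on a
bounded set are bounded linearly in the coordinates. -/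
theorem exists_poly_bound_unit (n ℓ : ℕ) (R : ℝ) : ∃ C : ℝ, 0 < C ∧
    ∀ p ∈ polySpace n ℓ, ∀ y ∈ Metric.closedBall (0 : EuclideanSpace ℝ (Fin n)) R,
      p y ^ 2 ≤ C * ∫ x in Metric.closedBall (0 : EuclideanSpace ℝ (Fin n)) 1, p x ^ 2 ∧
      ‖fderiv ℝ p y‖ ^ 2 ≤
        C * ∫ x in Metric.closedBall (0 : EuclideanSpace ℝ (Fin n)) 1, p x ^ 2 := by
  classical
  set b := Module.finBasis ℝ (polySubmodule n ℓ) with hb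
  set m := Module.finrank ℝ (polySubmodule n ℓ)
  have hbm : ∀ k, (b k : EuclideanSpace ℝ (Fin n) → ℝ) ∈ polySpace n ℓ :=
    fun k => mem_polySubmodule.1 (b k).2
  set B : Set (EuclideanSpace ℝ (Fin n)) := Metric.closedBall 0 1
  let S : (Fin m → ℝ) → EuclideanSpace ℝ (Fin n) → ℝ := fun c x =>
    ∑ k, c k * (b k : EuclideanSpace ℝ (Fin n) → ℝ) x
  have hScoe : ∀ c, S c = ((∑ k, c k • b k : polySubmodule n ℓ) : EuclideanSpace ℝ (Fin n) → ℝ) := by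
    intro c
    funext x
    simp [S, Finset.sum_apply]
  have hSmem : ∀ c, S c ∈ polySpace n ℓ := fun c => by
    rw [hScoe]; exact mem_polySubmodule.1 (Subtype.property _)
  let Q : (Fin m → ℝ) → ℝ := fun c => ∫ x in B, S c x ^ 2
  have hQc : Continuous Q := by
    refine continuous_parametric_integral_of_continuous ?_ (isCompact_closedBall _ _)
    have hk : ∀ k, Continuous (b k : EuclideanSpace ℝ (Fin n) → ℝ) :=
      fun k => continuous_of_mem_polySpace (hbm k)
    refine Continuous.pow ?_ 2
    refine continuous_finsetSum _ fun k _ => ?_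
    exact ((continuous_apply k).comp continuous_fst).mul ((hk k).comp continuous_snd)
  have hQpos : ∀ c ∈ Metric.sphere (0 : Fin m → ℝ) 1, 0 < Q c := by
    intro c hc
    have hQ0 : 0 ≤ Q c := integral_nonneg fun x => sq_nonneg _
    refine hQ0.lt_of_ne fun h0 => ?_
    have hcont : Continuous fun x => S c x ^ 2 := (continuous_of_mem_polySpace (hSmem c)).pow 2
    have h1 : (fun x => S c x ^ 2) =ᵐ[volume.restrict B] 0 :=
      (integral_eq_zero_iff_of_nonneg (fun x => sq_nonneg _)
        (hcont.continuousOn.integrableOn_compact (isCompact_closedBall _ _))).1 h0.symm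
    have h2 : Set.EqOn (fun x => S c x ^ 2) 0 (Metric.ball 0 1) :=
      Measure.eqOn_open_of_ae_eq (ae_restrict_of_ae_restrict_of_subset
        Metric.ball_subset_closedBall h1) Metric.isOpen_ball hcont.continuousOn
          continuousOn_const
    have h3 : S c = 0 := eq_zero_of_mem_polySpace_of_eqOn_ball (hSmem c) one_pos
      fun x hx => by simpa using h2 hx
    rw [hScoe] at h3
    have h4 : (∑ k, c k • b k : polySubmodule n ℓ) = 0 := Subtype.ext h3
    have h5 : c = 0 := funext (Fintype.linearIndependent_iff.1 b.linearIndependent c h4)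
    rw [h5] at hc
    simp at hc
  obtain ⟨δ, hδ, hδQ⟩ := (isCompact_sphere (0 : Fin m → ℝ) 1).exists_forall_le'
    hQc.continuousOn hQpos
  have hQlow : ∀ c, δ * ‖c‖ ^ 2 ≤ Q c := by
    intro c
    rcases eq_or_ne c 0 with rfl | hc
    · simpa using (integral_nonneg fun x => sq_nonneg _ : 0 ≤ Q 0)
    have hc' : ‖c‖ ≠ 0 := norm_ne_zero_iff.2 hc
    have h1 := hδQ (‖c‖⁻¹ • c) (by simp [norm_smul, hc'])
    have h2 : Q (‖c‖⁻¹ • c) = (‖c‖⁻¹) ^ 2 * Q c := by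
      simp only [Q]
      rw [← integral_const_mul]
      congr 1
      funext x
      rw [← mul_pow]
      congr 1
      simp only [S, Finset.mul_sum, Pi.smul_apply, smul_eq_mul, mul_assoc]
    rw [h2, inv_pow, inv_mul_eq_div, le_div_iff₀ (by positivity)] at h1
    exact h1
  obtain ⟨M, hM0, hM⟩ : ∃ M : ℝ, 0 ≤ M ∧ ∀ k, ∀ y ∈ Metric.closedBall (0 : EuclideanSpace ℝ (Fin n)) R,
      |(b k : EuclideanSpace ℝ (Fin n) → ℝ) y| ≤ M ∧
      ‖fderiv ℝ (b k : EuclideanSpace ℝ (Fin n) → ℝ) y‖ ≤ M := by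
    have : ∀ k, ∃ M : ℝ, ∀ y ∈ Metric.closedBall (0 : EuclideanSpace ℝ (Fin n)) R,
      |(b k : EuclideanSpace ℝ (Fin n) → ℝ) y| +
      ‖fderiv ℝ (b k : EuclideanSpace ℝ (Fin n) → ℝ) y‖ ≤ M := by
      intro k
      have hcd := contDiff_of_mem_polySpace (hbm k)
      have hcont : Continuous fun y => |(b k : EuclideanSpace ℝ (Fin n) → ℝ) y| +
          ‖fderiv ℝ (b k : EuclideanSpace ℝ (Fin n) → ℝ) y‖ :=
        hcd.continuous.abs.add (hcd.continuous_fderiv (by simp)).norm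
      obtain ⟨M, hM⟩ := (isCompact_closedBall (0 : EuclideanSpace ℝ (Fin n)) R).bddAbove_image
        hcont.continuousOn
      exact ⟨M, fun y hy => hM ⟨y, hy, rfl⟩⟩
    choose M hM using this
    refine ⟨∑ k, |M k|, Finset.sum_nonneg fun _ _ => abs_nonneg _, fun k y hy => ?_⟩
    have h1 : M k ≤ ∑ k, |M k| := (le_abs_self _).trans
      (Finset.single_le_sum (f := fun k => |M k|) (fun _ _ => abs_nonneg _) (Finset.mem_univ k))
    have h2 := hM k y hy
    have h3 := abs_nonneg ((b k : EuclideanSpace ℝ (Fin n) → ℝ) y)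
    have h4 := norm_nonneg (fderiv ℝ (b k : EuclideanSpace ℝ (Fin n) → ℝ) y)
    constructor <;> linarith
  have hsum : ∀ c : Fin m → ℝ, ∑ k, |c k| * M ≤ m * M * ‖c‖ := by
    intro c
    calc ∑ k, |c k| * M ≤ ∑ k : Fin m, ‖c‖ * M :=
          Finset.sum_le_sum fun k _ => mul_le_mul_of_nonneg_right (norm_le_pi_norm c k) hM0
      _ = m * M * ‖c‖ := by simp; ring
  -- The added 1 only makes the constant positive, as `m * M` may vanish.
  refine ⟨(m * M) ^ 2 / δ + 1, by positivity, fun p hp y hy => ?_⟩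
  obtain ⟨c, rfl⟩ : ∃ c, S c = p := by
    refine ⟨b.repr ⟨p, mem_polySubmodule.2 hp⟩, ?_⟩
    rw [hScoe, b.sum_repr]
  have key : ∀ a : ℝ, 0 ≤ a → a ≤ m * M * ‖c‖ →
      a ^ 2 ≤ ((m * M) ^ 2 / δ + 1) * ∫ x in B, S c x ^ 2 := by
    intro a ha0 ha
    have h0 : 0 ≤ Q c := integral_nonneg fun x => sq_nonneg _
    have h1 := hQlow c
    have h2 : ‖c‖ ^ 2 ≤ Q c / δ := by rw [le_div_iff₀ hδ]; linarith
    calc a ^ 2 ≤ (m * M * ‖c‖) ^ 2 := by gcongr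
      _ = (m * M) ^ 2 * ‖c‖ ^ 2 := by ring
      _ ≤ (m * M) ^ 2 * (Q c / δ) := by gcongr
      _ ≤ ((m * M) ^ 2 / δ + 1) * Q c := by rw [add_mul, div_mul_eq_mul_div, mul_div_assoc]; linarith
  constructor
  · rw [← sq_abs]
    refine key _ (abs_nonneg _) ((Finset.abs_sum_le_sum_abs _ _).trans
      ((Finset.sum_le_sum fun k _ => ?_).trans (hsum c)))
    rw [abs_mul]
    exact mul_le_mul_of_nonneg_left (hM k y hy).1 (abs_nonneg _)
  · refine key _ (norm_nonneg _) ?_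
    have h1 : fderiv ℝ (S c) y =
        ∑ k, c k • fderiv ℝ (b k : EuclideanSpace ℝ (Fin n) → ℝ) y := by
      have : ∀ k ∈ Finset.univ, HasFDerivAt
          (fun x => c k * (b k : EuclideanSpace ℝ (Fin n) → ℝ) x)
          (c k • fderiv ℝ (b k : EuclideanSpace ℝ (Fin n) → ℝ) y) y := fun k _ =>
        (differentiable_of_mem_polySpace (hbm k) y).hasFDerivAt.const_mul (c k)
      exact (HasFDerivAt.fun_sum this).fderiv
    rw [h1]
    refine (norm_sum_le _ _).trans ((Finset.sum_le_sum fun k _ => ?_).trans (hsum c))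
    rw [norm_smul, Real.norm_eq_abs]
    exact mul_le_mul_of_nonneg_left (hM k y hy).2 (abs_nonneg _)

/-- Equivalence of norms on polynomials and Markov's inequality, in scaled form. -/
theorem exists_poly_bound (n ℓ : ℕ) (R : ℝ) : ∃ C : ℝ, 0 < C ∧
    ∀ p ∈ polySpace n ℓ, ∀ (z : EuclideanSpace ℝ (Fin n)) (r : ℝ), 0 < r →
      ∀ y ∈ Metric.closedBall z (R * r),
      p y ^ 2 ≤ C * ((r ^ n)⁻¹ * ∫ x in Metric.closedBall z r, p x ^ 2) ∧
      ‖fderiv ℝ p y‖ ^ 2 ≤ C * ((r ^ 2)⁻¹ * ((r ^ n)⁻¹ * ∫ x in Metric.closedBall z r, p x ^ 2)) := by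
  obtain ⟨C, hC, H⟩ := exists_poly_bound_unit n ℓ R
  refine ⟨C, hC, fun p hp z r hr y hy => ?_⟩
  let f : EuclideanSpace ℝ (Fin n) →ᵃ[ℝ] EuclideanSpace ℝ (Fin n) :=
    (r • LinearMap.id (R := ℝ) (M := EuclideanSpace ℝ (Fin n))).toAffineMap +
      AffineMap.const ℝ _ z
  have hf : ∀ x, f x = r • x + z := fun x => by simp [f]
  have hpf : (fun x => p (r • x + z)) ∈ polySpace n ℓ := by
    simpa only [hf] using polySpace_comp_affineMap hp f
  have hint : ∫ x in Metric.closedBall (0 : EuclideanSpace ℝ (Fin n)) 1, p (r • x + z) ^ 2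
      = (r ^ n)⁻¹ * ∫ x in Metric.closedBall z r, p x ^ 2 := by
    rw [Measure.setIntegral_comp_smul_of_pos volume (fun x => p (x + z) ^ 2) _ hr]
    rw [finrank_euclideanSpace, Fintype.card_fin, smul_eq_mul]
    congr 1
    have h1 := (measurePreserving_add_right (volume : Measure (EuclideanSpace ℝ (Fin n))) z).setIntegral_preimage_emb
      (measurableEmbedding_addRight z) (fun x => p x ^ 2) (Metric.closedBall z r)
    rw [← h1]
    congr 2
    rw [smul_unitClosedBall, Real.norm_of_nonneg hr.le]
    ext x
    simp
  set y' := r⁻¹ • (y - z) with hy'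
  have hyy : r • y' + z = y := by simp [hy', smul_smul, hr.ne']
  have hy'm : y' ∈ Metric.closedBall (0 : EuclideanSpace ℝ (Fin n)) R := by
    rw [mem_closedBall_zero_iff, hy', norm_smul, norm_inv, Real.norm_of_nonneg hr.le,
      inv_mul_le_iff₀ hr]
    rw [mem_closedBall_iff_norm] at hy
    linarith
  obtain ⟨h1, h2⟩ := H _ hpf y' hy'm
  rw [hint] at h1 h2
  rw [hyy] at h1
  refine ⟨h1, ?_⟩
  have hder : fderiv ℝ (fun x => p (r • x + z)) y' = r • fderiv ℝ p y := by
    have ha : HasFDerivAt (fun x : EuclideanSpace ℝ (Fin n) => r • x + z)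
        (r • ContinuousLinearMap.id ℝ _) y' := ((hasFDerivAt_id y').const_smul r).add_const z
    have hb : HasFDerivAt p (fderiv ℝ p y) (r • y' + z) := by
      rw [hyy]; exact (differentiable_of_mem_polySpace hp y).hasFDerivAt
    have hc := hb.comp y' ha
    rw [show (fun x => p (r • x + z)) = p ∘ fun x => r • x + z from rfl, hc.fderiv]
    ext v
    simp
  rw [hder, norm_smul, mul_pow, Real.norm_of_nonneg hr.le] at h2
  have hr2 : 0 < r ^ 2 := by positivity
  calc ‖fderiv ℝ p y‖ ^ 2 = (r ^ 2)⁻¹ * (r ^ 2 * ‖fderiv ℝ p y‖ ^ 2) := by field_simp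
    _ ≤ (r ^ 2)⁻¹ * (C * ((r ^ n)⁻¹ * ∫ x in Metric.closedBall z r, p x ^ 2)) := by gcongr
    _ = _ := by ring

/-! ### Weak gradients -/

theorem inner_gradient_eq {d : ℕ} (p : EuclideanSpace ℝ (Fin d) → ℝ)
    (x w : EuclideanSpace ℝ (Fin d)) : inner ℝ (gradient p x) w = fderiv ℝ p x w :=
  InnerProductSpace.toDual_symm_apply

theorem norm_gradient_eq {d : ℕ} (p : EuclideanSpace ℝ (Fin d) → ℝ)
    (x : EuclideanSpace ℝ (Fin d)) : ‖gradient p x‖ = ‖fderiv ℝ p x‖ :=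
  LinearIsometryEquiv.norm_map _ _

theorem continuous_gradient {d : ℕ} {p : EuclideanSpace ℝ (Fin d) → ℝ} (hp : ContDiff ℝ ∞ p) :
    Continuous (gradient p) :=
  (LinearIsometryEquiv.continuous _).comp (hp.continuous_fderiv (by simp))

section TestFunctions

variable {d : ℕ} {Ω : Set (EuclideanSpace ℝ (Fin d))} {φ : EuclideanSpace ℝ (Fin d) → ℝ}

theorem integrable_mul_of_tsupport_subset {f : EuclideanSpace ℝ (Fin d) → ℝ}
    (hf : LocallyIntegrableOn f Ω volume) (hφ : Continuous φ) (hc : HasCompactSupport φ)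
    (hs : tsupport φ ⊆ Ω) : Integrable (fun x => f x * φ x) volume := by
  have h1 : IntegrableOn f (tsupport φ) volume := hf.integrableOn_compact_subset hs hc
  have h2 : IntegrableOn (fun x => f x * φ x) (tsupport φ) volume :=
    h1.mul_continuousOn hφ.continuousOn hc
  refine (integrableOn_iff_integrable_of_support_subset ?_).1 h2
  exact (Function.support_mul_subset_right _ _).trans (subset_tsupport _)

theorem setIntegral_mul_eq_integral {f : EuclideanSpace ℝ (Fin d) → ℝ} (hs : tsupport φ ⊆ Ω) :
    ∫ x in Ω, f x * φ x = ∫ x, f x * φ x := by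
  refine setIntegral_eq_integral_of_forall_compl_eq_zero fun x hx => ?_
  rw [image_eq_zero_of_notMem_tsupport fun h => hx (hs h), mul_zero]

theorem hasCompactSupport_fderiv_apply (hc : HasCompactSupport φ) (w : EuclideanSpace ℝ (Fin d)) :
    HasCompactSupport fun x => fderiv ℝ φ x w := hc.fderiv_apply ℝ w

theorem continuous_fderiv_apply_const (hφ : ContDiff ℝ ∞ φ) (w : EuclideanSpace ℝ (Fin d)) :
    Continuous fun x => fderiv ℝ φ x w :=
  (hφ.continuous_fderiv (by simp)).clm_apply continuous_const

end TestFunctions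

theorem LocallyIntegrableOn.inner_right_const {d : ℕ} {Ω : Set (EuclideanSpace ℝ (Fin d))}
    {g : EuclideanSpace ℝ (Fin d) → EuclideanSpace ℝ (Fin d)}
    (hg : LocallyIntegrableOn g Ω volume) (w : EuclideanSpace ℝ (Fin d)) :
    LocallyIntegrableOn (fun x => inner ℝ (g x) w) Ω volume := by
  intro x hx
  obtain ⟨t, ht, hgt⟩ := hg x hx
  exact ⟨t, ht, Integrable.inner_const hgt w⟩

/-- The fundamental lemma of the calculus of variations, one coordinate at a time. It makes the
arbitrary choice in `weakGradient` harmless: `rdNorm` can be computed from any weak gradient. -/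
theorem IsWeakGradient.ae_eq {d : ℕ} {Ω : Set (EuclideanSpace ℝ (Fin d))} (hΩ : IsOpen Ω)
    {u : EuclideanSpace ℝ (Fin d) → ℝ}
    {g g' : EuclideanSpace ℝ (Fin d) → EuclideanSpace ℝ (Fin d)}
    (h : IsWeakGradient Ω u g) (h' : IsWeakGradient Ω u g') : g =ᵐ[volume.restrict Ω] g' := by
  have key : ∀ i : Fin d, ∀ᵐ x, x ∈ Ω → inner ℝ (g x) (EuclideanSpace.single i (1 : ℝ)) -
      inner ℝ (g' x) (EuclideanSpace.single i (1 : ℝ)) = 0 := by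
    intro i
    set w := EuclideanSpace.single i (1 : ℝ)
    have hg := LocallyIntegrableOn.inner_right_const h.2.1 w
    have hg' := LocallyIntegrableOn.inner_right_const h'.2.1 w
    refine hΩ.ae_eq_zero_of_integral_contDiff_smul_eq_zero (hg.sub hg') fun φ hφ hc hs => ?_
    have e1 := h.2.2 φ hφ hc hs w
    have e2 := h'.2.2 φ hφ hc hs w
    rw [setIntegral_mul_eq_integral (f := fun x => inner ℝ (g x) w) hs] at e1
    rw [setIntegral_mul_eq_integral (f := fun x => inner ℝ (g' x) w) hs] at e2
    have e3 : ∫ x, φ x • (inner ℝ (g x) w - inner ℝ (g' x) w) =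
        (∫ x, inner ℝ (g x) w * φ x) - ∫ x, inner ℝ (g' x) w * φ x := by
      rw [← integral_sub (integrable_mul_of_tsupport_subset hg hφ.continuous hc hs)
        (integrable_mul_of_tsupport_subset hg' hφ.continuous hc hs)]
      congr 1
      funext x
      simp only [smul_eq_mul]
      ring
    exact e3.trans (by linarith)
  rw [Filter.EventuallyEq, ae_restrict_iff' hΩ.measurableSet]
  filter_upwards [ae_all_iff.2 key] with x hx hxΩ
  ext i
  have := hx i hxΩ
  simpa [EuclideanSpace.inner_single_right, sub_eq_zero] using this

theorem IsWeakGradient.weakGradient_ae_eq {d : ℕ} {Ω : Set (EuclideanSpace ℝ (Fin d))}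
    (hΩ : IsOpen Ω) {u : EuclideanSpace ℝ (Fin d) → ℝ}
    {g : EuclideanSpace ℝ (Fin d) → EuclideanSpace ℝ (Fin d)}
    (h : IsWeakGradient Ω u g) : weakGradient Ω u =ᵐ[volume.restrict Ω] g := by
  have hex : ∃ g, IsWeakGradient Ω u g := ⟨g, h⟩
  rw [weakGradient, dif_pos hex]
  exact hex.choose_spec.ae_eq hΩ h

theorem IsWeakGradient.rdNorm_sq {d : ℕ} {Ω : Set (EuclideanSpace ℝ (Fin d))}
    (hΩ : IsOpen Ω) {u : EuclideanSpace ℝ (Fin d) → ℝ}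
    {g : EuclideanSpace ℝ (Fin d) → EuclideanSpace ℝ (Fin d)}
    (h : IsWeakGradient Ω u g) {ε : ℝ} (hε : 0 ≤ ε) :
    rdNorm ε Ω u ^ 2 = (∫ x in Ω, u x ^ 2) + ε * ∫ x in Ω, ‖g x‖ ^ 2 := by
  have e : ∫ x in Ω, ‖weakGradient Ω u x‖ ^ 2 = ∫ x in Ω, ‖g x‖ ^ 2 := by
    refine integral_congr_ae ?_
    filter_upwards [h.weakGradient_ae_eq hΩ] with x hx
    rw [hx]
  rw [rdNorm, e, Real.sq_sqrt]
  have h1 : 0 ≤ ∫ x in Ω, u x ^ 2 := integral_nonneg fun x => sq_nonneg _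
  have h2 : 0 ≤ ∫ x in Ω, ‖g x‖ ^ 2 := integral_nonneg fun x => sq_nonneg _
  positivity

theorem IsWeakGradient.sub {d : ℕ} {Ω : Set (EuclideanSpace ℝ (Fin d))}
    {u v : EuclideanSpace ℝ (Fin d) → ℝ}
    {g g' : EuclideanSpace ℝ (Fin d) → EuclideanSpace ℝ (Fin d)}
    (h : IsWeakGradient Ω u g) (h' : IsWeakGradient Ω v g') :
    IsWeakGradient Ω (u - v) (g - g') := by
  refine ⟨h.1.sub h'.1, h.2.1.sub h'.2.1, fun φ hφ hc hs w => ?_⟩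
  have hw := continuous_fderiv_apply_const hφ w
  have hcw := hasCompactSupport_fderiv_apply hc w
  have hsw := (tsupport_fderiv_apply_subset ℝ (f := φ) w).trans hs
  have e1 := h.2.2 φ hφ hc hs w
  have e2 := h'.2.2 φ hφ hc hs w
  simp only [Pi.sub_apply, inner_sub_left, sub_mul]
  rw [integral_sub (integrable_mul_of_tsupport_subset h.1 hw hcw hsw).integrableOn
      (integrable_mul_of_tsupport_subset h'.1 hw hcw hsw).integrableOn, e1, e2,
    integral_sub (integrable_mul_of_tsupport_subset
        (LocallyIntegrableOn.inner_right_const h.2.1 w) hφ.continuous hc hs).integrableOn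
      (integrable_mul_of_tsupport_subset
        (LocallyIntegrableOn.inner_right_const h'.2.1 w) hφ.continuous hc hs).integrableOn]
  ring

theorem IsWeakGradient.add {d : ℕ} {Ω : Set (EuclideanSpace ℝ (Fin d))}
    {u v : EuclideanSpace ℝ (Fin d) → ℝ}
    {g g' : EuclideanSpace ℝ (Fin d) → EuclideanSpace ℝ (Fin d)}
    (h : IsWeakGradient Ω u g) (h' : IsWeakGradient Ω v g') :
    IsWeakGradient Ω (u + v) (g + g') := by
  refine ⟨h.1.add h'.1, h.2.1.add h'.2.1, fun φ hφ hc hs w => ?_⟩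
  have hw := continuous_fderiv_apply_const hφ w
  have hcw := hasCompactSupport_fderiv_apply hc w
  have hsw := (tsupport_fderiv_apply_subset ℝ (f := φ) w).trans hs
  have e1 := h.2.2 φ hφ hc hs w
  have e2 := h'.2.2 φ hφ hc hs w
  simp only [Pi.add_apply, inner_add_left, add_mul]
  rw [integral_add (integrable_mul_of_tsupport_subset h.1 hw hcw hsw).integrableOn
      (integrable_mul_of_tsupport_subset h'.1 hw hcw hsw).integrableOn, e1, e2,
    integral_add (integrable_mul_of_tsupport_subset
        (LocallyIntegrableOn.inner_right_const h.2.1 w) hφ.continuous hc hs).integrableOn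
      (integrable_mul_of_tsupport_subset
        (LocallyIntegrableOn.inner_right_const h'.2.1 w) hφ.continuous hc hs).integrableOn]
  ring

theorem IsWeakGradient.mono {d : ℕ} {Ω Ω' : Set (EuclideanSpace ℝ (Fin d))}
    {u : EuclideanSpace ℝ (Fin d) → ℝ}
    {g : EuclideanSpace ℝ (Fin d) → EuclideanSpace ℝ (Fin d)}
    (h : IsWeakGradient Ω u g) (hsub : Ω' ⊆ Ω) : IsWeakGradient Ω' u g := by
  refine ⟨h.1.mono_set hsub, h.2.1.mono_set hsub, fun φ hφ hc hs w => ?_⟩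
  have hsw := (tsupport_fderiv_apply_subset ℝ (f := φ) w).trans hs
  have e := h.2.2 φ hφ hc (hs.trans hsub) w
  rw [setIntegral_mul_eq_integral (hsw.trans hsub),
    setIntegral_mul_eq_integral (f := fun x => inner ℝ (g x) w) (hs.trans hsub)] at e
  rw [setIntegral_mul_eq_integral hsw,
    setIntegral_mul_eq_integral (f := fun x => inner ℝ (g x) w) hs, e]

theorem LocallyIntegrableOn.congr_eqOn {E F : Type*} [TopologicalSpace E] [MeasurableSpace E]
    [OpensMeasurableSpace E] [NormedAddCommGroup F] {Ω : Set E} (hΩ : IsOpen Ω) {μ : Measure E}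
    {f f' : E → F} (h : LocallyIntegrableOn f Ω μ) (e : Set.EqOn f f' Ω) :
    LocallyIntegrableOn f' Ω μ := by
  intro x hx
  obtain ⟨t, ht, hft⟩ := h x hx
  refine ⟨t ∩ Ω, Filter.inter_mem ht self_mem_nhdsWithin, ?_⟩
  have h1 : IntegrableOn f (t ∩ Ω) μ := hft.mono_set Set.inter_subset_left
  have h2 : f =ᵐ[μ.restrict (t ∩ Ω)] f' := by
    refine ae_restrict_of_ae_restrict_of_subset Set.inter_subset_right ?_
    exact (ae_restrict_iff' hΩ.measurableSet).2 (Filter.Eventually.of_forall fun x hx => e hx)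
  exact Integrable.congr h1 h2

theorem IsWeakGradient.congr {d : ℕ} {Ω : Set (EuclideanSpace ℝ (Fin d))} (hΩ : IsOpen Ω)
    {u u' : EuclideanSpace ℝ (Fin d) → ℝ}
    {g g' : EuclideanSpace ℝ (Fin d) → EuclideanSpace ℝ (Fin d)}
    (h : IsWeakGradient Ω u g) (hu : Set.EqOn u u' Ω) (hg : Set.EqOn g g' Ω) :
    IsWeakGradient Ω u' g' := by
  refine ⟨LocallyIntegrableOn.congr_eqOn hΩ h.1 hu, LocallyIntegrableOn.congr_eqOn hΩ h.2.1 hg,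
    fun φ hφ hc hs w => ?_⟩
  have e := h.2.2 φ hφ hc hs w
  have e1 : ∫ x in Ω, u x * fderiv ℝ φ x w = ∫ x in Ω, u' x * fderiv ℝ φ x w :=
    setIntegral_congr_fun hΩ.measurableSet fun x hx => by simp only [hu hx]
  have e2 : ∫ x in Ω, inner ℝ (g x) w * φ x = ∫ x in Ω, inner ℝ (g' x) w * φ x :=
    setIntegral_congr_fun hΩ.measurableSet fun x hx => by simp only [hg hx]
  rw [← e1, ← e2, e]

/-! ### Gradients of functions that are smooth on a half-space -/

theorem volume_affine_zero_set {d : ℕ} (l : EuclideanSpace ℝ (Fin d) →ᵃ[ℝ] ℝ)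
    (hl : ∃ x, l x ≠ 0) : volume {x | l x = 0} = 0 := by
  have h := Measure.addHaar_affineSubspace (volume : Measure (EuclideanSpace ℝ (Fin d)))
    ((affineSpan ℝ {(0 : ℝ)}).comap l) (by
      intro htop
      obtain ⟨x, hx⟩ := hl
      have : x ∈ (affineSpan ℝ {(0 : ℝ)}).comap l := by rw [htop]; trivial
      rw [AffineSubspace.mem_comap, AffineSubspace.mem_affineSpan_singleton] at this
      exact hx this)
  convert h using 2
  ext x
  simp

/-- A segment joining the two sides meets the hyperplane, where `f` vanishes, at a point no farther
from its positive end than the other end is. -/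
theorem lipschitzWith_indicator_of_affine {d : ℕ} (l : EuclideanSpace ℝ (Fin d) →ᵃ[ℝ] ℝ)
    {f : EuclideanSpace ℝ (Fin d) → ℝ} {L : NNReal} (hf : LipschitzWith L f)
    (h0 : ∀ x, l x = 0 → f x = 0) : LipschitzWith L ({x | 0 < l x}.indicator f) := by
  have key : ∀ x y, 0 < l x → l y ≤ 0 → dist (f x) 0 ≤ L * dist x y := by
    intro x y hx hy
    set t := l x / (l x - l y) with ht
    have hpos : 0 < l x - l y := by linarith
    have ht1 : t ≤ 1 := by rw [ht, div_le_one hpos]; linarith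
    have ht0 : 0 ≤ t := by positivity
    have hz : l (AffineMap.lineMap x y t) = 0 := by
      rw [AffineMap.apply_lineMap, AffineMap.lineMap_apply]
      simp only [vsub_eq_sub, smul_eq_mul, vadd_eq_add, ht]
      field_simp
      ring
    have h1 := hf.dist_le_mul x (AffineMap.lineMap x y t)
    rw [h0 _ hz, dist_left_lineMap, Real.norm_of_nonneg ht0] at h1
    refine h1.trans (mul_le_mul_of_nonneg_left ?_ L.2)
    exact mul_le_of_le_one_left dist_nonneg ht1
  refine LipschitzWith.of_dist_le_mul fun x y => ?_
  by_cases hx : 0 < l x <;> by_cases hy : 0 < l y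
  · simpa [Set.indicator, hx, hy] using hf.dist_le_mul x y
  · simpa [Set.indicator, hx, hy] using key x y hx (not_lt.1 hy)
  · have := key y x hy (not_lt.1 hx)
    rw [dist_comm y x, dist_comm _ (0 : ℝ)] at this
    simpa [Set.indicator, hx, hy] using this
  · simp only [Set.indicator, Set.mem_ofPred_eq, hx, hy, if_false, dist_self]
    positivity

/-- The truncated function is Lipschitz with compact support, so its directional derivatives
integrate to zero. Off the hyperplane, a null set, they are the truncated derivatives of `f`. -/
theorem integral_indicator_fderiv_eq_zero {d : ℕ} (l : EuclideanSpace ℝ (Fin d) →ᵃ[ℝ] ℝ)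
    (hl : ∃ x, l x ≠ 0) {f : EuclideanSpace ℝ (Fin d) → ℝ} (hf : ContDiff ℝ ∞ f)
    (hc : HasCompactSupport f) (h0 : ∀ x, l x = 0 → f x = 0) (w : EuclideanSpace ℝ (Fin d)) :
    ∫ x, {x | 0 < l x}.indicator (fun x => fderiv ℝ f x w) x = 0 := by
  have hlc : Continuous l := l.continuous_of_finiteDimensional
  obtain ⟨L, hL⟩ := (hf.of_le (m := 1) (by simp)).lipschitzWith_of_hasCompactSupport hc (by simp)
  have hF := lipschitzWith_indicator_of_affine l hL h0
  have hFc : HasCompactSupport ({x | 0 < l x}.indicator f) := by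
    refine hc.mono ?_
    intro x hx
    rw [Function.mem_support] at hx ⊢
    intro h
    exact hx (by simp [Set.indicator, h])
  -- Integration by parts against the constant 1. The direction is `-w` because the formula reverses
  -- it when the derivative changes factor.
  have h1 := LipschitzWith.integral_lineDeriv_mul_eq (μ := volume)
    (LipschitzWith.const (1 : ℝ) (α := EuclideanSpace ℝ (Fin d))) hF hFc (-w)
  have h2 : ∀ᵐ x, lineDeriv ℝ ({x | 0 < l x}.indicator f) x w =
      {x | 0 < l x}.indicator (fun x => fderiv ℝ f x w) x := by
    have hne : ∀ᵐ x, l x ≠ 0 := by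
      rw [ae_iff]
      simpa using volume_affine_zero_set l hl
    filter_upwards [hne] with x hx
    rcases lt_or_gt_of_ne hx with hneg | hpos
    · have hev : {x | 0 < l x}.indicator f =ᶠ[nhds x] fun _ => 0 := by
        filter_upwards [(hlc.isOpen_preimage _ isOpen_Iio).mem_nhds hneg] with y hy
        have : ¬ 0 < l y := not_lt.2 (le_of_lt hy)
        simp [Set.indicator, this]
      have h3 : HasFDerivAt ({x | 0 < l x}.indicator f)
          (0 : EuclideanSpace ℝ (Fin d) →L[ℝ] ℝ) x :=
        (hasFDerivAt_const (0 : ℝ) x).congr_of_eventuallyEq hev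
      rw [(h3.hasLineDerivAt w).lineDeriv]
      simp [Set.indicator, hneg.not_gt]
    · have hev : {x | 0 < l x}.indicator f =ᶠ[nhds x] f := by
        filter_upwards [(hlc.isOpen_preimage _ isOpen_Ioi).mem_nhds hpos] with y hy
        have : 0 < l y := hy
        simp [Set.indicator, this]
      have h3 : HasFDerivAt ({x | 0 < l x}.indicator f) (fderiv ℝ f x) x :=
        ((hf.differentiable (by simp) x).hasFDerivAt).congr_of_eventuallyEq hev
      rw [(h3.hasLineDerivAt w).lineDeriv]
      simp [Set.indicator, hpos]
  rw [← integral_congr_ae h2]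
  have h3 : ∀ x : EuclideanSpace ℝ (Fin d), lineDeriv ℝ (fun _ => (1 : ℝ)) x (-w) = 0 := fun x => by
    rw [((hasFDerivAt_const (1 : ℝ) x).hasLineDerivAt (-w)).lineDeriv]
    simp
  simpa [h3] using h1.symm

/-- The product of `r` and a test function vanishes on the hyperplane, so the half-space integral of
its derivative is zero: integration by parts leaves no boundary term. -/
theorem isWeakGradient_indicator {d : ℕ} (l : EuclideanSpace ℝ (Fin d) →ᵃ[ℝ] ℝ)
    (hl : ∃ x, l x ≠ 0) {r : EuclideanSpace ℝ (Fin d) → ℝ} (hr : ContDiff ℝ ∞ r)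
    (h0 : ∀ x, l x = 0 → r x = 0) (Ω : Set (EuclideanSpace ℝ (Fin d))) :
    IsWeakGradient Ω ({x | 0 < l x}.indicator r) ({x | 0 < l x}.indicator (gradient r)) := by
  have hm : MeasurableSet {x | 0 < l x} :=
    (l.continuous_of_finiteDimensional.isOpen_preimage _ isOpen_Ioi).measurableSet
  have hi : LocallyIntegrable ({x | 0 < l x}.indicator r) volume :=
    hr.continuous.locallyIntegrable.indicator hm
  have hgi : LocallyIntegrable ({x | 0 < l x}.indicator (gradient r)) volume :=
    (continuous_gradient hr).locallyIntegrable.indicator hm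
  refine ⟨hi.locallyIntegrableOn _, hgi.locallyIntegrableOn _, fun φ hφ hc hs w => ?_⟩
  have hw := continuous_fderiv_apply_const hφ w
  have hcw := hasCompactSupport_fderiv_apply hc w
  have hsw := (tsupport_fderiv_apply_subset ℝ (f := φ) w).trans hs
  rw [setIntegral_mul_eq_integral hsw, setIntegral_mul_eq_integral
    (f := fun x => inner ℝ ({x | 0 < l x}.indicator (gradient r) x) w) hs,
    eq_neg_iff_add_eq_zero, ← integral_add
      (integrable_mul_of_tsupport_subset (hi.locallyIntegrableOn Set.univ) hw hcw
        (Set.subset_univ _))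
      (integrable_mul_of_tsupport_subset (LocallyIntegrableOn.inner_right_const
        (hgi.locallyIntegrableOn Set.univ) w) hφ.continuous hc (Set.subset_univ _))]
  refine Eq.trans ?_ (integral_indicator_fderiv_eq_zero l hl (hr.mul hφ) hc.mul_left
    (fun x hx => by simp [h0 x hx]) w)
  congr 1
  funext x
  by_cases hx : 0 < l x
  · have h1 := (hr.differentiable (by simp) x).hasFDerivAt.mul
      (hφ.differentiable (by simp) x).hasFDerivAt
    simp only [Set.indicator, Set.mem_ofPred_eq, hx, if_true, inner_gradient_eq]
    rw [show (fun x => r x * φ x) = r * φ from rfl, h1.fderiv]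
    simp [mul_comm]
  · simp [Set.indicator, hx]

theorem isWeakGradient_of_contDiff {d : ℕ} {p : EuclideanSpace ℝ (Fin d) → ℝ}
    (hp : ContDiff ℝ ∞ p) (Ω : Set (EuclideanSpace ℝ (Fin d))) :
    IsWeakGradient Ω p (gradient p) := by
  -- The half-space belonging to the constant 1 is the whole space and its zero set is empty.
  have h := isWeakGradient_indicator (AffineMap.const ℝ (EuclideanSpace ℝ (Fin d)) (1 : ℝ))
    ⟨0, by simp⟩ hp (by simp) Ω
  simpa using h

/-! ### Translates of Sobolev functions and the Poincaré inequality -/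

theorem lintegral_sq_le_of_isProbabilityMeasure {α : Type*} [MeasurableSpace α] {ν : Measure α}
    [IsProbabilityMeasure ν] {f : α → ENNReal} (hf : AEMeasurable f ν) :
    (∫⁻ t, f t ∂ν) ^ 2 ≤ ∫⁻ t, f t ^ 2 ∂ν := by
  have h := ENNReal.lintegral_mul_le_Lp_mul_Lq ν (p := 2) (q := 2)
    (Real.holderConjugate_iff.2 ⟨by norm_num, by norm_num⟩) hf
    (aemeasurable_const (b := (1 : ENNReal)))
  simp only [Pi.mul_apply, mul_one, ENNReal.one_rpow, lintegral_const, measure_univ] at h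
  have h2 := pow_le_pow_left' h 2
  rw [← ENNReal.rpow_natCast (_ ^ (1 / 2 : ℝ)), ← ENNReal.rpow_mul] at h2
  simpa using h2

theorem LocallyIntegrableOn.comp_add_right {d : ℕ} {Ω A : Set (EuclideanSpace ℝ (Fin d))}
    (hA : IsOpen A) {f : EuclideanSpace ℝ (Fin d) → ℝ} (hf : LocallyIntegrableOn f Ω volume)
    {h : EuclideanSpace ℝ (Fin d)} (hAΩ : ∀ x ∈ A, x + h ∈ Ω) :
    LocallyIntegrableOn (fun x => f (x + h)) A volume := by
  rw [locallyIntegrableOn_iff hA.isLocallyClosed]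
  intro K hKA hK
  have h1 : IntegrableOn f ((fun x => x + h) '' K) volume :=
    hf.integrableOn_compact_subset (by rintro _ ⟨x, hx, rfl⟩; exact hAΩ x (hKA hx))
      (hK.image (by fun_prop))
  exact ((measurePreserving_add_right volume h).integrableOn_image
    (measurableEmbedding_addRight h)).1 h1

theorem sub_eq_integral_fderiv {d : ℕ} {φ : EuclideanSpace ℝ (Fin d) → ℝ} (hφ : ContDiff ℝ ∞ φ)
    (y h : EuclideanSpace ℝ (Fin d)) :
    φ (y - h) - φ y = -∫ t in Set.Ioc (0 : ℝ) 1, fderiv ℝ φ (y - t • h) h := by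
  have hder : ∀ t ∈ Set.uIcc (0 : ℝ) 1, HasDerivAt (fun t : ℝ => φ (y - t • h))
      (-fderiv ℝ φ (y - t • h) h) t := by
    intro t _
    have h1 : HasDerivAt (fun t : ℝ => y - t • h) (-h) t := by
      simpa using ((hasDerivAt_id t).smul_const h).const_sub y
    have h2 := (hφ.differentiable (by simp) (y - t • h)).hasFDerivAt.comp_hasDerivAt t h1
    rw [map_neg] at h2
    exact h2
  have hc : Continuous fun t : ℝ => -fderiv ℝ φ (y - t • h) h :=
    (((hφ.continuous_fderiv (by simp)).comp (by fun_prop)).clm_apply continuous_const).neg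
  have := intervalIntegral.integral_eq_sub_of_hasDerivAt hder (hc.intervalIntegrable 0 1)
  rw [intervalIntegral.integral_of_le zero_le_one, integral_neg] at this
  simpa using this.symm

theorem measurePreserving_shear {d : ℕ} (ν : Measure ℝ) [SFinite ν]
    (h : EuclideanSpace ℝ (Fin d)) :
    MeasurePreserving (fun p : ℝ × EuclideanSpace ℝ (Fin d) => (p.1, p.2 + p.1 • h))
      (ν.prod volume) (ν.prod volume) :=
  (MeasurePreserving.id ν).skew_product (g := fun (t : ℝ) (x : EuclideanSpace ℝ (Fin d)) => x + t • h)
    (by fun_prop) (Filter.Eventually.of_forall fun t => map_add_right_eq_self volume (t • h))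

/-- This is the tested form of writing `f (x + h) - f x` as the integral of the derivative along the
segment. The weak gradient is tested against the translates of `φ` by `t • h`, and Fubini integrates
over `t`. Convexity keeps the supports of these translates inside `Ω`. -/
theorem integral_mul_translate_sub {d : ℕ} {Ω : Set (EuclideanSpace ℝ (Fin d))}
    (hconv : Convex ℝ Ω)
    {f : EuclideanSpace ℝ (Fin d) → ℝ} {g : EuclideanSpace ℝ (Fin d) → EuclideanSpace ℝ (Fin d)}
    (hfg : IsWeakGradient Ω f g) (h : EuclideanSpace ℝ (Fin d))
    {φ : EuclideanSpace ℝ (Fin d) → ℝ} (hφ : ContDiff ℝ ∞ φ) (hc : HasCompactSupport φ)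
    (hs : ∀ x ∈ tsupport φ, x ∈ Ω ∧ x + h ∈ Ω) :
    ∫ x, φ x * (f (x + h) - f x) =
      ∫ x, φ x * ∫ t in Set.Ioc (0 : ℝ) 1, Ω.indicator (fun y => inner ℝ (g y) h) (x + t • h) := by
  set ν : Measure ℝ := volume.restrict (Set.Ioc (0 : ℝ) 1) with hν
  set G : EuclideanSpace ℝ (Fin d) → ℝ := Ω.indicator fun y => inner ℝ (g y) h with hG
  -- the region swept by the support
  set K : Set (EuclideanSpace ℝ (Fin d)) :=
    (fun p : ℝ × EuclideanSpace ℝ (Fin d) => p.2 + p.1 • h) '' (Set.Icc (0 : ℝ) 1 ×ˢ tsupport φ)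
    with hK
  have hKc : IsCompact K := (isCompact_Icc.prod hc).image (by fun_prop)
  have hKm : MeasurableSet K := hKc.measurableSet
  have hseg : ∀ x ∈ tsupport φ, ∀ t ∈ Set.Icc (0 : ℝ) 1, x + t • h ∈ Ω := by
    intro x hx t ht
    obtain ⟨h1, h2⟩ := hs x hx
    exact hconv.add_smul_mem h1 h2 ht
  have hKΩ : K ⊆ Ω := by
    rintro _ ⟨⟨t, x⟩, ⟨ht, hx⟩, rfl⟩
    exact hseg x hx t ht
  have hmemK : ∀ t ∈ Set.Icc (0 : ℝ) 1, ∀ x, x ∈ tsupport φ → x + t • h ∈ K :=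
    fun t ht x hx => ⟨(t, x), ⟨ht, hx⟩, rfl⟩
  -- Only local integrability is known on `Ω`; cutting off to the compact set `K` gives functions
  -- integrable on the whole space, as Fubini requires.
  have hfK : Integrable (K.indicator f) volume :=
    (hfg.1.integrableOn_compact_subset hKΩ hKc).integrable_indicator hKm
  have hGK : Integrable (K.indicator G) volume := by
    have h1 := (LocallyIntegrableOn.inner_right_const hfg.2.1 h).integrableOn_compact_subset hKΩ hKc
    have h2 := h1.integrable_indicator hKm
    refine h2.congr (Filter.Eventually.of_forall fun x => ?_)
    by_cases hx : x ∈ K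
    · simp [hx, hG, hKΩ hx]
    · simp [hx]
  have hIcc : ∀ᵐ t ∂ν, t ∈ Set.Icc (0 : ℝ) 1 :=
    (ae_restrict_mem measurableSet_Ioc).mono fun t ht => Set.Ioc_subset_Icc_self ht
  have hφb : ∃ M, ∀ x, ‖φ x‖ ≤ M := hc.exists_bound_of_continuous hφ.continuous
  obtain ⟨M, hM⟩ := hφb
  have hDb : ∃ M, ∀ x, ‖fderiv ℝ φ x h‖ ≤ M :=
    (hasCompactSupport_fderiv_apply hc h).exists_bound_of_continuous
      (continuous_fderiv_apply_const hφ h)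
  obtain ⟨M', hM'⟩ := hDb
  have hDc := continuous_fderiv_apply_const hφ h
  -- the translated test functions
  have hweak : ∀ t ∈ Set.Icc (0 : ℝ) 1,
      ∫ y, K.indicator f y * fderiv ℝ φ (y - t • h) h = -∫ x, K.indicator G (x + t • h) * φ x := by
    intro t ht
    set ψ : EuclideanSpace ℝ (Fin d) → ℝ := fun y => φ (y - t • h) with hψ
    have hψs : tsupport ψ = (fun y => y - t • h) ⁻¹' tsupport φ :=
      tsupport_comp_eq_preimage φ (Homeomorph.subRight (t • h))
    have hψd : ContDiff ℝ ∞ ψ := hφ.comp (contDiff_id.sub contDiff_const)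
    have hψc : HasCompactSupport ψ := hc.comp_homeomorph (Homeomorph.subRight (t • h))
    have hψK : tsupport ψ ⊆ K := by
      rw [hψs]
      intro y hy
      have := hmemK t ht _ hy
      simpa using this
    have hder : ∀ y, fderiv ℝ ψ y h = fderiv ℝ φ (y - t • h) h := by
      intro y
      rw [hψ, fderiv_comp_sub]
    have e := hfg.2.2 ψ hψd hψc (hψK.trans hKΩ) h
    have hsw := tsupport_fderiv_apply_subset ℝ (f := ψ) h
    rw [setIntegral_mul_eq_integral (hsw.trans (hψK.trans hKΩ)),
      setIntegral_mul_eq_integral (f := fun x => inner ℝ (g x) h) (hψK.trans hKΩ)] at e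
    have e1 : ∫ y, K.indicator f y * fderiv ℝ φ (y - t • h) h = ∫ y, f y * fderiv ℝ ψ y h := by
      congr 1
      funext y
      rw [← hder]
      by_cases hy : y ∈ K
      · simp [hy]
      · rw [image_eq_zero_of_notMem_tsupport (f := fun y => fderiv ℝ ψ y h)
          fun h' => hy (hψK (hsw h'))]
        simp
    have e2 : ∫ x, K.indicator G (x + t • h) * φ x = ∫ y, inner ℝ (g y) h * ψ y := by
      rw [← integral_add_right_eq_self (fun y => inner ℝ (g y) h * ψ y) (t • h)]
      congr 1
      funext x
      by_cases hx : x ∈ tsupport φ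
      · have h1 := hmemK t ht x hx
        simp [h1, hG, hKΩ h1, hψ]
      · simp [hψ, image_eq_zero_of_notMem_tsupport hx]
    rw [e1, e2, e]
  -- both sides as double integrals
  have hfub1 : Integrable (fun p : ℝ × EuclideanSpace ℝ (Fin d) =>
      K.indicator f p.2 * fderiv ℝ φ (p.2 - p.1 • h) h) (ν.prod volume) := by
    refine (hfK.comp_snd ν).mul_bdd (c := M') ?_ (Filter.Eventually.of_forall fun p => hM' _)
    exact (hDc.comp (f := fun p : ℝ × EuclideanSpace ℝ (Fin d) => p.2 - p.1 • h)
      (by fun_prop)).aestronglyMeasurable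
  have hfub2 : Integrable (fun p : ℝ × EuclideanSpace ℝ (Fin d) =>
      K.indicator G (p.2 + p.1 • h) * φ p.2) (ν.prod volume) := by
    have h1 := (measurePreserving_shear ν h).integrable_comp_of_integrable (hGK.comp_snd ν)
    refine h1.mul_bdd (c := M) ?_ (Filter.Eventually.of_forall fun p => hM _)
    exact (hφ.continuous.comp continuous_snd).aestronglyMeasurable
  have hφf : ∀ x, φ x * f x = K.indicator f x * φ x := by
    intro x
    by_cases hx : x ∈ tsupport φ
    · have h1 : x ∈ K := by simpa using hmemK 0 (by simp) x hx
      simp [h1, mul_comm]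
    · simp [image_eq_zero_of_notMem_tsupport hx]
  have hφfh : ∀ x, φ x * f (x + h) = K.indicator f (x + h) * φ x := by
    intro x
    by_cases hx : x ∈ tsupport φ
    · have h1 : x + h ∈ K := by simpa using hmemK 1 (by simp) x hx
      simp [h1, mul_comm]
    · simp [image_eq_zero_of_notMem_tsupport hx]
  have hi1 : Integrable (fun x => K.indicator f x * φ x) volume :=
    hfK.mul_bdd (c := M) hφ.continuous.aestronglyMeasurable (Filter.Eventually.of_forall hM)
  have hi2 : Integrable (fun x => K.indicator f x * φ (x - h)) volume :=
    hfK.mul_bdd (c := M) (hφ.continuous.comp (by fun_prop)).aestronglyMeasurable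
      (Filter.Eventually.of_forall fun x => hM _)
  have hi3 : Integrable (fun x => K.indicator f (x + h) * φ x) volume := by
    have := hi2.comp_add_right h
    simpa using this
  have lhs : ∫ x, φ x * (f (x + h) - f x) =
      ∫ y, K.indicator f y * (φ (y - h) - φ y) := by
    have e1 : ∫ x, K.indicator f (x + h) * φ x = ∫ y, K.indicator f y * φ (y - h) := by
      rw [← integral_add_right_eq_self (fun y => K.indicator f y * φ (y - h)) h]
      simp
    simp only [mul_sub, hφf, hφfh]
    rw [integral_sub hi3 hi1, integral_sub hi2 hi1, e1]
  rw [lhs]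
  have e3 : ∫ y, K.indicator f y * (φ (y - h) - φ y) =
      -∫ y, ∫ t, K.indicator f y * fderiv ℝ φ (y - t • h) h ∂ν := by
    rw [← integral_neg]
    congr 1
    funext y
    rw [sub_eq_integral_fderiv hφ, integral_const_mul]
    ring
  have e4 : ∫ x, φ x * ∫ t, G (x + t • h) ∂ν =
      ∫ x, ∫ t, K.indicator G (x + t • h) * φ x ∂ν := by
    congr 1
    funext x
    rw [← integral_const_mul]
    refine integral_congr_ae ?_
    filter_upwards [hIcc] with t ht
    by_cases hx : x ∈ tsupport φ
    · simp [hmemK t ht x hx, mul_comm]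
    · simp [image_eq_zero_of_notMem_tsupport hx]
  rw [e3, e4, integral_integral_swap (f := fun y t => K.indicator f y * fderiv ℝ φ (y - t • h) h)
      hfub1.swap, integral_integral_swap (f := fun x t => K.indicator G (x + t • h) * φ x)
      hfub2.swap, ← integral_neg]
  refine integral_congr_ae ?_
  filter_upwards [hIcc] with t ht
  rw [hweak t ht, neg_neg]

/-- The fundamental lemma turns the tested identity into one holding almost everywhere: the
difference is an average over `t` of the directional derivative, extended by zero. Cauchy–Schwarz in
`t`, Tonelli and translation invariance then give the bound. -/
theorem lintegral_translate_sub_le {d : ℕ} {Ω : Set (EuclideanSpace ℝ (Fin d))} (hΩ : IsOpen Ω)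
    (hconv : Convex ℝ Ω)
    {f : EuclideanSpace ℝ (Fin d) → ℝ} {g : EuclideanSpace ℝ (Fin d) → EuclideanSpace ℝ (Fin d)}
    (hfg : IsWeakGradient Ω f g) (hg : MemLp g 2 (volume.restrict Ω))
    (h : EuclideanSpace ℝ (Fin d)) :
    ∫⁻ x in {x | x ∈ Ω ∧ x + h ∈ Ω}, ‖f (x + h) - f x‖ₑ ^ 2 ≤
      ∫⁻ x in Ω, ‖inner ℝ (g x) h‖ₑ ^ 2 := by
  set ν : Measure ℝ := volume.restrict (Set.Ioc (0 : ℝ) 1) with hν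
  have : IsProbabilityMeasure ν := ⟨by simp [hν]⟩
  set G : EuclideanSpace ℝ (Fin d) → ℝ := Ω.indicator fun y => inner ℝ (g y) h with hG
  set A : Set (EuclideanSpace ℝ (Fin d)) := {x | x ∈ Ω ∧ x + h ∈ Ω} with hA
  have hAo : IsOpen A := hΩ.inter (hΩ.preimage (by fun_prop : Continuous fun x => x + h))
  have hGL : MemLp G 2 volume := by
    rw [hG, memLp_indicator_iff_restrict hΩ.measurableSet]
    exact hg.inner_const h
  set I : EuclideanSpace ℝ (Fin d) → ℝ := fun x => ∫ t, G (x + t • h) ∂ν with hI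
  have hGm : AEStronglyMeasurable (fun p : ℝ × EuclideanSpace ℝ (Fin d) => G (p.2 + p.1 • h))
      (ν.prod volume) :=
    (hGL.1.comp_snd (μ := ν)).comp_measurePreserving (measurePreserving_shear ν h)
  have hIm : AEStronglyMeasurable I volume := hGm.prod_swap.integral_prod_right'
  have hGtot : ∫⁻ x, ‖G x‖ₑ ^ 2 = ∫⁻ x in Ω, ‖inner ℝ (g x) h‖ₑ ^ 2 := by
    rw [← lintegral_indicator hΩ.measurableSet]
    congr 1
    funext x
    by_cases hx : x ∈ Ω <;> simp [hG, hx]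
  have hIle : ∫⁻ x, ‖I x‖ₑ ^ 2 ≤ ∫⁻ x, ‖G x‖ₑ ^ 2 := by
    have hGm2 : AEMeasurable (fun p : ℝ × EuclideanSpace ℝ (Fin d) => ‖G (p.2 + p.1 • h)‖ₑ ^ 2)
      (ν.prod volume) := hGm.enorm.pow_const 2
    have hae : ∀ᵐ x, AEMeasurable (fun t => ‖G (x + t • h)‖ₑ) ν := by
      filter_upwards [hGm.prod_swap.prodMk_left] with x hx using hx.enorm
    calc ∫⁻ x, ‖I x‖ₑ ^ 2 ≤ ∫⁻ x, ∫⁻ t, ‖G (x + t • h)‖ₑ ^ 2 ∂ν := by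
          refine lintegral_mono_ae ?_
          filter_upwards [hae] with x hx
          exact (pow_le_pow_left' (enorm_integral_le_lintegral_enorm _) 2).trans
            (lintegral_sq_le_of_isProbabilityMeasure hx)
      _ = lintegral ν fun t => ∫⁻ x, ‖G (x + t • h)‖ₑ ^ 2 :=
          lintegral_lintegral_swap (f := fun x t => ‖G (x + t • h)‖ₑ ^ 2) hGm2.prod_swap
      _ = lintegral ν fun _ => ∫⁻ x, ‖G x‖ₑ ^ 2 := by
          congr 1
          funext t
          exact lintegral_add_right_eq_self (fun x => ‖G x‖ₑ ^ 2) (t • h)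
      _ = ∫⁻ x, ‖G x‖ₑ ^ 2 := by simp
  have hGfin : ∫⁻ x, ‖G x‖ₑ ^ 2 < ⊤ := by
    have := lintegral_rpow_enorm_lt_top_of_eLpNorm_lt_top (by simp) (by simp) hGL.2
    simpa using this
  have hIL : MemLp I 2 volume := by
    refine ⟨hIm, (eLpNorm_lt_top_iff_lintegral_rpow_enorm_lt_top (by simp) (by simp)).2 ?_⟩
    simpa using hIle.trans_lt hGfin
  have hDloc : LocallyIntegrableOn (fun x => f (x + h) - f x) A volume :=
    (LocallyIntegrableOn.comp_add_right hAo hfg.1 fun x hx => hx.2).sub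
      (hfg.1.mono_set fun x hx => hx.1)
  have hIloc : LocallyIntegrableOn I A volume :=
    (hIL.locallyIntegrable (by norm_num)).locallyIntegrableOn A
  have hae : ∀ᵐ x, x ∈ A → f (x + h) - f x - I x = 0 := by
    refine hAo.ae_eq_zero_of_integral_contDiff_smul_eq_zero (hDloc.sub hIloc)
      fun φ hφ hc hs => ?_
    have e := integral_mul_translate_sub hconv hfg h hφ hc fun x hx => hs hx
    have i1 := integrable_mul_of_tsupport_subset hDloc hφ.continuous hc hs
    have i2 := integrable_mul_of_tsupport_subset hIloc hφ.continuous hc hs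
    have e2 : ∫ x, φ x • (f (x + h) - f x - I x) =
        (∫ x, φ x * (f (x + h) - f x)) - ∫ x, φ x * I x := by
      rw [← integral_sub]
      · congr 1
        funext x
        simp only [smul_eq_mul]
        ring
      · simpa only [mul_comm] using i1
      · simpa only [mul_comm] using i2
    exact e2.trans (sub_eq_zero.2 e)
  calc ∫⁻ x in A, ‖f (x + h) - f x‖ₑ ^ 2 = ∫⁻ x in A, ‖I x‖ₑ ^ 2 := by
        refine lintegral_congr_ae ?_
        rw [Filter.EventuallyEq, ae_restrict_iff' hAo.measurableSet]
        filter_upwards [hae] with x hx hxA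
        rw [sub_eq_zero.1 (hx hxA)]
    _ ≤ ∫⁻ x, ‖I x‖ₑ ^ 2 := setLIntegral_le_lintegral _ _
    _ ≤ _ := hIle.trans hGtot.le

/-- Put `y = x + h` and integrate over `x` first: each inner integral is a translation difference,
and it is empty when `h` is longer than `δ`. -/
theorem lintegral_lintegral_sub_le {d : ℕ} {Ω : Set (EuclideanSpace ℝ (Fin d))} (hΩ : IsOpen Ω)
    (hconv : Convex ℝ Ω)
    {f : EuclideanSpace ℝ (Fin d) → ℝ} {g : EuclideanSpace ℝ (Fin d) → EuclideanSpace ℝ (Fin d)}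
    (hfg : IsWeakGradient Ω f g) (hf : AEStronglyMeasurable f (volume.restrict Ω))
    (hg : MemLp g 2 (volume.restrict Ω)) {δ : ℝ} (hδ : ∀ x ∈ Ω, ∀ y ∈ Ω, ‖y - x‖ ≤ δ) :
    ∫⁻ x in Ω, ∫⁻ y in Ω, ‖f y - f x‖ₑ ^ 2 ≤
      volume (Metric.closedBall (0 : EuclideanSpace ℝ (Fin d)) δ) *
        (ENNReal.ofReal δ ^ 2 * ∫⁻ x in Ω, ‖g x‖ₑ ^ 2) := by
  set F := Ω.indicator f with hF
  have hFm : AEStronglyMeasurable F volume := (aestronglyMeasurable_indicator_iff hΩ.measurableSet).2 hf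
  set k : EuclideanSpace ℝ (Fin d) → EuclideanSpace ℝ (Fin d) → ENNReal := fun x y =>
    Ω.indicator 1 x * (Ω.indicator 1 y * ‖F y - F x‖ₑ ^ 2) with hk
  have h1m : Measurable (Ω.indicator (1 : EuclideanSpace ℝ (Fin d) → ENNReal)) :=
    measurable_one.indicator hΩ.measurableSet
  have hkm : AEMeasurable (fun p : EuclideanSpace ℝ (Fin d) × EuclideanSpace ℝ (Fin d) =>
      k p.1 p.2) (volume.prod volume) :=
    (h1m.comp measurable_fst).aemeasurable.mul ((h1m.comp measurable_snd).aemeasurable.mul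
      ((hFm.comp_snd.sub hFm.comp_fst).enorm.pow_const 2))
  have hkm' : AEMeasurable (fun p : EuclideanSpace ℝ (Fin d) × EuclideanSpace ℝ (Fin d) =>
      k p.1 (p.1 + p.2)) (volume.prod volume) :=
    hkm.comp_quasiMeasurePreserving (measurePreserving_prod_add volume volume).quasiMeasurePreserving
  have e1 : ∫⁻ x in Ω, ∫⁻ y in Ω, ‖f y - f x‖ₑ ^ 2 = ∫⁻ x, ∫⁻ y, k x y := by
    rw [← lintegral_indicator hΩ.measurableSet]
    congr 1
    funext x
    by_cases hx : x ∈ Ω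
    · rw [Set.indicator_of_mem hx, ← lintegral_indicator hΩ.measurableSet]
      congr 1
      funext y
      by_cases hy : y ∈ Ω <;> simp [hk, hx, hy, hF]
    · simp [hk, hx]
  have e2 : ∫⁻ x, ∫⁻ y, k x y = ∫⁻ h, ∫⁻ x, k x (x + h) := by
    rw [← lintegral_lintegral_swap (f := fun x h => k x (x + h)) hkm']
    congr 1
    funext x
    exact (lintegral_add_left_eq_self (fun y => k x y) x).symm
  have key : ∀ h, ∫⁻ x, k x (x + h) ≤ (Metric.closedBall (0 : EuclideanSpace ℝ (Fin d)) δ).indicator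
      (fun _ => ENNReal.ofReal δ ^ 2 * ∫⁻ x in Ω, ‖g x‖ₑ ^ 2) h := by
    intro h
    set A : Set (EuclideanSpace ℝ (Fin d)) := {x | x ∈ Ω ∧ x + h ∈ Ω} with hA
    have hAo : IsOpen A := hΩ.inter (hΩ.preimage (by fun_prop : Continuous fun x => x + h))
    have e3 : ∫⁻ x, k x (x + h) = ∫⁻ x in A, ‖f (x + h) - f x‖ₑ ^ 2 := by
      rw [← lintegral_indicator hAo.measurableSet]
      congr 1
      funext x
      by_cases hx : x ∈ Ω <;> by_cases hxh : x + h ∈ Ω <;>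
        simp [hk, hF, hA, Set.indicator, hx, hxh]
    by_cases hh : h ∈ Metric.closedBall (0 : EuclideanSpace ℝ (Fin d)) δ
    · rw [Set.indicator_of_mem hh, e3]
      refine (lintegral_translate_sub_le hΩ hconv hfg hg h).trans ?_
      rw [← lintegral_const_mul' _ _ (by simp)]
      refine lintegral_mono fun x => ?_
      have h1 : ‖(inner ℝ (g x) h : ℝ)‖ₑ ≤ ENNReal.ofReal δ * ‖g x‖ₑ := by
        rw [← ofReal_norm, ← ofReal_norm, ← ENNReal.ofReal_mul
          ((norm_nonneg h).trans (mem_closedBall_zero_iff.1 hh))]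
        refine ENNReal.ofReal_le_ofReal ((norm_inner_le_norm _ _).trans ?_)
        rw [mul_comm]
        exact mul_le_mul_of_nonneg_right (mem_closedBall_zero_iff.1 hh) (norm_nonneg _)
      calc ‖(inner ℝ (g x) h : ℝ)‖ₑ ^ 2 ≤ (ENNReal.ofReal δ * ‖g x‖ₑ) ^ 2 := pow_le_pow_left' h1 2
        _ = _ := mul_pow _ _ _
    · have hAe : A = ∅ := by
        ext x
        simp only [hA, Set.mem_ofPred_eq, Set.mem_empty_iff_false, iff_false]
        rintro ⟨hx, hxh⟩
        exact hh (by simpa using hδ x hx _ hxh)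
      rw [e3, hAe]
      simp
  rw [e1, e2]
  refine (lintegral_mono key).trans ?_
  rw [lintegral_indicator Metric.isClosed_closedBall.measurableSet]
  simp [mul_comm]

theorem enorm_sq_eq_ofReal {E : Type*} [NormedAddCommGroup E] (x : E) :
    ‖x‖ₑ ^ 2 = ENNReal.ofReal (‖x‖ ^ 2) := by
  rw [← ofReal_norm, ENNReal.ofReal_pow (norm_nonneg _)]

theorem lintegral_enorm_sq_eq_ofReal {α E : Type*} [MeasurableSpace α] [NormedAddCommGroup E]
    {μ : Measure α} {f : α → E} (hf : MemLp f 2 μ) :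
    ∫⁻ x, ‖f x‖ₑ ^ 2 ∂μ = ENNReal.ofReal (∫ x, ‖f x‖ ^ 2 ∂μ) := by
  rw [ofReal_integral_eq_lintegral_ofReal ((memLp_two_iff_integrable_sq_norm hf.1).1 hf)
    (Filter.Eventually.of_forall fun x => sq_nonneg _)]
  simp only [enorm_sq_eq_ofReal]

/-- For mean zero, the mixed term in the double integral of `(f y - f x) ^ 2` disappears, and the
translation estimate bounds what remains. The constant is explicit in the diameter and the volume,
hence uniform over all bodies of bounded shape. -/
theorem poincare_of_convex {d : ℕ} {Ω : Set (EuclideanSpace ℝ (Fin d))} (hΩ : IsOpen Ω)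
    (hconv : Convex ℝ Ω)
    {f : EuclideanSpace ℝ (Fin d) → ℝ} {g : EuclideanSpace ℝ (Fin d) → EuclideanSpace ℝ (Fin d)}
    (hfg : IsWeakGradient Ω f g) (hf : MemLp f 2 (volume.restrict Ω))
    (hg : MemLp g 2 (volume.restrict Ω)) {δ : ℝ} (hδ0 : 0 ≤ δ)
    (hδ : ∀ x ∈ Ω, ∀ y ∈ Ω, ‖y - x‖ ≤ δ) (hfin : volume Ω ≠ ⊤) (hmean : ∫ x in Ω, f x = 0) :
    volume.real Ω * ∫ x in Ω, f x ^ 2 ≤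
      volume.real (Metric.closedBall (0 : EuclideanSpace ℝ (Fin d)) δ) * δ ^ 2 *
        ∫ x in Ω, ‖g x‖ ^ 2 := by
  have : IsFiniteMeasure (volume.restrict Ω) := ⟨by simpa using hfin.lt_top⟩
  have hle := lintegral_lintegral_sub_le hΩ hconv hfg hf.1 hg hδ
  have hf1 : Integrable f (volume.restrict Ω) := hf.integrable (by norm_num)
  have hf2 : Integrable (fun x => f x ^ 2) (volume.restrict Ω) :=
    (memLp_two_iff_integrable_sq hf.1).1 hf
  have hlow : ENNReal.ofReal (volume.real Ω * ∫ x in Ω, f x ^ 2) ≤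
      ∫⁻ x in Ω, ∫⁻ y in Ω, ‖f y - f x‖ₑ ^ 2 := by
    rw [← integral_const_mul, ofReal_integral_eq_lintegral_ofReal (hf2.const_mul _)
      (Filter.Eventually.of_forall fun x => by positivity)]
    refine lintegral_mono fun x => ?_
    have hd : MemLp (fun y => f y - f x) 2 (volume.restrict Ω) := hf.sub (memLp_const (f x))
    rw [lintegral_enorm_sq_eq_ofReal hd]
    refine ENNReal.ofReal_le_ofReal ?_
    -- Only the second summand is kept; integrating it over `x` produces the left-hand side.
    have e : ∫ y in Ω, ‖f y - f x‖ ^ 2 = (∫ y in Ω, f y ^ 2) + volume.real Ω * f x ^ 2 := by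
      have e1 : ∀ y, ‖f y - f x‖ ^ 2 = f y ^ 2 + ((-2 * f x) * f y + f x ^ 2) := fun y => by
        rw [Real.norm_eq_abs, sq_abs]; ring
      simp only [e1]
      have i1 : Integrable (fun y => (-2 * f x) * f y + f x ^ 2) (volume.restrict Ω) :=
        (hf1.const_mul _).add (integrable_const _)
      rw [integral_add hf2 i1, integral_add (hf1.const_mul _) (integrable_const _), integral_const_mul, hmean]
      simp
    rw [e]
    have : 0 ≤ ∫ y in Ω, f y ^ 2 := integral_nonneg fun y => sq_nonneg _
    linarith
  have h := hlow.trans hle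
  rw [lintegral_enorm_sq_eq_ofReal hg, ← ENNReal.ofReal_pow hδ0,
    ← ENNReal.ofReal_mul (by positivity),
    ← ENNReal.ofReal_toReal (measure_closedBall_lt_top (μ := volume)
      (x := (0 : EuclideanSpace ℝ (Fin d))) (r := δ)).ne,
    ← ENNReal.ofReal_mul ENNReal.toReal_nonneg] at h
  have h0 : 0 ≤ ∫ x in Ω, ‖g x‖ ^ 2 := integral_nonneg fun x => sq_nonneg _
  rw [ENNReal.ofReal_le_ofReal_iff (by positivity)] at h
  rw [mul_assoc]
  exact h

/-! ### Pairs of convex bodies on the two sides of a hyperplane -/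

/-- The signed distance to the hyperplane through `z` with unit normal `n`. -/
def hyperHeight {d : ℕ} (z n : EuclideanSpace ℝ (Fin d)) : EuclideanSpace ℝ (Fin d) →ᵃ[ℝ] ℝ :=
  ((innerSL ℝ n).toLinearMap.toAffineMap) - AffineMap.const ℝ _ (inner ℝ n z)

theorem hyperHeight_apply {d : ℕ} (z n x : EuclideanSpace ℝ (Fin d)) :
    hyperHeight z n x = inner ℝ n (x - z) := by
  simp [hyperHeight, inner_sub_right]

/-- The orthogonal projection onto the hyperplane through `z` with unit normal `n`. -/
def hyperProj {d : ℕ} (z n : EuclideanSpace ℝ (Fin d)) :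
    EuclideanSpace ℝ (Fin d) →ᵃ[ℝ] EuclideanSpace ℝ (Fin d) :=
  AffineMap.id ℝ _ - ((LinearMap.toSpanSingleton ℝ _ n).toAffineMap.comp (hyperHeight z n))

theorem hyperProj_apply {d : ℕ} (z n x : EuclideanSpace ℝ (Fin d)) :
    hyperProj z n x = x - inner ℝ n (x - z) • n := by
  simp [hyperProj, hyperHeight_apply]

/-- `K₁` and `K₂` are convex bodies on the two sides of the hyperplane through `z` with unit normal
`n`, each containing its half of the ball of radius `r` and contained in the ball of radius
`R * r` about `z`. -/
structure TwoSided {d : ℕ} (K₁ K₂ : Set (EuclideanSpace ℝ (Fin d)))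
    (z n : EuclideanSpace ℝ (Fin d)) (r R : ℝ) : Prop where
  convex₁ : Convex ℝ K₁
  convex₂ : Convex ℝ K₂
  closed₁ : IsClosed K₁
  closed₂ : IsClosed K₂
  norm_n : ‖n‖ = 1
  r_pos : 0 < r
  one_le_R : 1 ≤ R
  side₁ : ∀ x ∈ K₁, 0 ≤ hyperHeight z n x
  side₂ : ∀ x ∈ K₂, hyperHeight z n x ≤ 0
  half₁ : ∀ x, ‖x - z‖ ≤ r → 0 ≤ hyperHeight z n x → x ∈ K₁
  half₂ : ∀ x, ‖x - z‖ ≤ r → hyperHeight z n x ≤ 0 → x ∈ K₂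
  sub₁ : K₁ ⊆ Metric.closedBall z (R * r)
  sub₂ : K₂ ⊆ Metric.closedBall z (R * r)

namespace TwoSided

variable {d : ℕ} {K₁ K₂ : Set (EuclideanSpace ℝ (Fin d))} {z n : EuclideanSpace ℝ (Fin d)}
  {r R : ℝ}

theorem hyperHeight_neg (z n x : EuclideanSpace ℝ (Fin d)) :
    hyperHeight z (-n) x = -hyperHeight z n x := by
  simp [hyperHeight_apply]

theorem symm (h : TwoSided K₁ K₂ z n r R) : TwoSided K₂ K₁ z (-n) r R where
  convex₁ := h.convex₂
  convex₂ := h.convex₁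
  closed₁ := h.closed₂
  closed₂ := h.closed₁
  norm_n := by rw [norm_neg, h.norm_n]
  r_pos := h.r_pos
  one_le_R := h.one_le_R
  side₁ := fun x hx => by rw [hyperHeight_neg]; linarith [h.side₂ x hx]
  side₂ := fun x hx => by rw [hyperHeight_neg]; linarith [h.side₁ x hx]
  half₁ := fun x hx hl => h.half₂ x hx (by rw [hyperHeight_neg] at hl; linarith)
  half₂ := fun x hx hl => h.half₁ x hx (by rw [hyperHeight_neg] at hl; linarith)
  sub₁ := h.sub₂
  sub₂ := h.sub₁

theorem inner_self_eq (h : TwoSided K₁ K₂ z n r R) : inner ℝ n n = (1 : ℝ) := by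
  rw [real_inner_self_eq_norm_sq, h.norm_n, one_pow]

theorem hyperHeight_add_smul (h : TwoSided K₁ K₂ z n r R) (x : EuclideanSpace ℝ (Fin d)) (t : ℝ) :
    hyperHeight z n (x + t • n) = hyperHeight z n x + t := by
  rw [hyperHeight_apply, hyperHeight_apply, add_sub_right_comm, inner_add_right, inner_smul_right,
    h.inner_self_eq, mul_one]

theorem hyperProj_add_smul (h : TwoSided K₁ K₂ z n r R) (x : EuclideanSpace ℝ (Fin d)) (t : ℝ) :
    hyperProj z n (x + t • n) = hyperProj z n x := by
  rw [hyperProj_apply, hyperProj_apply, ← hyperHeight_apply, ← hyperHeight_apply,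
    h.hyperHeight_add_smul]
  module

theorem hyperProj_of_hyperHeight_eq_zero {x : EuclideanSpace ℝ (Fin d)}
    (hx : hyperHeight z n x = 0) : hyperProj z n x = x := by
  rw [hyperProj_apply, ← hyperHeight_apply, hx, zero_smul, sub_zero]

theorem hyperHeight_hyperProj (h : TwoSided K₁ K₂ z n r R) (x : EuclideanSpace ℝ (Fin d)) :
    hyperHeight z n (hyperProj z n x) = 0 := by
  rw [hyperProj_apply, ← hyperHeight_apply, sub_eq_add_neg, ← neg_smul, h.hyperHeight_add_smul,
    add_neg_cancel]

theorem abs_hyperHeight_sub_le (h : TwoSided K₁ K₂ z n r R) (x y : EuclideanSpace ℝ (Fin d)) :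
    |hyperHeight z n x - hyperHeight z n y| ≤ ‖x - y‖ := by
  rw [hyperHeight_apply, hyperHeight_apply, ← inner_sub_right, sub_sub_sub_cancel_right]
  refine (abs_real_inner_le_norm _ _).trans ?_
  rw [h.norm_n, one_mul]

theorem norm_hyperProj_sub_le (h : TwoSided K₁ K₂ z n r R) (x : EuclideanSpace ℝ (Fin d)) :
    ‖hyperProj z n x - z‖ ≤ ‖x - z‖ := by
  have h1 : hyperProj z n x - z = (x - z) - inner ℝ n (x - z) • n := by
    rw [hyperProj_apply]; abel
  refine (sq_le_sq₀ (norm_nonneg _) (norm_nonneg _)).1 ?_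
  rw [h1, norm_sub_sq_real, norm_smul, h.norm_n, inner_smul_right, real_inner_comm,
    Real.norm_eq_abs, mul_one, sq_abs]
  nlinarith [sq_nonneg (inner ℝ n (x - z) : ℝ)]

theorem hyperHeight_self (z n : EuclideanSpace ℝ (Fin d)) : hyperHeight z n z = 0 := by
  simp [hyperHeight_apply]

theorem exists_hyperHeight_ne_zero (h : TwoSided K₁ K₂ z n r R) : ∃ x, hyperHeight z n x ≠ 0 :=
  ⟨z + (1 : ℝ) • n, by rw [h.hyperHeight_add_smul, hyperHeight_self]; norm_num⟩

theorem r_le (h : TwoSided K₁ K₂ z n r R) : r ≤ R * r :=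
  le_mul_of_one_le_left h.r_pos.le h.one_le_R

/-- A ball about the point at height `s` of small radius lies in the first body. -/
theorem closedBall_subset₁ (h : TwoSided K₁ K₂ z n r R) {s t : ℝ} (hts : t ≤ s)
    (hst : s + t ≤ r) : Metric.closedBall (z + s • n) t ⊆ K₁ := by
  intro x hx
  rw [mem_closedBall_iff_norm] at hx
  have ht : 0 ≤ t := (norm_nonneg _).trans hx
  refine h.half₁ x ?_ ?_
  · calc ‖x - z‖ = ‖(x - (z + s • n)) + s • n‖ := by congr 1; abel
      _ ≤ t + s := by
        refine (norm_add_le _ _).trans (add_le_add hx ?_)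
        rw [norm_smul, h.norm_n, mul_one, Real.norm_of_nonneg (ht.trans hts)]
      _ ≤ r := by linarith
  · have h1 := (abs_le.1 ((h.abs_hyperHeight_sub_le x (z + s • n)).trans hx)).1
    rw [h.hyperHeight_add_smul, hyperHeight_self] at h1
    linarith

theorem interior_subset₁ (h : TwoSided K₁ K₂ z n r R) :
    interior K₁ ⊆ {x | 0 < hyperHeight z n x} := by
  intro x hx
  have hc : Continuous fun t : ℝ => x + t • n := by fun_prop
  have h1 : ∀ᶠ t : ℝ in nhds 0, x + t • n ∈ interior K₁ :=
    hc.continuousAt.eventually_mem (isOpen_interior.mem_nhds (by simpa using hx))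
  obtain ⟨t, ht, htn⟩ := ((h1.filter_mono nhdsWithin_le_nhds).and
    (self_mem_nhdsWithin (a := (0 : ℝ)) (s := Set.Iio 0))).exists
  have h2 := h.side₁ _ (interior_subset ht)
  rw [h.hyperHeight_add_smul] at h2
  have : t < 0 := htn
  simp only [Set.mem_ofPred_eq]
  linarith

theorem interior_subset₂ (h : TwoSided K₁ K₂ z n r R) :
    interior K₂ ⊆ {x | hyperHeight z n x < 0} := by
  intro x hx
  have := h.symm.interior_subset₁ hx
  simp only [Set.mem_ofPred_eq, hyperHeight_neg] at this ⊢
  linarith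

/-- Boundaries of convex sets are null, so the part of the common face inside the union does not
count. Squared norms on the union therefore split into those of the two bodies. -/
theorem restrict_interior_union (h : TwoSided K₁ K₂ z n r R) :
    (volume : Measure (EuclideanSpace ℝ (Fin d))).restrict (interior (K₁ ∪ K₂)) =
      volume.restrict (interior K₁) + volume.restrict (interior K₂) := by
  have hdisj : Disjoint (interior K₁) (interior K₂) := by
    rw [Set.disjoint_left]
    intro x h1 h2
    have h1' := h.interior_subset₁ h1
    have h2' := h.interior_subset₂ h2
    simp only [Set.mem_ofPred_eq] at h1' h2'
    linarith
  rw [← Measure.restrict_union hdisj isOpen_interior.measurableSet]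
  refine Measure.restrict_congr_set ?_
  have h1 : (interior K₁ : Set _) =ᵐ[volume] K₁ :=
    interior_ae_eq_of_null_frontier (h.convex₁.addHaar_frontier volume)
  have h2 : (interior K₂ : Set _) =ᵐ[volume] K₂ :=
    interior_ae_eq_of_null_frontier (h.convex₂.addHaar_frontier volume)
  refine Filter.EventuallyLE.antisymm ?_ ?_
  · exact Filter.EventuallyLE.trans (LE.le.eventuallyLE (interior_subset (s := K₁ ∪ K₂)))
      (h1.union h2).symm.le
  · exact Filter.Eventually.of_forall (Set.union_subset (interior_mono Set.subset_union_left)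
      (interior_mono Set.subset_union_right))

/-- The union of the bodies need not be convex; this ball is the convex set crossing the face to
which the translation estimate is applied. -/
theorem ball_subset_interior_union (h : TwoSided K₁ K₂ z n r R) :
    Metric.ball z r ⊆ interior (K₁ ∪ K₂) := by
  refine interior_maximal (fun x hx => ?_) Metric.isOpen_ball
  rw [mem_ball_iff_norm] at hx
  rcases le_total 0 (hyperHeight z n x) with hl | hl
  · exact Or.inl (h.half₁ x hx.le hl)
  · exact Or.inr (h.half₂ x hx.le hl)

theorem hyperHeight_eq_zero_of_mem_inter (h : TwoSided K₁ K₂ z n r R)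
    {x : EuclideanSpace ℝ (Fin d)} (hx : x ∈ K₁ ∩ K₂) : hyperHeight z n x = 0 :=
  le_antisymm (h.side₂ x hx.2) (h.side₁ x hx.1)

theorem volume_ne_top₁ (h : TwoSided K₁ K₂ z n r R) : volume K₁ ≠ ⊤ :=
  ((measure_mono h.sub₁).trans_lt measure_closedBall_lt_top).ne

theorem volume_le₁ (h : TwoSided K₁ K₂ z n r R) : volume.real K₁ ≤
    (R * r) ^ d * volume.real (Metric.ball (0 : EuclideanSpace ℝ (Fin d)) 1) := by
  have h0 : 0 ≤ R * r := h.r_pos.le.trans h.r_le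
  have := measureReal_mono (μ := volume) h.sub₁ measure_closedBall_lt_top.ne
  rwa [Measure.addHaar_real_closedBall _ _ h0, finrank_euclideanSpace, Fintype.card_fin] at this

theorem le_volume₁ (h : TwoSided K₁ K₂ z n r R) :
    (r / 2) ^ d * volume.real (Metric.ball (0 : EuclideanSpace ℝ (Fin d)) 1) ≤ volume.real K₁ := by
  have h0 : 0 ≤ r / 2 := by linarith [h.r_pos]
  have := measureReal_mono (μ := volume) (h.closedBall_subset₁ (s := r / 2) (t := r / 2) le_rfl
    (by linarith)) h.volume_ne_top₁
  rwa [Measure.addHaar_real_closedBall _ _ h0, finrank_euclideanSpace, Fintype.card_fin] at this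

theorem le_volume₂ (h : TwoSided K₁ K₂ z n r R) :
    (r / 2) ^ d * volume.real (Metric.ball (0 : EuclideanSpace ℝ (Fin d)) 1) ≤ volume.real K₂ :=
  h.symm.le_volume₁

theorem volume_real_interior₁ (h : TwoSided K₁ K₂ z n r R) :
    volume.real (interior K₁) = volume.real K₁ :=
  measureReal_congr (interior_ae_eq_of_null_frontier (h.convex₁.addHaar_frontier volume))

/-! ### The common face -/

/-- The measure of the face cancels between the height and the integral, leaving the smaller volume.
-/
theorem faceHeight_mul_faceNormSq_le (h : TwoSided K₁ K₂ z n r R)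
    {f : EuclideanSpace ℝ (Fin d) → ℝ} {M : ℝ} (hM0 : 0 ≤ M) (hM : ∀ x ∈ K₁ ∩ K₂, f x ^ 2 ≤ M) :
    faceHeight K₁ K₂ (K₁ ∩ K₂) * faceNormSq (K₁ ∩ K₂) f ≤
      (R * r) ^ d * volume.real (Metric.ball (0 : EuclideanSpace ℝ (Fin d)) 1) * M := by
  have hmin : min (volume.real K₁) (volume.real K₂) ≤
      (R * r) ^ d * volume.real (Metric.ball (0 : EuclideanSpace ℝ (Fin d)) 1) :=
    (min_le_left _ _).trans h.volume_le₁
  have hmin0 : 0 ≤ min (volume.real K₁) (volume.real K₂) := by positivity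
  set μ : Measure (EuclideanSpace ℝ (Fin d)) := Measure.euclideanHausdorffMeasure (d - 1)
  refine le_trans ?_ (mul_le_mul_of_nonneg_right hmin hM0)
  unfold faceHeight faceNormSq
  -- The real-valued measure is 0 also for a set of infinite measure; in both cases the height is a
  -- division by zero, hence 0.
  rcases eq_or_ne (μ.real (K₁ ∩ K₂)) 0 with h0 | h0
  · rw [h0, div_zero, zero_mul]
    positivity
  have hpos : 0 < μ.real (K₁ ∩ K₂) := measureReal_nonneg.lt_of_ne h0.symm
  have hfin : μ (K₁ ∩ K₂) < ⊤ := by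
    refine lt_top_iff_ne_top.2 fun htop => h0 ?_
    simp [measureReal_def, htop]
  have h1 : ∫ x in K₁ ∩ K₂, f x ^ 2 ∂μ ≤ M * μ.real (K₁ ∩ K₂) := by
    refine (le_abs_self _).trans ?_
    rw [← Real.norm_eq_abs]
    refine norm_setIntegral_le_of_norm_le_const hfin fun x hx => ?_
    rw [Real.norm_of_nonneg (sq_nonneg _)]
    exact hM x hx
  calc min (volume.real K₁) (volume.real K₂) / μ.real (K₁ ∩ K₂) * ∫ x in K₁ ∩ K₂, f x ^ 2 ∂μ
      ≤ min (volume.real K₁) (volume.real K₂) / μ.real (K₁ ∩ K₂) * (M * μ.real (K₁ ∩ K₂)) := by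
        gcongr
    _ = min (volume.real K₁) (volume.real K₂) * M := by field_simp

/-- An isometric parametrization of the hyperplane. -/
theorem exists_isometry_hyperplane [NeZero d] (h : TwoSided K₁ K₂ z n r R) :
    ∃ f : EuclideanSpace ℝ (Fin (d - 1)) →ᵃ[ℝ] EuclideanSpace ℝ (Fin d),
      Isometry f ∧ f 0 = z ∧ Set.range f = {x | hyperHeight z n x = 0} := by
  have hd : d - 1 + 1 = d := Nat.sub_add_cancel (NeZero.one_le)
  have : Fact (Module.finrank ℝ (EuclideanSpace ℝ (Fin d)) = (d - 1) + 1) := ⟨by simp [hd]⟩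
  have hn : n ≠ 0 := by
    intro h0
    have := h.norm_n
    rw [h0, norm_zero] at this
    exact zero_ne_one this
  set b := OrthonormalBasis.fromOrthogonalSpanSingleton (𝕜 := ℝ) (d - 1) hn
  set L : EuclideanSpace ℝ (Fin (d - 1)) →ₗᵢ[ℝ] EuclideanSpace ℝ (Fin d) :=
    (Submodule.subtypeₗᵢ _).comp b.repr.symm.toLinearIsometry with hL
  set f : EuclideanSpace ℝ (Fin (d - 1)) →ᵃ[ℝ] EuclideanSpace ℝ (Fin d) :=
    L.toLinearMap.toAffineMap + AffineMap.const ℝ _ z with hfdef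
  have hf : ∀ y, f y = L y + z := fun y => by simp [hfdef]
  refine ⟨f, ?_, by simp [hf], ?_⟩
  · refine Isometry.of_dist_eq fun x y => ?_
    rw [hf, hf, dist_add_right, L.dist_map]
  · ext x
    simp only [Set.mem_range, hf, Set.mem_ofPred_eq, hyperHeight_apply]
    rw [← Submodule.mem_orthogonal_singleton_iff_inner_right]
    constructor
    · rintro ⟨y, rfl⟩
      simp [hL]
    · intro hx
      refine ⟨b.repr ⟨x - z, hx⟩, ?_⟩
      simp [hL]

end TwoSided

/-- In isometric coordinates on the hyperplane the face lies between balls of radii `r` and `R * r`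
in dimension `d - 1`, so polynomial norm equivalence there bounds `q` at projected points. The
missing factor `r` comes from the height: volumes are at least of order `r ^ d`, the face measure at
most of order `r ^ (d - 1)`. -/
theorem exists_le_face (d ℓ : ℕ) [NeZero d] (R : ℝ) (hR : 1 ≤ R) : ∃ C : ℝ, 0 < C ∧
    ∀ (K₁ K₂ : Set (EuclideanSpace ℝ (Fin d))) (z n : EuclideanSpace ℝ (Fin d)) (r : ℝ),
      TwoSided K₁ K₂ z n r R → ∀ q ∈ polySpace d ℓ, ∀ x ∈ Metric.closedBall z (R * r),
        r ^ d * q (hyperProj z n x) ^ 2 ≤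
          C * (faceHeight K₁ K₂ (K₁ ∩ K₂) * faceNormSq (K₁ ∩ K₂) q) := by
  obtain ⟨C, hC, H⟩ := exists_poly_bound (d - 1) ℓ R
  set α := volume.real (Metric.ball (0 : EuclideanSpace ℝ (Fin d)) 1) with hα
  set β := volume.real (Metric.ball (0 : EuclideanSpace ℝ (Fin (d - 1))) 1) with hβ
  have hα0 : 0 < α := ENNReal.toReal_pos (Metric.measure_ball_pos _ _ one_pos).ne'
    measure_ball_lt_top.ne
  have hβ0 : 0 < β := ENNReal.toReal_pos (Metric.measure_ball_pos _ _ one_pos).ne'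
    measure_ball_lt_top.ne
  have hR0 : 0 < R := by linarith
  refine ⟨C * (2 ^ d * (R ^ (d - 1) * β) / α), by positivity,
    fun K₁ K₂ z n r h q hq x hx => ?_⟩
  have hr := h.r_pos
  obtain ⟨f, hfi, hf0, hfr⟩ := h.exists_isometry_hyperplane
  set F := K₁ ∩ K₂ with hF
  set S := f ⁻¹' F with hS
  have hFcl : IsClosed F := h.closed₁.inter h.closed₂
  have hFr : F ⊆ Set.range f := by
    rw [hfr]
    exact fun x hx => h.hyperHeight_eq_zero_of_mem_inter hx
  have hdist : ∀ y, ‖f y - z‖ = ‖y‖ := fun y => by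
    rw [← dist_eq_norm, ← hf0, hfi.dist_eq, dist_zero_right]
  have hSin : Metric.closedBall 0 r ⊆ S := by
    intro y hy
    rw [mem_closedBall_zero_iff, ← hdist] at hy
    have h0 : hyperHeight z n (f y) = 0 := by
      have : f y ∈ Set.range f := ⟨y, rfl⟩
      rwa [hfr] at this
    exact ⟨h.half₁ _ hy h0.ge, h.half₂ _ hy h0.le⟩
  have hSout : S ⊆ Metric.closedBall 0 (R * r) := by
    intro y hy
    have h1 := h.sub₁ hy.1
    rwa [mem_closedBall_iff_norm, hdist, ← mem_closedBall_zero_iff] at h1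
  have hScl : IsClosed S := hFcl.preimage hfi.continuous
  have hSc : IsCompact S := (isCompact_closedBall _ _).of_isClosed_subset hScl hSout
  have hqf : (fun y => q (f y)) ∈ polySpace (d - 1) ℓ := polySpace_comp_affineMap hq f
  have hmap := hfi.map_euclideanHausdorffMeasure (d := d - 1)
  rw [EuclideanSpace.euclideanHausdorffMeasure_eq_volume] at hmap
  have hemb : MeasurableEmbedding f := hfi.isClosedEmbedding.measurableEmbedding
  have hres : (Measure.euclideanHausdorffMeasure (d - 1) :
      Measure (EuclideanSpace ℝ (Fin d))).restrict F = (Measure.map f volume).restrict F := by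
    rw [hmap, Measure.restrict_restrict_of_subset hFr]
  have hnorm : faceNormSq F q = ∫ y in S, q (f y) ^ 2 := by
    unfold faceNormSq
    rw [hres, hemb.setIntegral_map]
  have hmeas : (Measure.euclideanHausdorffMeasure (d - 1) :
      Measure (EuclideanSpace ℝ (Fin d))).real F = volume.real S := by
    rw [measureReal_def, measureReal_def, ← Measure.restrict_apply_self _ F, hres,
      Measure.restrict_apply_self, hemb.map_apply]
  have hSle : volume.real S ≤ (R * r) ^ (d - 1) * β := by
    have := measureReal_mono (μ := volume) hSout measure_closedBall_lt_top.ne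
    rwa [Measure.addHaar_real_closedBall _ _ (by positivity), finrank_euclideanSpace,
      Fintype.card_fin] at this
  have hSpos : 0 < volume.real S := by
    have := measureReal_mono (μ := volume) hSin hSc.measure_lt_top.ne
    rw [Measure.addHaar_real_closedBall _ _ hr.le] at this
    exact lt_of_lt_of_le (by positivity) this
  have hint : ∫ y in Metric.closedBall 0 r, q (f y) ^ 2 ≤ ∫ y in S, q (f y) ^ 2 := by
    refine setIntegral_mono_set ?_ (Filter.Eventually.of_forall fun y => sq_nonneg _)
      (Filter.Eventually.of_forall hSin)
    exact ((continuous_of_mem_polySpace hqf).pow 2).continuousOn.integrableOn_compact hSc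
  set J := ∫ y in S, q (f y) ^ 2 with hJ
  have hJ0 : 0 ≤ J := integral_nonneg fun y => sq_nonneg _
  obtain ⟨y, hy⟩ : hyperProj z n x ∈ Set.range f := by
    rw [hfr]
    exact h.hyperHeight_hyperProj x
  have hyb : y ∈ Metric.closedBall 0 (R * r) := by
    rw [mem_closedBall_zero_iff, ← hdist, hy]
    rw [mem_closedBall_iff_norm] at hx
    exact (h.norm_hyperProj_sub_le x).trans hx
  have hb := (H _ hqf 0 r hr y hyb).1
  rw [hy] at hb
  have hmin : (r / 2) ^ d * α ≤ min (volume.real K₁) (volume.real K₂) :=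
    le_min h.le_volume₁ h.le_volume₂
  rw [hnorm, faceHeight, hmeas]
  have h1 : (r / 2) ^ d * α / ((R * r) ^ (d - 1) * β) ≤
      min (volume.real K₁) (volume.real K₂) / volume.real S := by gcongr
  have hrd : r ^ d ≠ 0 := by positivity
  have hrd1 : r ^ (d - 1) ≠ 0 := by positivity
  have hRd1 : R ^ (d - 1) ≠ 0 := by positivity
  calc r ^ d * q (hyperProj z n x) ^ 2
      ≤ r ^ d * (C * ((r ^ (d - 1))⁻¹ * J)) := by
        refine mul_le_mul_of_nonneg_left (hb.trans ?_) (by positivity)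
        gcongr
    _ = C * (2 ^ d * (R ^ (d - 1) * β) / α) *
          ((r / 2) ^ d * α / ((R * r) ^ (d - 1) * β) * J) := by
        rw [div_pow, mul_pow]
        field_simp
    _ ≤ _ := by gcongr

/-! ### Square integrable functions with square integrable weak gradient -/

/-- `u` is square integrable on `Ω`, with the square integrable weak gradient `g`. -/
structure IsH1 {d : ℕ} (Ω : Set (EuclideanSpace ℝ (Fin d))) (u : EuclideanSpace ℝ (Fin d) → ℝ)
    (g : EuclideanSpace ℝ (Fin d) → EuclideanSpace ℝ (Fin d)) : Prop where
  memLp : MemLp u 2 (volume.restrict Ω)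
  memLp_grad : MemLp g 2 (volume.restrict Ω)
  weak : IsWeakGradient Ω u g

theorem memLp_two_of_continuous {d : ℕ} {E : Type*} [NormedAddCommGroup E]
    {Ω : Set (EuclideanSpace ℝ (Fin d))} {f : EuclideanSpace ℝ (Fin d) → E}
    (hf : Continuous f) {z : EuclideanSpace ℝ (Fin d)} {ρ : ℝ} (hΩ : Ω ⊆ Metric.closedBall z ρ) :
    MemLp f 2 (volume.restrict Ω) := by
  refine MemLp.mono_measure (Measure.restrict_mono hΩ le_rfl) ?_
  have : IsFiniteMeasure ((volume : Measure (EuclideanSpace ℝ (Fin d))).restrict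
    (Metric.closedBall z ρ)) := ⟨by simpa using measure_closedBall_lt_top⟩
  obtain ⟨C, hC⟩ := (isCompact_closedBall z ρ).exists_bound_of_continuousOn hf.continuousOn
  refine MemLp.of_bound ?_ C ((ae_restrict_iff' Metric.isClosed_closedBall.measurableSet).2
    (Filter.Eventually.of_forall hC))
  exact hf.continuousOn.aestronglyMeasurable_of_isCompact (isCompact_closedBall z ρ)
    Metric.isClosed_closedBall.measurableSet

namespace IsH1

variable {d : ℕ} {Ω Ω' : Set (EuclideanSpace ℝ (Fin d))} {u v : EuclideanSpace ℝ (Fin d) → ℝ}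
  {g g' : EuclideanSpace ℝ (Fin d) → EuclideanSpace ℝ (Fin d)}

theorem mono (h : IsH1 Ω u g) (hs : Ω' ⊆ Ω) : IsH1 Ω' u g :=
  ⟨h.memLp.mono_measure (Measure.restrict_mono hs le_rfl),
    h.memLp_grad.mono_measure (Measure.restrict_mono hs le_rfl), h.weak.mono hs⟩

theorem sub (h : IsH1 Ω u g) (h' : IsH1 Ω v g') : IsH1 Ω (u - v) (g - g') :=
  ⟨h.memLp.sub h'.memLp, h.memLp_grad.sub h'.memLp_grad, h.weak.sub h'.weak⟩

theorem congr (hΩ : IsOpen Ω) (h : IsH1 Ω u g) (hu : Set.EqOn u v Ω) (hg : Set.EqOn g g' Ω) :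
    IsH1 Ω v g' := by
  refine ⟨h.memLp.ae_eq ?_, h.memLp_grad.ae_eq ?_, h.weak.congr hΩ hu hg⟩
  · exact (ae_restrict_iff' hΩ.measurableSet).2 (Filter.Eventually.of_forall hu)
  · exact (ae_restrict_iff' hΩ.measurableSet).2 (Filter.Eventually.of_forall hg)

theorem of_contDiff {p : EuclideanSpace ℝ (Fin d) → ℝ} (hp : ContDiff ℝ ∞ p)
    {z : EuclideanSpace ℝ (Fin d)} {ρ : ℝ} (hΩ : Ω ⊆ Metric.closedBall z ρ) :
    IsH1 Ω p (gradient p) :=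
  ⟨memLp_two_of_continuous hp.continuous hΩ, memLp_two_of_continuous (continuous_gradient hp) hΩ,
    isWeakGradient_of_contDiff hp Ω⟩

theorem integrable_sq (h : IsH1 Ω u g) : Integrable (fun x => u x ^ 2) (volume.restrict Ω) :=
  (memLp_two_iff_integrable_sq h.memLp.1).1 h.memLp

theorem integrable_grad_sq (h : IsH1 Ω u g) :
    Integrable (fun x => ‖g x‖ ^ 2) (volume.restrict Ω) :=
  (memLp_two_iff_integrable_sq_norm h.memLp_grad.1).1 h.memLp_grad

theorem rdNorm_sq (h : IsH1 Ω u g) (hΩ : IsOpen Ω) {ε : ℝ} (hε : 0 ≤ ε) :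
    rdNorm ε Ω u ^ 2 = (∫ x in Ω, u x ^ 2) + ε * ∫ x in Ω, ‖g x‖ ^ 2 :=
  h.weak.rdNorm_sq hΩ hε

theorem integral_sq_le_rdNorm_sq (h : IsH1 Ω u g) (hΩ : IsOpen Ω) {ε : ℝ} (hε : 0 ≤ ε) :
    ∫ x in Ω, u x ^ 2 ≤ rdNorm ε Ω u ^ 2 := by
  rw [h.rdNorm_sq hΩ hε]
  have : 0 ≤ ∫ x in Ω, ‖g x‖ ^ 2 := integral_nonneg fun x => sq_nonneg _
  nlinarith [mul_nonneg hε this]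

theorem integral_grad_sq_le_rdNorm_sq (h : IsH1 Ω u g) (hΩ : IsOpen Ω) {ε : ℝ} (hε : 0 ≤ ε) :
    ε * ∫ x in Ω, ‖g x‖ ^ 2 ≤ rdNorm ε Ω u ^ 2 := by
  rw [h.rdNorm_sq hΩ hε]
  have : 0 ≤ ∫ x in Ω, u x ^ 2 := integral_nonneg fun x => sq_nonneg _
  linarith

theorem rdNorm_congr (h : IsH1 Ω u g) (hΩ : IsOpen Ω) (hu : Set.EqOn u v Ω) {ε : ℝ}
    (hε : 0 ≤ ε) : rdNorm ε Ω u ^ 2 = rdNorm ε Ω v ^ 2 := by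
  rw [h.rdNorm_sq hΩ hε, (h.congr hΩ hu (Set.eqOn_refl g Ω)).rdNorm_sq hΩ hε]
  congr 1
  exact setIntegral_congr_fun hΩ.measurableSet fun x hx => by simp only [hu hx]

theorem rdNorm_sq_union {K₁ K₂ : Set (EuclideanSpace ℝ (Fin d))} {z n : EuclideanSpace ℝ (Fin d)}
    {r R : ℝ} (hK : TwoSided K₁ K₂ z n r R) (h : IsH1 (interior (K₁ ∪ K₂)) u g) {ε : ℝ}
    (hε : 0 ≤ ε) : rdNorm ε (interior (K₁ ∪ K₂)) u ^ 2 =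
      rdNorm ε (interior K₁) u ^ 2 + rdNorm ε (interior K₂) u ^ 2 := by
  have h1 := h.mono (interior_mono Set.subset_union_left : interior K₁ ⊆ _)
  have h2 := h.mono (interior_mono Set.subset_union_right : interior K₂ ⊆ _)
  rw [h.rdNorm_sq isOpen_interior hε, h1.rdNorm_sq isOpen_interior hε,
    h2.rdNorm_sq isOpen_interior hε, hK.restrict_interior_union,
    integral_add_measure h1.integrable_sq h2.integrable_sq,
    integral_add_measure h1.integrable_grad_sq h2.integrable_grad_sq]
  ring

end IsH1

theorem MemH1.exists_isH1 {d : ℕ} {Ω : Set (EuclideanSpace ℝ (Fin d))}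
    {u : EuclideanSpace ℝ (Fin d) → ℝ} (h : MemH1 Ω u) : ∃ g, IsH1 Ω u g := by
  obtain ⟨hu, g, hg, hw⟩ := h
  exact ⟨g, hu, hg, hw⟩

theorem gradient_sub_eq {d : ℕ} {p q : EuclideanSpace ℝ (Fin d) → ℝ} (hp : Differentiable ℝ p)
    (hq : Differentiable ℝ q) (x : EuclideanSpace ℝ (Fin d)) :
    gradient (p - q) x = gradient p x - gradient q x := by
  rw [gradient, fderiv_sub (hp x) (hq x), map_sub]
  rfl

/-- On the union `v` is `p₂` plus the truncation of `p₁ - p₂` to the positive side. The two pieces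
agree on a disc of the hyperplane, hence on the whole hyperplane because they are polynomials, so
the truncation has a weak gradient. -/
theorem TwoSided.isH1_piecewise {d ℓ : ℕ} {K₁ K₂ : Set (EuclideanSpace ℝ (Fin d))}
    {z n : EuclideanSpace ℝ (Fin d)} {r R : ℝ} (hK : TwoSided K₁ K₂ z n r R)
    {v p₁ p₂ : EuclideanSpace ℝ (Fin d) → ℝ} (hp₁ : p₁ ∈ polySpace d ℓ) (hp₂ : p₂ ∈ polySpace d ℓ)
    (h₁ : Set.EqOn v p₁ K₁) (h₂ : Set.EqOn v p₂ K₂) :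
    ∃ G, IsH1 (interior (K₁ ∪ K₂)) v G ∧ Set.EqOn G (gradient p₁) (interior K₁) ∧
      Set.EqOn G (gradient p₂) (interior K₂) := by
  have hq : p₁ - p₂ ∈ polySpace d ℓ := polySpace_sub hp₁ hp₂
  have hqd := contDiff_of_mem_polySpace hq
  have h0 : ∀ x, hyperHeight z n x = 0 → (p₁ - p₂) x = 0 := by
    -- Composing with the projection turns vanishing on a disc into vanishing on a full-dimensional
    -- ball, where the identity theorem applies.
    have hπ : (fun x => (p₁ - p₂) (hyperProj z n x)) = 0 := by
      refine eq_zero_of_mem_polySpace_of_eqOn_ball (polySpace_comp_affineMap hq (hyperProj z n))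
        (z := z) hK.r_pos fun x hx => ?_
      rw [mem_ball_iff_norm] at hx
      have h1 := (hK.norm_hyperProj_sub_le x).trans hx.le
      have h2 := hK.hyperHeight_hyperProj x
      have e1 := h₁ (hK.half₁ _ h1 h2.ge)
      have e2 := h₂ (hK.half₂ _ h1 h2.le)
      simp [← e1, ← e2]
    intro x hx
    have := congrFun hπ x
    simp only [TwoSided.hyperProj_of_hyperHeight_eq_zero hx] at this
    exact this
  set S : Set (EuclideanSpace ℝ (Fin d)) := {x | 0 < hyperHeight z n x} with hS
  have hSm : MeasurableSet S :=
    ((hyperHeight z n).continuous_of_finiteDimensional.isOpen_preimage _ isOpen_Ioi).measurableSet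
  have hb : interior (K₁ ∪ K₂) ⊆ Metric.closedBall z (R * r) :=
    interior_subset.trans (Set.union_subset hK.sub₁ hK.sub₂)
  have hw : IsH1 (interior (K₁ ∪ K₂)) (S.indicator (p₁ - p₂)) (S.indicator (gradient (p₁ - p₂))) :=
    ⟨(memLp_two_of_continuous hqd.continuous hb).indicator hSm,
      (memLp_two_of_continuous (continuous_gradient hqd) hb).indicator hSm,
      isWeakGradient_indicator _ hK.exists_hyperHeight_ne_zero hqd h0 _⟩
  have hw2 := IsH1.of_contDiff (contDiff_of_mem_polySpace hp₂) hb
  have hsum : IsH1 (interior (K₁ ∪ K₂)) (p₂ + S.indicator (p₁ - p₂))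
      (gradient p₂ + S.indicator (gradient (p₁ - p₂))) :=
    ⟨hw2.memLp.add hw.memLp, hw2.memLp_grad.add hw.memLp_grad, hw2.weak.add hw.weak⟩
  refine ⟨_, hsum.congr isOpen_interior ?_ (Set.eqOn_refl _ _), fun x hx => ?_, fun x hx => ?_⟩
  · intro x hx
    rcases interior_subset hx with hx | hx
    · rw [h₁ hx]
      rcases (hK.side₁ x hx).eq_or_lt with hl | hl
      · have : x ∉ S := hl.not_lt
        have h3 := h0 x hl.symm
        simp only [Pi.sub_apply] at h3
        simp only [Pi.add_apply, Set.indicator_of_notMem this]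
        linarith
      · have : x ∈ S := hl
        simp [Set.indicator_of_mem this]
    · have : x ∉ S := (hK.side₂ x hx).not_gt
      simp [Set.indicator_of_notMem this, h₂ hx]
  · have : x ∈ S := hK.interior_subset₁ hx
    simp only [Pi.add_apply, Set.indicator_of_mem this]
    rw [gradient_sub_eq (differentiable_of_mem_polySpace hp₁) (differentiable_of_mem_polySpace hp₂)]
    abel
  · have hneg : hyperHeight z n x < 0 := hK.interior_subset₂ hx
    have : x ∉ S := hneg.not_gt
    simp [Set.indicator_of_notMem this]

/-- Adding a constant to `P` leaves the gradient unchanged, so minimality is a statement about the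
L² part alone, whatever `ε` is: its first variation in the direction of constants vanishes. -/
theorem IsBestApprox.integral_eq_zero {d ℓ : ℕ} {Ω : Set (EuclideanSpace ℝ (Fin d))}
    (hΩ : IsOpen Ω) {z : EuclideanSpace ℝ (Fin d)} {ρ : ℝ} (hb : Ω ⊆ Metric.closedBall z ρ)
    {u P : EuclideanSpace ℝ (Fin d) → ℝ}
    {g : EuclideanSpace ℝ (Fin d) → EuclideanSpace ℝ (Fin d)} (hu : IsH1 Ω u g) {ε : ℝ}
    (hε : 0 ≤ ε) (hP : IsBestApprox ε Ω (polySpace d ℓ) u P) : ∫ x in Ω, (u - P) x = 0 := by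
  have hfin : volume Ω < ⊤ := (measure_mono hb).trans_lt measure_closedBall_lt_top
  have : IsFiniteMeasure (volume.restrict Ω) := ⟨by simpa using hfin⟩
  have hPd := contDiff_of_mem_polySpace hP.1
  have hw : IsH1 Ω (u - P) (g - gradient P) := hu.sub (IsH1.of_contDiff hPd hb)
  have hi1 : Integrable (u - P) (volume.restrict Ω) := hw.memLp.integrable (by norm_num)
  set I := ∫ x in Ω, (u - P) x with hI
  have key : ∀ t : ℝ, 2 * t * I ≤ t ^ 2 * volume.real Ω := by
    intro t
    set c : EuclideanSpace ℝ (Fin d) → ℝ := fun _ => t with hc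
    have hPt : P + c ∈ polySpace d ℓ := polySpace_add hP.1 (const_mem_polySpace d ℓ t)
    have h1 := pow_le_pow_left₀ (Real.sqrt_nonneg _) (hP.2 _ hPt) 2
    have hgr : gradient (P + c) = gradient P := by
      funext x
      rw [gradient, gradient, show (P + c) = fun x => P x + t from rfl, fderiv_add_const]
    have hwt : IsH1 Ω (u - (P + c)) (g - gradient P) := by
      have := hu.sub (IsH1.of_contDiff (contDiff_of_mem_polySpace hPt) hb)
      rwa [hgr] at this
    have e : ∫ x in Ω, (u - (P + c)) x ^ 2 =
        (∫ x in Ω, (u - P) x ^ 2) - 2 * t * I + t ^ 2 * volume.real Ω := by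
      have e1 : ∀ x, (u - (P + c)) x ^ 2 =
          (u - P) x ^ 2 - 2 * t * (u - P) x + t ^ 2 := fun x => by
        simp only [Pi.sub_apply, Pi.add_apply, hc]; ring
      simp only [e1]
      have i1 : Integrable (fun x => (u - P) x ^ 2 - 2 * t * (u - P) x) (volume.restrict Ω) :=
        hw.integrable_sq.sub (hi1.const_mul _)
      rw [integral_add i1 (integrable_const _),
        integral_sub hw.integrable_sq (hi1.const_mul _), integral_const_mul]
      simp [hI, mul_comm]
    change rdNorm ε Ω (u - P) ^ 2 ≤ _ at h1
    rw [hw.rdNorm_sq hΩ hε, hwt.rdNorm_sq hΩ hε, e] at h1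
    linarith
  -- For positive volume the optimal shift is `I` divided by the volume; for zero volume any nonzero
  -- multiple of `I` works.
  rcases eq_or_lt_of_le (measureReal_nonneg (μ := volume) (s := Ω)) with h0 | hpos
  · have h1 := key I
    rw [← h0] at h1
    nlinarith [sq_nonneg I]
  · have h1 := key (I / volume.real Ω)
    have h2 : 2 * (I / volume.real Ω) * I = 2 * (I ^ 2 / volume.real Ω) := by ring
    have h3 : (I / volume.real Ω) ^ 2 * volume.real Ω = I ^ 2 / volume.real Ω := by
      field_simp
    rw [h2, h3] at h1
    have h4 : I ^ 2 / volume.real Ω ≤ 0 := by linarith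
    have h5 : I ^ 2 ≤ 0 := by
      rw [div_le_iff₀ hpos] at h4
      linarith
    exact pow_eq_zero_iff two_ne_zero |>.1 (le_antisymm h5 (sq_nonneg I))

theorem IsH1.integral_translate_sub_le {d : ℕ} {Ω a : Set (EuclideanSpace ℝ (Fin d))}
    (hΩ : IsOpen Ω) (hconv : Convex ℝ Ω) {f : EuclideanSpace ℝ (Fin d) → ℝ}
    {g : EuclideanSpace ℝ (Fin d) → EuclideanSpace ℝ (Fin d)} (hf : IsH1 Ω f g)
    {h : EuclideanSpace ℝ (Fin d)} (ha : a ⊆ Ω) (hah : ∀ x ∈ a, x + h ∈ Ω) :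
    MemLp (fun x => f (x + h)) 2 (volume.restrict a) ∧
      ∫ x in a, (f (x + h) - f x) ^ 2 ≤ ∫ x in Ω, inner ℝ (g x) h ^ 2 := by
  have h1 : MemLp (fun x => f (x + h)) 2 (volume.restrict a) := by
    have hmp := (measurePreserving_add_right (volume : Measure (EuclideanSpace ℝ (Fin d)))
      h).restrict_preimage_emb (measurableEmbedding_addRight h) Ω
    exact (hf.memLp.comp_measurePreserving hmp).mono_measure (Measure.restrict_mono hah le_rfl)
  have h2 : MemLp (fun x => f (x + h) - f x) 2 (volume.restrict a) :=
    h1.sub (hf.memLp.mono_measure (Measure.restrict_mono ha le_rfl))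
  have h3 : MemLp (fun x => (inner ℝ (g x) h : ℝ)) 2 (volume.restrict Ω) :=
    hf.memLp_grad.inner_const h
  refine ⟨h1, ?_⟩
  have h4 := (lintegral_mono_set (μ := volume) (f := fun x => ‖f (x + h) - f x‖ₑ ^ 2)
    (fun x hx => ⟨ha hx, hah x hx⟩ : a ⊆ {x | x ∈ Ω ∧ x + h ∈ Ω})).trans
    (lintegral_translate_sub_le hΩ hconv hf.weak hf.memLp_grad h)
  rw [lintegral_enorm_sq_eq_ofReal h2, lintegral_enorm_sq_eq_ofReal h3,
    ENNReal.ofReal_le_ofReal_iff (integral_nonneg fun x => sq_nonneg _)] at h4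
  simpa only [Real.norm_eq_abs, sq_abs] using h4

/-! ### Jump augmentation for pairs of convex bodies -/

theorem volume_real_unit_ball_pos (d : ℕ) :
    0 < volume.real (Metric.ball (0 : EuclideanSpace ℝ (Fin d)) 1) :=
  ENNReal.toReal_pos (Metric.measure_ball_pos _ _ one_pos).ne' measure_ball_lt_top.ne

theorem exists_poly_bound_near (d ℓ : ℕ) (R : ℝ) : ∃ C : ℝ, 0 < C ∧
    ∀ p ∈ polySpace d ℓ, ∀ (z y : EuclideanSpace ℝ (Fin d)) (r : ℝ), 0 < r → ‖y - z‖ ≤ r →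
      ∀ x ∈ Metric.closedBall z (R * r),
      r ^ d * p x ^ 2 ≤ C * ∫ x in Metric.closedBall y (r / 8), p x ^ 2 ∧
      r ^ d * ‖gradient p x‖ ^ 2 ≤
        C * ((r ^ 2)⁻¹ * ∫ x in Metric.closedBall y (r / 8), p x ^ 2) := by
  -- A point within `R * r` of `z` is within `(R + 1) * r` of `y`, that is, `8 * (R + 1)` radii of
  -- the small ball. The factors `8 ^ d` and 64 below undo the scaling by `r / 8`.
  obtain ⟨C, hC, H⟩ := exists_poly_bound d ℓ (8 * (R + 1))
  refine ⟨C * 64 * 8 ^ d, by positivity, fun p hp z y r hr hyz x hx => ?_⟩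
  have hx' : x ∈ Metric.closedBall y (8 * (R + 1) * (r / 8)) := by
    rw [mem_closedBall_iff_norm] at hx ⊢
    have h1 : ‖x - y‖ ≤ ‖x - z‖ + ‖y - z‖ := by
      rw [← norm_neg (y - z)]
      calc ‖x - y‖ = ‖(x - z) + -(y - z)‖ := by congr 1; abel
        _ ≤ _ := norm_add_le _ _
    linarith
  obtain ⟨h1, h2⟩ := H p hp y (r / 8) (by positivity) x hx'
  set I := ∫ x in Metric.closedBall y (r / 8), p x ^ 2 with hI
  have hI0 : 0 ≤ I := integral_nonneg fun x => sq_nonneg _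
  have e : r ^ d * ((r / 8) ^ d)⁻¹ = 8 ^ d := by
    rw [div_pow, inv_div]; field_simp
  constructor
  · calc r ^ d * p x ^ 2 ≤ r ^ d * (C * (((r / 8) ^ d)⁻¹ * I)) := by gcongr
      _ = C * 8 ^ d * I := by rw [← e]; ring
      _ ≤ C * 64 * 8 ^ d * I := by
        have : 0 ≤ C * 8 ^ d * I := by positivity
        linarith
  · rw [norm_gradient_eq]
    calc r ^ d * ‖fderiv ℝ p x‖ ^ 2 ≤
        r ^ d * (C * (((r / 8) ^ 2)⁻¹ * (((r / 8) ^ d)⁻¹ * I))) := by gcongr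
      _ = C * (r ^ d * ((r / 8) ^ d)⁻¹) * (((r / 8) ^ 2)⁻¹ * I) := by ring
      _ = C * 64 * 8 ^ d * ((r ^ 2)⁻¹ * I) := by
        rw [e, div_pow, inv_div]; field_simp; norm_num; ring

theorem TwoSided.closedBall_subset_interior₁ {d : ℕ} {K₁ K₂ : Set (EuclideanSpace ℝ (Fin d))}
    {z n : EuclideanSpace ℝ (Fin d)} {r R : ℝ} (hK : TwoSided K₁ K₂ z n r R) :
    Metric.closedBall (z + (r / 4) • n) (r / 8) ⊆ interior K₁ := by
  have hr := hK.r_pos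
  refine (Metric.closedBall_subset_ball (by linarith : r / 8 < r / 4)).trans
    (interior_maximal (Metric.ball_subset_closedBall.trans
      (hK.closedBall_subset₁ le_rfl (by linarith))) Metric.isOpen_ball)

theorem TwoSided.closedBall_subset_interior₂ {d : ℕ} {K₁ K₂ : Set (EuclideanSpace ℝ (Fin d))}
    {z n : EuclideanSpace ℝ (Fin d)} {r R : ℝ} (hK : TwoSided K₁ K₂ z n r R) :
    Metric.closedBall (z - (r / 4) • n) (r / 8) ⊆ interior K₂ := by
  have := hK.symm.closedBall_subset_interior₁
  rwa [smul_neg, ← sub_eq_add_neg] at this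

theorem exists_sq_le_integral (d ℓ : ℕ) (R : ℝ) : ∃ C : ℝ, 0 < C ∧
    ∀ (K₁ K₂ : Set (EuclideanSpace ℝ (Fin d))) (z n : EuclideanSpace ℝ (Fin d)) (r : ℝ),
      TwoSided K₁ K₂ z n r R → ∀ p ∈ polySpace d ℓ, ∀ x ∈ Metric.closedBall z (R * r),
        r ^ d * p x ^ 2 ≤ C * ∫ x in interior K₁, p x ^ 2 := by
  obtain ⟨C, hC, H⟩ := exists_poly_bound_near d ℓ R
  refine ⟨C, hC, fun K₁ K₂ z n r hK p hp x hx => ?_⟩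
  have hr := hK.r_pos
  have hn : ‖z + (r / 4) • n - z‖ ≤ r := by
    rw [add_sub_cancel_left, norm_smul, hK.norm_n, Real.norm_of_nonneg (by positivity)]
    linarith
  refine (H p hp z _ r hr hn x hx).1.trans (mul_le_mul_of_nonneg_left ?_ hC.le)
  refine setIntegral_mono_set ?_ (Filter.Eventually.of_forall fun y => sq_nonneg _)
    (LE.le.eventuallyLE hK.closedBall_subset_interior₁)
  have hb : interior K₁ ⊆ Metric.closedBall z (R * r) := interior_subset.trans hK.sub₁
  exact (IsH1.of_contDiff (contDiff_of_mem_polySpace hp) hb).integrable_sq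

theorem integral_sub_sq_le {α : Type*} [MeasurableSpace α] {μ : Measure α} {u p q : α → ℝ}
    (hp : MemLp (u - p) 2 μ) (hq : MemLp (u - q) 2 μ) :
    ∫ x, (p - q) x ^ 2 ∂μ ≤ 2 * (∫ x, (u - p) x ^ 2 ∂μ) + 2 * ∫ x, (u - q) x ^ 2 ∂μ := by
  have i1 := ((memLp_two_iff_integrable_sq hp.1).1 hp).const_mul 2
  have i2 := ((memLp_two_iff_integrable_sq hq.1).1 hq).const_mul 2
  rw [← integral_const_mul, ← integral_const_mul, ← integral_add i1 i2]
  refine integral_mono_of_nonneg (Filter.Eventually.of_forall fun x => sq_nonneg _) (i1.add i2)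
    (Filter.Eventually.of_forall fun x => ?_)
  simp only [Pi.sub_apply]
  nlinarith [sq_nonneg ((u x - p x) + (u x - q x))]

/-- On each body `v` is one of the polynomials over which `Pᵢ` is optimal, which handles the two
errors. For the jump, `v` is single-valued on the face, so the jump is the difference of the
polynomials `Pᵢ - pᵢ`, whose pointwise values are controlled by L² norms. -/
theorem exists_jump_augmentation_lower (d ℓ : ℕ) (R : ℝ) : ∃ C : ℝ, 0 < C ∧
    ∀ (K₁ K₂ : Set (EuclideanSpace ℝ (Fin d))) (z n : EuclideanSpace ℝ (Fin d)) (r : ℝ),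
      TwoSided K₁ K₂ z n r R → ∀ ε : ℝ, 0 < ε → ∀ u : EuclideanSpace ℝ (Fin d) → ℝ,
      MemH1 (interior (K₁ ∪ K₂)) u → ∀ P₁ P₂ : EuclideanSpace ℝ (Fin d) → ℝ,
      IsBestApprox ε (interior K₁) (polySpace d ℓ) u P₁ →
      IsBestApprox ε (interior K₂) (polySpace d ℓ) u P₂ → ∀ v ∈ pairSpace ℓ K₁ K₂,
      faceHeight K₁ K₂ (K₁ ∩ K₂) * faceNormSq (K₁ ∩ K₂) (P₁ - P₂)
          + (rdNorm ε (interior K₁) (u - P₁) ^ 2 + rdNorm ε (interior K₂) (u - P₂) ^ 2) ≤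
        C * rdNorm ε (interior (K₁ ∪ K₂)) (u - v) ^ 2 := by
  obtain ⟨C, hC, H⟩ := exists_sq_le_integral d ℓ R
  set α := volume.real (Metric.ball (0 : EuclideanSpace ℝ (Fin d)) 1) with hα
  have hα0 : 0 < α := volume_real_unit_ball_pos d
  -- The absolute value gives positivity before a pair is chosen; only the pair provides `1 ≤ R`.
  refine ⟨1 + |R| ^ d * α * (8 * C), by positivity, ?_⟩
  rintro K₁ K₂ z n r hK ε hε u hu P₁ P₂ hP₁ hP₂ v ⟨-, ⟨p₁, hp₁, hv₁⟩, ⟨p₂, hp₂, hv₂⟩⟩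
  have hr := hK.r_pos
  obtain ⟨g, hg⟩ := hu.exists_isH1
  obtain ⟨G, hG, -, -⟩ := hK.isH1_piecewise hp₁ hp₂ hv₁ hv₂
  have hs₁ : interior K₁ ⊆ interior (K₁ ∪ K₂) := interior_mono Set.subset_union_left
  have hs₂ : interior K₂ ⊆ interior (K₁ ∪ K₂) := interior_mono Set.subset_union_right
  have hb₁ : interior K₁ ⊆ Metric.closedBall z (R * r) := interior_subset.trans hK.sub₁
  have hb₂ : interior K₂ ⊆ Metric.closedBall z (R * r) := interior_subset.trans hK.sub₂
  have hdiff := hg.sub hG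
  have e₁ : rdNorm ε (interior K₁) (u - v) ^ 2 = rdNorm ε (interior K₁) (u - p₁) ^ 2 :=
    (hdiff.mono hs₁).rdNorm_congr isOpen_interior
      (fun x hx => by simp [hv₁ (interior_subset hx)]) hε.le
  have e₂ : rdNorm ε (interior K₂) (u - v) ^ 2 = rdNorm ε (interior K₂) (u - p₂) ^ 2 :=
    (hdiff.mono hs₂).rdNorm_congr isOpen_interior
      (fun x hx => by simp [hv₂ (interior_subset hx)]) hε.le
  rw [hdiff.rdNorm_sq_union hK hε.le, e₁, e₂]
  set t₁ := rdNorm ε (interior K₁) (u - p₁) ^ 2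
  set t₂ := rdNorm ε (interior K₂) (u - p₂) ^ 2
  have le₁ : rdNorm ε (interior K₁) (u - P₁) ^ 2 ≤ t₁ :=
    pow_le_pow_left₀ (Real.sqrt_nonneg _) (hP₁.2 _ hp₁) 2
  have le₂ : rdNorm ε (interior K₂) (u - P₂) ^ 2 ≤ t₂ :=
    pow_le_pow_left₀ (Real.sqrt_nonneg _) (hP₂.2 _ hp₂) 2
  have hw₁ := (hg.mono hs₁).sub (IsH1.of_contDiff (contDiff_of_mem_polySpace hP₁.1) hb₁)
  have hw₂ := (hg.mono hs₂).sub (IsH1.of_contDiff (contDiff_of_mem_polySpace hP₂.1) hb₂)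
  have hy₁ := (hg.mono hs₁).sub (IsH1.of_contDiff (contDiff_of_mem_polySpace hp₁) hb₁)
  have hy₂ := (hg.mono hs₂).sub (IsH1.of_contDiff (contDiff_of_mem_polySpace hp₂) hb₂)
  have b₁ : ∫ x in interior K₁, (P₁ - p₁) x ^ 2 ≤ 4 * t₁ := by
    have h1 := integral_sub_sq_le hw₁.memLp hy₁.memLp
    have h2 := hw₁.integral_sq_le_rdNorm_sq isOpen_interior hε.le
    have h3 := hy₁.integral_sq_le_rdNorm_sq isOpen_interior hε.le
    linarith
  have b₂ : ∫ x in interior K₂, (P₂ - p₂) x ^ 2 ≤ 4 * t₂ := by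
    have h1 := integral_sub_sq_le hw₂.memLp hy₂.memLp
    have h2 := hw₂.integral_sq_le_rdNorm_sq isOpen_interior hε.le
    have h3 := hy₂.integral_sq_le_rdNorm_sq isOpen_interior hε.le
    linarith
  have t₁0 : 0 ≤ t₁ := sq_nonneg _
  have t₂0 : 0 ≤ t₂ := sq_nonneg _
  have hrd : 0 < r ^ d := by positivity
  -- The 8 is 2 from squaring a difference of two terms, times the 4 in `b₁` and `b₂`.
  have hJ := hK.faceHeight_mul_faceNormSq_le (f := P₁ - P₂) (M := 8 * C * (t₁ + t₂) / r ^ d)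
    (by positivity) (fun x hx => by
      have c₁ := H K₁ K₂ z n r hK _ (polySpace_sub hP₁.1 hp₁) x (hK.sub₁ hx.1)
      have c₂ := H K₂ K₁ z (-n) r hK.symm _ (polySpace_sub hP₂.1 hp₂) x (hK.sub₂ hx.2)
      have ev : p₁ x = p₂ x := (hv₁ hx.1).symm.trans (hv₂ hx.2)
      have esq : (P₁ - P₂) x ^ 2 ≤ 2 * (P₁ - p₁) x ^ 2 + 2 * (P₂ - p₂) x ^ 2 := by
        simp only [Pi.sub_apply, ev]
        nlinarith [sq_nonneg ((P₁ x - p₂ x) + (P₂ x - p₂ x))]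
      rw [le_div_iff₀ hrd]
      have d₁ := mul_le_mul_of_nonneg_left b₁ hC.le
      have d₂ := mul_le_mul_of_nonneg_left b₂ hC.le
      have d₃ := mul_le_mul_of_nonneg_left esq hrd.le
      linarith)
  have e3 : (R * r) ^ d * α * (8 * C * (t₁ + t₂) / r ^ d) = R ^ d * α * (8 * C) * (t₁ + t₂) := by
    rw [mul_pow]; field_simp
  have e4 : |R| = R := abs_of_nonneg (zero_le_one.trans hK.one_le_R)
  rw [e3] at hJ
  rw [e4]
  linarith

/-- The body has diameter at most `2 * R * r` and contains a ball of radius `r / 2`; `(4 * R) ^ d`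
is the ratio of the corresponding ball volumes. -/
theorem TwoSided.poincare₁ {d : ℕ} {K₁ K₂ : Set (EuclideanSpace ℝ (Fin d))}
    {z n : EuclideanSpace ℝ (Fin d)} {r R : ℝ} (hK : TwoSided K₁ K₂ z n r R)
    {w : EuclideanSpace ℝ (Fin d) → ℝ} {G : EuclideanSpace ℝ (Fin d) → EuclideanSpace ℝ (Fin d)}
    (hw : IsH1 (interior K₁) w G) (hmean : ∫ x in interior K₁, w x = 0) :
    ∫ x in interior K₁, w x ^ 2 ≤
      (4 * R) ^ d * (4 * R ^ 2) * r ^ 2 * ∫ x in interior K₁, ‖G x‖ ^ 2 := by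
  set α := volume.real (Metric.ball (0 : EuclideanSpace ℝ (Fin d)) 1) with hα
  have hα0 : 0 < α := volume_real_unit_ball_pos d
  have hr := hK.r_pos
  have hR : 0 < R := zero_lt_one.trans_le hK.one_le_R
  have hb₁ : interior K₁ ⊆ Metric.closedBall z (R * r) := interior_subset.trans hK.sub₁
  have h1 := poincare_of_convex isOpen_interior hK.convex₁.interior hw.weak hw.memLp hw.memLp_grad
    (δ := 2 * R * r) (by positivity) (fun x hx y hy => by
      have hx' := hb₁ hx
      have hy' := hb₁ hy
      rw [Metric.mem_closedBall] at hx' hy'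
      rw [← dist_eq_norm]
      have := dist_triangle_right y x z
      linarith) ((measure_mono interior_subset).trans_lt hK.volume_ne_top₁.lt_top).ne hmean
  rw [Measure.addHaar_real_closedBall _ _ (by positivity), finrank_euclideanSpace,
    Fintype.card_fin, hK.volume_real_interior₁] at h1
  have h2 := hK.le_volume₁
  set I := ∫ x in interior K₁, w x ^ 2
  set Γ := ∫ x in interior K₁, ‖G x‖ ^ 2
  have hI0 : 0 ≤ I := integral_nonneg fun x => sq_nonneg _
  have h3 := (mul_le_mul_of_nonneg_right h2 hI0).trans h1
  have hpos : 0 < (r / 2) ^ d * α := by positivity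
  refine le_of_mul_le_mul_left (h3.trans_eq ?_) hpos
  change (2 * R * r) ^ d * α * (2 * R * r) ^ 2 * Γ = _
  have e : (2 * R * r) ^ d = (r / 2) ^ d * (4 * R) ^ d := by rw [← mul_pow]; congr 1; ring
  rw [e]
  ring

theorem TwoSided.inner_gradient_comp_hyperProj {d : ℕ} {K₁ K₂ : Set (EuclideanSpace ℝ (Fin d))}
    {z n : EuclideanSpace ℝ (Fin d)} {r R : ℝ} (hK : TwoSided K₁ K₂ z n r R)
    {q : EuclideanSpace ℝ (Fin d) → ℝ}
    (hq : Differentiable ℝ fun x => q (hyperProj z n x)) (x : EuclideanSpace ℝ (Fin d)) :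
    inner ℝ (gradient (fun x => q (hyperProj z n x)) x) n = (0 : ℝ) := by
  rw [inner_gradient_eq, ← ((hq x).hasFDerivAt.hasLineDerivAt n).lineDeriv, lineDeriv]
  simp [hK.hyperProj_add_smul]

theorem TwoSided.norm_smul_n {d : ℕ} {K₁ K₂ : Set (EuclideanSpace ℝ (Fin d))}
    {z n : EuclideanSpace ℝ (Fin d)} {r R : ℝ} (hK : TwoSided K₁ K₂ z n r R) {s : ℝ}
    (hs : 0 ≤ s) : ‖s • n‖ = s := by
  rw [norm_smul, hK.norm_n, mul_one, Real.norm_of_nonneg hs]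

theorem closedBall_add_subset_ball {d : ℕ} {z s : EuclideanSpace ℝ (Fin d)} {r : ℝ} (hr : 0 < r)
    (hs : ‖s‖ = r / 4) : Metric.closedBall (z + s) (r / 8) ⊆ Metric.ball z r := by
  refine Metric.closedBall_subset_ball' ?_
  rw [dist_eq_norm, add_sub_cancel_left, hs]
  linarith

theorem TwoSided.add_mem_closedBall {d : ℕ} {z n : EuclideanSpace ℝ (Fin d)} {r : ℝ}
    {x : EuclideanSpace ℝ (Fin d)} (hx : x ∈ Metric.closedBall (z - (r / 4) • n) (r / 8)) :
    x + (r / 2) • n ∈ Metric.closedBall (z + (r / 4) • n) (r / 8) := by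
  rw [mem_closedBall_iff_norm] at hx ⊢
  have e : x + (r / 2) • n - (z + (r / 4) • n) = x - (z - (r / 4) • n) := by module
  rwa [e]

/-- Agreement of the normal components suffices. This keeps the gradient of `Q`, which is purely
tangential and still to be bounded, out of the estimate. -/
theorem TwoSided.integral_inner_sq_le {d : ℕ} {K₁ K₂ : Set (EuclideanSpace ℝ (Fin d))}
    {z n : EuclideanSpace ℝ (Fin d)} {r R : ℝ} (hK : TwoSided K₁ K₂ z n r R)
    {G G₁ G₂ : EuclideanSpace ℝ (Fin d) → EuclideanSpace ℝ (Fin d)}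
    (hG : MemLp G 2 (volume.restrict (interior (K₁ ∪ K₂))))
    (hG₁ : Integrable (fun x => ‖G₁ x‖ ^ 2) (volume.restrict (interior K₁)))
    (hG₂ : Integrable (fun x => ‖G₂ x‖ ^ 2) (volume.restrict (interior K₂)))
    (h₁ : ∀ x ∈ interior K₁, inner ℝ (G x) n = (inner ℝ (G₁ x) n : ℝ))
    (h₂ : ∀ x ∈ interior K₂, inner ℝ (G x) n = (inner ℝ (G₂ x) n : ℝ)) :
    ∫ x in Metric.ball z r, (inner ℝ (G x) ((r / 2) • n) : ℝ) ^ 2 ≤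
      r ^ 2 / 4 * ((∫ x in interior K₁, ‖G₁ x‖ ^ 2) + ∫ x in interior K₂, ‖G₂ x‖ ^ 2) := by
  have hr := hK.r_pos
  have hs₁ : interior K₁ ⊆ interior (K₁ ∪ K₂) := interior_mono Set.subset_union_left
  have hs₂ : interior K₂ ⊆ interior (K₁ ∪ K₂) := interior_mono Set.subset_union_right
  have hinner : MemLp (fun x => (inner ℝ (G x) ((r / 2) • n) : ℝ)) 2
      (volume.restrict (interior (K₁ ∪ K₂))) := hG.inner_const _
  have hinnerI := (memLp_two_iff_integrable_sq hinner.1).1 hinner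
  have hsq : ∀ y : EuclideanSpace ℝ (Fin d),
      (inner ℝ y ((r / 2) • n) : ℝ) ^ 2 ≤ r ^ 2 / 4 * ‖y‖ ^ 2 := by
    intro y
    have h1 := abs_real_inner_le_norm y ((r / 2) • n)
    rw [hK.norm_smul_n (by positivity)] at h1
    rw [← sq_abs]
    calc |inner ℝ y ((r / 2) • n)| ^ 2 ≤ (‖y‖ * (r / 2)) ^ 2 :=
          pow_le_pow_left₀ (abs_nonneg _) h1 2
      _ = r ^ 2 / 4 * ‖y‖ ^ 2 := by ring
  refine (setIntegral_mono_set hinnerI (Filter.Eventually.of_forall fun x => sq_nonneg _)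
    (LE.le.eventuallyLE hK.ball_subset_interior_union)).trans ?_
  rw [hK.restrict_interior_union, integral_add_measure
    (hinnerI.mono_measure (Measure.restrict_mono hs₁ le_rfl))
    (hinnerI.mono_measure (Measure.restrict_mono hs₂ le_rfl)), mul_add,
    ← integral_const_mul, ← integral_const_mul]
  refine add_le_add ?_ ?_
  · refine setIntegral_mono_on (hinnerI.mono_measure (Measure.restrict_mono hs₁ le_rfl))
      (hG₁.const_mul _) isOpen_interior.measurableSet fun x hx => ?_
    rw [inner_smul_right, h₁ x hx, ← inner_smul_right]
    exact hsq _
  · refine setIntegral_mono_on (hinnerI.mono_measure (Measure.restrict_mono hs₂ le_rfl))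
      (hG₂.const_mul _) isOpen_interior.measurableSet fun x hx => ?_
    rw [inner_smul_right, h₂ x hx, ← inner_smul_right]
    exact hsq _

/-- The jump of the two best approximations across the face is controlled by the gradients. -/
theorem TwoSided.integral_jump_sq_le {d ℓ : ℕ} {K₁ K₂ : Set (EuclideanSpace ℝ (Fin d))}
    {z n : EuclideanSpace ℝ (Fin d)} {r R : ℝ} (hK : TwoSided K₁ K₂ z n r R)
    {u v P₁ P₂ : EuclideanSpace ℝ (Fin d) → ℝ}
    {g Gv : EuclideanSpace ℝ (Fin d) → EuclideanSpace ℝ (Fin d)}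
    (hg : IsH1 (interior (K₁ ∪ K₂)) u g) (hP₁ : P₁ ∈ polySpace d ℓ) (hP₂ : P₂ ∈ polySpace d ℓ)
    (hmean₁ : ∫ x in interior K₁, (u - P₁) x = 0) (hmean₂ : ∫ x in interior K₂, (u - P₂) x = 0)
    {Q : EuclideanSpace ℝ (Fin d) → ℝ} (hQp : Q ∈ polySpace d ℓ)
    (hQ : ∀ x, Q x = (P₁ - P₂) (hyperProj z n x))
    (hv₁ : Set.EqOn v (P₁ - Q) K₁) (hv₂ : Set.EqOn v P₂ K₂)
    (hGv : IsH1 (interior (K₁ ∪ K₂)) v Gv)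
    (hGv₁ : Set.EqOn Gv (gradient (P₁ - Q)) (interior K₁))
    (hGv₂ : Set.EqOn Gv (gradient P₂) (interior K₂)) :
    ∫ x in Metric.closedBall (z - (r / 4) • n) (r / 8), Q x ^ 2 ≤
      3 * (1 + (4 * R) ^ d * (4 * R ^ 2)) * r ^ 2 *
        ((∫ x in interior K₁, ‖(g - gradient P₁) x‖ ^ 2) +
          ∫ x in interior K₂, ‖(g - gradient P₂) x‖ ^ 2) := by
  have hr := hK.r_pos
  have hs₁ : interior K₁ ⊆ interior (K₁ ∪ K₂) := interior_mono Set.subset_union_left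
  have hs₂ : interior K₂ ⊆ interior (K₁ ∪ K₂) := interior_mono Set.subset_union_right
  have hb₁ : interior K₁ ⊆ Metric.closedBall z (R * r) := interior_subset.trans hK.sub₁
  have hb₂ : interior K₂ ⊆ Metric.closedBall z (R * r) := interior_subset.trans hK.sub₂
  have hw₁ := (hg.mono hs₁).sub (IsH1.of_contDiff (contDiff_of_mem_polySpace hP₁) hb₁)
  have hw₂ := (hg.mono hs₂).sub (IsH1.of_contDiff (contDiff_of_mem_polySpace hP₂) hb₂)
  have hf := hg.sub hGv
  have hp₁ := hK.poincare₁ hw₁ hmean₁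
  have hp₂ := hK.symm.poincare₁ hw₂ hmean₂
  set Γ₁ := ∫ x in interior K₁, ‖(g - gradient P₁) x‖ ^ 2
  set Γ₂ := ∫ x in interior K₂, ‖(g - gradient P₂) x‖ ^ 2
  set a := Metric.closedBall (z - (r / 4) • n) (r / 8) with ha
  -- This shift carries the small ball `a` in the second body into the mirror ball in the first,
  -- within the ball of radius `r` about `z`.
  set h₀ := (r / 2) • n with hh₀
  have ham : MeasurableSet a := Metric.isClosed_closedBall.measurableSet
  have ha₂ : a ⊆ interior K₂ := hK.closedBall_subset_interior₂
  have ha₁ : ∀ x ∈ a, x + h₀ ∈ interior K₁ := fun x hx =>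
    hK.closedBall_subset_interior₁ (TwoSided.add_mem_closedBall hx)
  have haB : a ⊆ Metric.ball z r := by
    rw [ha, sub_eq_add_neg]
    exact closedBall_add_subset_ball hr (by rw [norm_neg, hK.norm_smul_n (by positivity)])
  have haB' : ∀ x ∈ a, x + h₀ ∈ Metric.ball z r := fun x hx =>
    closedBall_add_subset_ball hr (hK.norm_smul_n (by positivity))
      (TwoSided.add_mem_closedBall hx)
  obtain ⟨hfL, hT⟩ := (hf.mono hK.ball_subset_interior_union).integral_translate_sub_le
    Metric.isOpen_ball (convex_ball z r) haB haB'
  have hQd : Differentiable ℝ fun x => (P₁ - P₂) (hyperProj z n x) := by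
    simp only [← hQ]
    exact differentiable_of_mem_polySpace hQp
  have hQn : ∀ x, inner ℝ (gradient Q x) n = (0 : ℝ) := by
    have : Q = fun x => (P₁ - P₂) (hyperProj z n x) := funext hQ
    rw [this]
    exact hK.inner_gradient_comp_hyperProj hQd
  have hgr : ∫ x in Metric.ball z r, (inner ℝ ((g - Gv) x) h₀ : ℝ) ^ 2 ≤
      r ^ 2 / 4 * (Γ₁ + Γ₂) := by
    refine hK.integral_inner_sq_le hf.memLp_grad hw₁.integrable_grad_sq hw₂.integrable_grad_sq
      (fun x hx => ?_) (fun x hx => ?_)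
    · rw [Pi.sub_apply, hGv₁ hx, gradient_sub_eq (differentiable_of_mem_polySpace hP₁)
        (differentiable_of_mem_polySpace hQp), sub_sub_eq_add_sub, add_sub_right_comm,
        inner_add_left, hQn, add_zero, Pi.sub_apply]
    · rw [Pi.sub_apply, hGv₂ hx, Pi.sub_apply]
  have hmp := (measurePreserving_add_right (volume : Measure (EuclideanSpace ℝ (Fin d)))
    h₀).restrict_preimage_emb (measurableEmbedding_addRight h₀) (interior K₁)
  have hi₁' : Integrable (fun x => (u - P₁) (x + h₀) ^ 2)
      (volume.restrict ((fun x => x + h₀) ⁻¹' interior K₁)) :=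
    hmp.integrable_comp_of_integrable hw₁.integrable_sq
  have hi₁ : Integrable (fun x => (u - P₁) (x + h₀) ^ 2) (volume.restrict a) :=
    hi₁'.mono_measure (Measure.restrict_mono ha₁ le_rfl)
  have hi₂ : Integrable (fun x => (u - P₂) x ^ 2) (volume.restrict a) :=
    hw₂.integrable_sq.mono_measure (Measure.restrict_mono ha₂ le_rfl)
  have hb1 : ∫ x in a, (u - P₁) (x + h₀) ^ 2 ≤ ∫ x in interior K₁, (u - P₁) x ^ 2 := by
    refine (setIntegral_mono_set hi₁' (Filter.Eventually.of_forall fun x => sq_nonneg _)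
      (LE.le.eventuallyLE ha₁)).trans_eq ?_
    exact (measurePreserving_add_right (volume : Measure (EuclideanSpace ℝ (Fin d)))
      h₀).setIntegral_preimage_emb (measurableEmbedding_addRight h₀)
      (fun x => (u - P₁) x ^ 2) (interior K₁)
  have hb2 : ∫ x in a, (u - P₂) x ^ 2 ≤ ∫ x in interior K₂, (u - P₂) x ^ 2 :=
    setIntegral_mono_set hw₂.integrable_sq (Filter.Eventually.of_forall fun x => sq_nonneg _)
      (LE.le.eventuallyLE ha₂)
  have hD : MemLp (fun x => (u - v) (x + h₀) - (u - v) x) 2 (volume.restrict a) :=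
    hfL.sub (hf.memLp.mono_measure
      (Measure.restrict_mono (haB.trans hK.ball_subset_interior_union) le_rfl))
  have hDi := (memLp_two_iff_integrable_sq hD.1).1 hD
  have hQi : Integrable (fun x => Q x ^ 2) (volume.restrict a) :=
    ((continuous_of_mem_polySpace hQp).pow 2).continuousOn.integrableOn_compact
      (isCompact_closedBall _ _)
  -- As `Q` takes the same value at `x` and `x + h₀`, it equals the difference of `u - v` between
  -- these points, minus `u - P₁` at the far point, plus `u - P₂` at the near one.
  have hsum : ∫ x in a, Q x ^ 2 ≤ 3 * ((∫ x in a, ((u - v) (x + h₀) - (u - v) x) ^ 2) +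
      (∫ x in a, (u - P₁) (x + h₀) ^ 2) + ∫ x in a, (u - P₂) x ^ 2) := by
    have hDi₁ : Integrable (fun x => ((u - v) (x + h₀) - (u - v) x) ^ 2 + (u - P₁) (x + h₀) ^ 2)
        (volume.restrict a) := hDi.add hi₁
    rw [← integral_add hDi hi₁, ← integral_add hDi₁ hi₂, ← integral_const_mul]
    refine setIntegral_mono_on hQi ((hDi₁.add hi₂).const_mul 3) ham fun x hx => ?_
    have e1 := hv₁ (interior_subset (ha₁ x hx))
    have e2 := hv₂ (interior_subset (ha₂ hx))
    have e3 : Q (x + h₀) = Q x := by rw [hQ, hQ, hh₀, hK.hyperProj_add_smul]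
    simp only [Pi.sub_apply] at e1 e2 ⊢
    rw [e1, e2, e3]
    set A := u (x + h₀) - P₁ (x + h₀) with hA
    set B := u x - P₂ x with hB
    rw [show u (x + h₀) - (P₁ (x + h₀) - Q x) = A + Q x by rw [hA]; ring]
    set D := A + Q x - B with hDdef
    rw [show Q x = D - A + B by rw [hDdef]; ring]
    nlinarith [sq_nonneg (D + A), sq_nonneg (D - B), sq_nonneg (A + B)]
  have hΓ₁ : 0 ≤ Γ₁ := integral_nonneg fun x => sq_nonneg _
  have hΓ₂ : 0 ≤ Γ₂ := integral_nonneg fun x => sq_nonneg _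
  have hr2 : 0 ≤ r ^ 2 * (Γ₁ + Γ₂) := by positivity
  have h5 := hT.trans hgr
  set k := (4 * R) ^ d * (4 * R ^ 2)
  calc ∫ x in a, Q x ^ 2 ≤ 3 * (r ^ 2 / 4 * (Γ₁ + Γ₂) + k * r ^ 2 * Γ₁ + k * r ^ 2 * Γ₂) := by
        linarith
    _ ≤ 3 * (1 + k) * r ^ 2 * (Γ₁ + Γ₂) := by linarith

/-- The jump, extended constantly in the normal direction, is subtracted from `P₁`. Its L² norm is
paid for by the face term, its gradient by the gradient errors of both best approximations. -/
theorem exists_jump_augmentation_upper (d ℓ : ℕ) [NeZero d] (R : ℝ) (hR : 1 ≤ R) :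
    ∃ C : ℝ, 0 < C ∧
    ∀ (K₁ K₂ : Set (EuclideanSpace ℝ (Fin d))) (z n : EuclideanSpace ℝ (Fin d)) (r : ℝ),
      TwoSided K₁ K₂ z n r R → ∀ ε : ℝ, 0 < ε → ∀ u : EuclideanSpace ℝ (Fin d) → ℝ,
      MemH1 (interior (K₁ ∪ K₂)) u → ∀ P₁ P₂ : EuclideanSpace ℝ (Fin d) → ℝ,
      IsBestApprox ε (interior K₁) (polySpace d ℓ) u P₁ →
      IsBestApprox ε (interior K₂) (polySpace d ℓ) u P₂ → ∃ v ∈ pairSpace ℓ K₁ K₂,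
      rdNorm ε (interior (K₁ ∪ K₂)) (u - v) ^ 2 ≤
        C * (faceHeight K₁ K₂ (K₁ ∩ K₂) * faceNormSq (K₁ ∩ K₂) (P₁ - P₂)
          + (rdNorm ε (interior K₁) (u - P₁) ^ 2 + rdNorm ε (interior K₂) (u - P₂) ^ 2)) := by
  obtain ⟨C, hC, H⟩ := exists_le_face d ℓ R hR
  obtain ⟨D, hD, HD⟩ := exists_poly_bound_near d ℓ R
  set α := volume.real (Metric.ball (0 : EuclideanSpace ℝ (Fin d)) 1) with hα
  have hα0 : 0 < α := volume_real_unit_ball_pos d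
  have hR0 : 0 < R := zero_lt_one.trans_le hR
  set κ := 3 * (1 + (4 * R) ^ d * (4 * R ^ 2)) with hκ
  have hκ0 : 0 < κ := by positivity
  -- The 2s come from squaring `(u - P₁) + Q` on the first body; the other two terms pay for the
  -- values and the gradient of `Q`.
  refine ⟨2 + 2 * (R ^ d * α * C) + 2 * (R ^ d * α * D * κ), by positivity,
    fun K₁ K₂ z n r hK ε hε u hu P₁ P₂ hP₁ hP₂ => ?_⟩
  have hr := hK.r_pos
  obtain ⟨g, hg⟩ := hu.exists_isH1
  have hs₁ : interior K₁ ⊆ interior (K₁ ∪ K₂) := interior_mono Set.subset_union_left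
  have hs₂ : interior K₂ ⊆ interior (K₁ ∪ K₂) := interior_mono Set.subset_union_right
  have hb₁ : interior K₁ ⊆ Metric.closedBall z (R * r) := interior_subset.trans hK.sub₁
  have hb₂ : interior K₂ ⊆ Metric.closedBall z (R * r) := interior_subset.trans hK.sub₂
  have hq := polySpace_sub hP₁.1 hP₂.1
  set Q : EuclideanSpace ℝ (Fin d) → ℝ := fun x => (P₁ - P₂) (hyperProj z n x) with hQ
  have hQp : Q ∈ polySpace d ℓ := polySpace_comp_affineMap hq _
  have hp₁ : P₁ - Q ∈ polySpace d ℓ := polySpace_sub hP₁.1 hQp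
  set v : EuclideanSpace ℝ (Fin d) → ℝ := fun x =>
    if hyperHeight z n x ≤ 0 then P₂ x else (P₁ - Q) x with hv
  have h0 : ∀ x, hyperHeight z n x = 0 → P₂ x = (P₁ - Q) x := by
    intro x hx
    simp [hQ, TwoSided.hyperProj_of_hyperHeight_eq_zero hx]
  have hv₂ : Set.EqOn v P₂ K₂ := fun x hx => by simp only [hv, if_pos (hK.side₂ x hx)]
  have hv₁ : Set.EqOn v (P₁ - Q) K₁ := by
    intro x hx
    rcases (hK.side₁ x hx).eq_or_lt with hl | hl
    · simp only [hv, if_pos hl.ge]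
      exact h0 x hl.symm
    · simp only [hv, if_neg hl.not_ge]
  have hvc : Continuous v :=
    Continuous.if_le (continuous_of_mem_polySpace hP₂.1) (continuous_of_mem_polySpace hp₁)
      (hyperHeight z n).continuous_of_finiteDimensional continuous_const h0
  refine ⟨v, ⟨hvc.continuousOn, ⟨_, hp₁, hv₁⟩, ⟨_, hP₂.1, hv₂⟩⟩, ?_⟩
  obtain ⟨Gv, hGv, hGv₁, hGv₂⟩ := hK.isH1_piecewise hp₁ hP₂.1 hv₁ hv₂
  have hmean₁ := hP₁.integral_eq_zero isOpen_interior hb₁ (hg.mono hs₁) hε.le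
  have hmean₂ := hP₂.integral_eq_zero isOpen_interior hb₂ (hg.mono hs₂) hε.le
  have hjump := hK.integral_jump_sq_le hg hP₁.1 hP₂.1 hmean₁ hmean₂ hQp (fun x => rfl) hv₁ hv₂
    hGv hGv₁ hGv₂
  have hw₁ := (hg.mono hs₁).sub (IsH1.of_contDiff (contDiff_of_mem_polySpace hP₁.1) hb₁)
  have hw₂ := (hg.mono hs₂).sub (IsH1.of_contDiff (contDiff_of_mem_polySpace hP₂.1) hb₂)
  have hdiff := hg.sub hGv
  have e₂ : rdNorm ε (interior K₂) (u - v) ^ 2 = rdNorm ε (interior K₂) (u - P₂) ^ 2 :=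
    (hdiff.mono hs₂).rdNorm_congr isOpen_interior
      (fun x hx => by simp [hv₂ (interior_subset hx)]) hε.le
  have hQ1 : IsH1 (interior K₁) Q (gradient Q) :=
    IsH1.of_contDiff (contDiff_of_mem_polySpace hQp) hb₁
  have hsum : IsH1 (interior K₁) ((u - P₁) + Q) ((g - gradient P₁) + gradient Q) :=
    ⟨hw₁.memLp.add hQ1.memLp, hw₁.memLp_grad.add hQ1.memLp_grad, hw₁.weak.add hQ1.weak⟩
  have e₁ : rdNorm ε (interior K₁) (u - v) ^ 2 = rdNorm ε (interior K₁) ((u - P₁) + Q) ^ 2 :=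
    (hdiff.mono hs₁).rdNorm_congr isOpen_interior
      (fun x hx => by
        simp only [Pi.sub_apply, Pi.add_apply, hv₁ (interior_subset hx)]
        ring) hε.le
  have hsplit : rdNorm ε (interior K₁) ((u - P₁) + Q) ^ 2 ≤
      2 * rdNorm ε (interior K₁) (u - P₁) ^ 2 + 2 * ((∫ x in interior K₁, Q x ^ 2) +
        ε * ∫ x in interior K₁, ‖gradient Q x‖ ^ 2) := by
    rw [hsum.rdNorm_sq isOpen_interior hε.le, hw₁.rdNorm_sq isOpen_interior hε.le]
    have a1 : ∫ x in interior K₁, ((u - P₁) + Q) x ^ 2 ≤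
        2 * (∫ x in interior K₁, (u - P₁) x ^ 2) + 2 * ∫ x in interior K₁, Q x ^ 2 := by
      rw [← integral_const_mul, ← integral_const_mul,
        ← integral_add (hw₁.integrable_sq.const_mul 2) (hQ1.integrable_sq.const_mul 2)]
      refine integral_mono hsum.integrable_sq
        ((hw₁.integrable_sq.const_mul 2).add (hQ1.integrable_sq.const_mul 2)) fun x => ?_
      simp only [Pi.add_apply]
      nlinarith [sq_nonneg ((u - P₁) x - Q x)]
    have a2 : ∫ x in interior K₁, ‖((g - gradient P₁) + gradient Q) x‖ ^ 2 ≤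
        2 * (∫ x in interior K₁, ‖(g - gradient P₁) x‖ ^ 2) +
          2 * ∫ x in interior K₁, ‖gradient Q x‖ ^ 2 := by
      rw [← integral_const_mul, ← integral_const_mul,
        ← integral_add (hw₁.integrable_grad_sq.const_mul 2) (hQ1.integrable_grad_sq.const_mul 2)]
      refine integral_mono hsum.integrable_grad_sq
        ((hw₁.integrable_grad_sq.const_mul 2).add (hQ1.integrable_grad_sq.const_mul 2))
        fun x => ?_
      have h1 := norm_add_le ((g - gradient P₁) x) (gradient Q x)
      have h2 := pow_le_pow_left₀ (norm_nonneg _) h1 2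
      simp only [Pi.add_apply]
      nlinarith [sq_nonneg (‖(g - gradient P₁) x‖ - ‖gradient Q x‖)]
    have a3 := mul_le_mul_of_nonneg_left a2 hε.le
    linarith
  set J := faceHeight K₁ K₂ (K₁ ∩ K₂) * faceNormSq (K₁ ∩ K₂) (P₁ - P₂) with hJ
  set t₁ := rdNorm ε (interior K₁) (u - P₁) ^ 2 with ht₁
  set t₂ := rdNorm ε (interior K₂) (u - P₂) ^ 2 with ht₂
  have ht₁0 : 0 ≤ t₁ := sq_nonneg _
  have ht₂0 : 0 ≤ t₂ := sq_nonneg _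
  have hrd : 0 < r ^ d := by positivity
  have hvol : volume.real (interior K₁) ≤ (R * r) ^ d * α := by
    rw [hK.volume_real_interior₁]
    exact hK.volume_le₁
  have hfin : volume (interior K₁) < ⊤ :=
    (measure_mono interior_subset).trans_lt hK.volume_ne_top₁.lt_top
  have hJ0 : 0 ≤ J := by
    have := (H K₁ K₂ z n r hK _ hq z (by simpa using hr.le.trans hK.r_le)).trans' (by positivity)
    exact nonneg_of_mul_nonneg_right this hC
  have hbd : ∀ (f : EuclideanSpace ℝ (Fin d) → ℝ) (M : ℝ),
      (∀ x ∈ interior K₁, 0 ≤ f x) → (∀ x ∈ interior K₁, r ^ d * f x ≤ M) → 0 ≤ M →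
      ∫ x in interior K₁, f x ≤ R ^ d * α * M := by
    intro f M hf0 hfM hM
    have h1 : ∀ x ∈ interior K₁, ‖f x‖ ≤ M / r ^ d := by
      intro x hx
      rw [Real.norm_of_nonneg (hf0 x hx), le_div_iff₀ hrd, mul_comm]
      exact hfM x hx
    have h2 := (le_abs_self _).trans (norm_setIntegral_le_of_norm_le_const hfin h1)
    calc ∫ x in interior K₁, f x ≤ M / r ^ d * volume.real (interior K₁) := h2
      _ ≤ M / r ^ d * ((R * r) ^ d * α) := by gcongr
      _ = R ^ d * α * M := by rw [mul_pow]; field_simp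
  have hI1 : ∫ x in interior K₁, Q x ^ 2 ≤ R ^ d * α * (C * J) :=
    hbd _ _ (fun x _ => sq_nonneg _) (fun x hx => H K₁ K₂ z n r hK _ hq x (hb₁ hx)) (by positivity)
  set A := ∫ x in Metric.closedBall (z - (r / 4) • n) (r / 8), Q x ^ 2 with hA
  have hA0 : 0 ≤ A := integral_nonneg fun x => sq_nonneg _
  have hnear : ‖z - (r / 4) • n - z‖ ≤ r := by
    rw [sub_sub_cancel_left, norm_neg, norm_smul, hK.norm_n, Real.norm_of_nonneg (by positivity)]
    linarith
  have hI2 : ∫ x in interior K₁, ‖gradient Q x‖ ^ 2 ≤ R ^ d * α * (D * ((r ^ 2)⁻¹ * A)) :=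
    hbd _ _ (fun x _ => sq_nonneg _)
      (fun x hx => (HD Q hQp z _ r hr hnear x (hb₁ hx)).2) (by positivity)
  have hg₁ := hw₁.integral_grad_sq_le_rdNorm_sq isOpen_interior hε.le
  have hg₂ := hw₂.integral_grad_sq_le_rdNorm_sq isOpen_interior hε.le
  have hA' : (r ^ 2)⁻¹ * A ≤ κ * ((∫ x in interior K₁, ‖(g - gradient P₁) x‖ ^ 2) +
      ∫ x in interior K₂, ‖(g - gradient P₂) x‖ ^ 2) := by
    rw [inv_mul_le_iff₀ (by positivity)]
    linarith
  -- The `r⁻²` of the inverse inequality has cancelled against the `r²` of the jump estimate, so `ε`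
  -- meets only gradient errors and the constant is free of it.
  have hI3 : ε * ∫ x in interior K₁, ‖gradient Q x‖ ^ 2 ≤ R ^ d * α * D * κ * (t₁ + t₂) := by
    calc ε * ∫ x in interior K₁, ‖gradient Q x‖ ^ 2
        ≤ ε * (R ^ d * α * (D * (κ * ((∫ x in interior K₁, ‖(g - gradient P₁) x‖ ^ 2) +
          ∫ x in interior K₂, ‖(g - gradient P₂) x‖ ^ 2)))) := by
          refine mul_le_mul_of_nonneg_left (hI2.trans ?_) hε.le
          gcongr
      _ = R ^ d * α * D * κ * (ε * (∫ x in interior K₁, ‖(g - gradient P₁) x‖ ^ 2) +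
          ε * ∫ x in interior K₂, ‖(g - gradient P₂) x‖ ^ 2) := by ring
      _ ≤ _ := by gcongr
  rw [hdiff.rdNorm_sq_union hK hε.le, e₁, e₂]
  set X := R ^ d * α * C with hX
  set Y := R ^ d * α * D * κ with hY
  have hX0 : 0 ≤ X := by positivity
  have hY0 : 0 ≤ Y := by positivity
  have hXJ : R ^ d * α * (C * J) = X * J := by rw [hX]; ring
  rw [hXJ] at hI1
  have p1 := mul_nonneg hX0 ht₁0
  have p2 := mul_nonneg hX0 ht₂0
  have p3 := mul_nonneg hY0 hJ0
  linarith

/-! ### Pairs of simplices -/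

/-- The barycentric coordinates of a simplex, together with what is needed about its face
opposite to a vertex. -/
theorem Affine.Simplex.exists_barycentric {d : ℕ} [NeZero d]
    (T : Affine.Simplex ℝ (EuclideanSpace ℝ (Fin d)) d) (i : Fin (d + 1)) :
    ∃ l : Fin (d + 1) → EuclideanSpace ℝ (Fin d) →ᵃ[ℝ] ℝ,
      (∀ x, x ∈ T.closedInterior ↔ ∀ j, 0 ≤ l j x) ∧ (∀ x, ∑ j, l j x = 1) ∧
      (∀ x ∈ (T.faceOpposite i).closedInterior, l i x = 0) ∧
      (∃ z ∈ (T.faceOpposite i).closedInterior, ∀ j ≠ i, l j z = (d : ℝ)⁻¹) ∧ (∃ a, l i a = 1) ∧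
      (interior T.closedInterior).Nonempty := by
  classical
  have hd : (d : ℝ) ≠ 0 := Nat.cast_ne_zero.2 (NeZero.ne d)
  have htop : affineSpan ℝ (Set.range T.points) = ⊤ :=
    (T.independent.affineSpan_eq_top_iff_card_eq_finrank_add_one).2 (by simp)
  set b : AffineBasis (Fin (d + 1)) ℝ (EuclideanSpace ℝ (Fin d)) := ⟨T.points, T.independent, htop⟩
    with hb
  have hbT : ∀ j, b j = T.points j := fun j => rfl
  have hconv : T.closedInterior = {x | ∀ j, 0 ≤ b.coord j x} := by
    rw [← b.convexHull_eq_nonneg_coord, ← T.convexHull_eq_closedInterior]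
    rfl
  have hface : (T.faceOpposite i).closedInterior = convexHull ℝ (T.points '' {i}ᶜ) := by
    rw [← (T.faceOpposite i).convexHull_eq_closedInterior, T.range_faceOpposite_points]
  refine ⟨b.coord, fun x => by rw [hconv]; rfl, b.sum_coord_apply_eq_one, fun x hx => ?_, ?_,
    ⟨b i, b.coord_apply_eq i⟩, ?_⟩
  · rw [hface] at hx
    have hsub : convexHull ℝ (T.points '' {i}ᶜ) ⊆ (b.coord i) ⁻¹' {0} := by
      refine convexHull_min ?_ ((convex_singleton (0 : ℝ)).affine_preimage _)
      rintro _ ⟨j, hj, rfl⟩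
      exact b.coord_apply_ne (Ne.symm hj)
    exact hsub hx
  · have hsum : ∑ _j ∈ Finset.univ.erase i, (d : ℝ)⁻¹ = 1 := by
      rw [Finset.sum_const, Finset.card_erase_of_mem (Finset.mem_univ i)]
      simp [hd]
    refine ⟨∑ j ∈ Finset.univ.erase i, (d : ℝ)⁻¹ • T.points j, ?_, fun j hj => ?_⟩
    · rw [hface]
      refine (convex_convexHull ℝ _).sum_mem (fun _ _ => by positivity) hsum fun j hj => ?_
      exact subset_convexHull ℝ _ ⟨j, Finset.ne_of_mem_erase hj, rfl⟩
    · have e : ∑ j ∈ Finset.univ.erase i, (d : ℝ)⁻¹ • T.points j =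
          (Finset.univ.erase i).affineCombination ℝ b fun _ => (d : ℝ)⁻¹ := by
        rw [Finset.affineCombination_eq_linear_combination _ _ _ hsum]
        rfl
      rw [e, b.coord_apply_combination_of_mem (by simp [hj]) hsum]
  · rw [← T.convexHull_eq_closedInterior, interior_convexHull_nonempty_iff_affineSpan_eq_top]
    exact htop

/-- Along a diameter of the ball an affine function with values in `[0, 1]` changes by at most 1, so
its slope is at most `1 / (2 * s)`. -/
theorem linear_mul_diam_le {d : ℕ} {K : Set (EuclideanSpace ℝ (Fin d))}
    {l : EuclideanSpace ℝ (Fin d) →ᵃ[ℝ] ℝ} (h0 : ∀ x ∈ K, 0 ≤ l x) (h1 : ∀ x ∈ K, l x ≤ 1)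
    {c : EuclideanSpace ℝ (Fin d)} {s : ℝ} (hs : 0 ≤ s) (hK : Metric.closedBall c s ⊆ K)
    (x y : EuclideanSpace ℝ (Fin d)) : |l x - l y| * (2 * s) ≤ ‖x - y‖ := by
  rcases eq_or_ne x y with rfl | hxy
  · simp
  have hpos : 0 < ‖x - y‖ := norm_pos_iff.2 (sub_ne_zero.2 hxy)
  have hlin : l x - l y = l.linear (x - y) := by
    simpa using (l.linearMap_vsub x y).symm
  set v := (s / ‖x - y‖) • (x - y) with hv
  have hvn : ‖v‖ = s := by
    rw [hv, norm_smul, Real.norm_of_nonneg (by positivity), div_mul_cancel₀ _ hpos.ne']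
  have hp : c + v ∈ K := hK (by simp [hvn])
  have hm : c - v ∈ K := hK (by simp [hvn])
  have ep : l (c + v) = l.linear v + l c := by simpa [add_comm] using l.map_vadd c v
  have em : l (c - v) = -l.linear v + l c := by
    simpa [sub_eq_add_neg, add_comm] using l.map_vadd c (-v)
  have a1 := h0 _ hp
  have a2 := h1 _ hp
  have a3 := h0 _ hm
  have a4 := h1 _ hm
  rw [ep] at a1 a2
  rw [em] at a3 a4
  have e : l.linear v = s / ‖x - y‖ * (l x - l y) := by rw [hv, map_smul, hlin, smul_eq_mul]
  have h2 : |l.linear v| ≤ 1 / 2 := abs_le.2 ⟨by linarith, by linarith⟩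
  rw [e, abs_mul, abs_of_nonneg (by positivity : 0 ≤ s / ‖x - y‖), div_mul_eq_mul_div,
    div_le_iff₀ hpos] at h2
  linarith

theorem abs_sub_mul_inscribedDiam_le {d : ℕ} {K : Set (EuclideanSpace ℝ (Fin d))}
    {l : EuclideanSpace ℝ (Fin d) →ᵃ[ℝ] ℝ} (h0 : ∀ x ∈ K, 0 ≤ l x) (h1 : ∀ x ∈ K, l x ≤ 1)
    (x y : EuclideanSpace ℝ (Fin d)) : |l x - l y| * inscribedDiam K ≤ ‖x - y‖ := by
  rcases (abs_nonneg (l x - l y)).eq_or_lt with h | h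
  · rw [← h, zero_mul]
    exact norm_nonneg _
  · rw [← le_div_iff₀' h]
    refine Real.sSup_le ?_ (by positivity)
    rintro _ ⟨c, s, hs, hK, rfl⟩
    rw [le_div_iff₀' h]
    exact linear_mul_diam_le h0 h1 hs hK x y

/-- A nonconstant coordinate bounds the diameters of inscribed balls, so the supremum is genuine and
not the default value 0. -/
theorem inscribedDiam_pos {d : ℕ} {K : Set (EuclideanSpace ℝ (Fin d))}
    (hint : (interior K).Nonempty)
    {l : EuclideanSpace ℝ (Fin d) →ᵃ[ℝ] ℝ} (h0 : ∀ x ∈ K, 0 ≤ l x) (h1 : ∀ x ∈ K, l x ≤ 1)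
    {x y : EuclideanSpace ℝ (Fin d)} (hxy : l x ≠ l y) : 0 < inscribedDiam K := by
  obtain ⟨c, hc⟩ := hint
  obtain ⟨s, hs, hsK⟩ := Metric.nhds_basis_closedBall.mem_iff.1 (mem_interior_iff_mem_nhds.1 hc)
  have h : 0 < |l x - l y| := abs_pos.2 (sub_ne_zero.2 hxy)
  refine lt_of_lt_of_le (by positivity : 0 < 2 * s) (le_csSup ⟨‖x - y‖ / |l x - l y|, ?_⟩
    ⟨c, s, hs.le, hsK, rfl⟩)
  rintro _ ⟨c, s, hs, hK, rfl⟩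
  rw [le_div_iff₀' h]
  exact linear_mul_diam_le h0 h1 hs hK x y

theorem exists_hyperHeight_eq {d : ℕ} (l : EuclideanSpace ℝ (Fin d) →ᵃ[ℝ] ℝ)
    {z a : EuclideanSpace ℝ (Fin d)} (hz : l z = 0) (ha : l a ≠ 0) :
    ∃ n : EuclideanSpace ℝ (Fin d), ‖n‖ = 1 ∧ ∃ k : ℝ, 0 < k ∧ ∀ x, l x = k * hyperHeight z n x := by
  set ν := (InnerProductSpace.toDual ℝ (EuclideanSpace ℝ (Fin d))).symm
    (LinearMap.toContinuousLinearMap l.linear) with hν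
  have hl : ∀ x, l x = inner ℝ ν (x - z) := by
    intro x
    rw [hν, InnerProductSpace.toDual_symm_apply]
    have := l.linearMap_vsub x z
    simpa [hz] using this.symm
  have hν0 : ν ≠ 0 := by
    intro h
    rw [hl a, h, inner_zero_left] at ha
    exact ha rfl
  have hn : 0 < ‖ν‖ := norm_pos_iff.2 hν0
  refine ⟨‖ν‖⁻¹ • ν, by rw [norm_smul, norm_inv, norm_norm, inv_mul_cancel₀ hn.ne'], ‖ν‖, hn,
    fun x => ?_⟩
  rw [hyperHeight_apply, inner_smul_left, hl]
  simp [hn.ne']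

/-- Barycentric coordinates have slope at most the reciprocal of the inscribed diameter. Near a
point `z` of the face where all coordinates but the one vanishing on the face are bounded below,
membership in a simplex depends on the sign of that single coordinate. -/
theorem ShareFace.exists_twoSided {d : ℕ} [NeZero d]
    {T₁ T₂ : Affine.Simplex ℝ (EuclideanSpace ℝ (Fin d)) d} {F : Set (EuclideanSpace ℝ (Fin d))}
    (hF : ShareFace T₁ T₂ F) {σ : ℝ}
    (hσ : shapeParam T₁.closedInterior T₂.closedInterior ≤ σ) :
    ∃ z n r, TwoSided T₁.closedInterior T₂.closedInterior z n r (max 1 (2 * d * σ)) := by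
  obtain ⟨hinter, ⟨i, hi⟩, ⟨j, hj⟩⟩ := hF
  obtain ⟨l, hlK, hlsum, hlF, ⟨z₁, hz₁, hlz₁⟩, ⟨a₁, ha₁⟩, hint₁⟩ := T₁.exists_barycentric i
  obtain ⟨m, hmK, hmsum, hmF, ⟨z₂, hz₂, hmz₂⟩, ⟨a₂, ha₂⟩, hint₂⟩ := T₂.exists_barycentric j
  rw [← hi] at hlF hz₁
  rw [← hj] at hmF hz₂
  have hd : 0 < (d : ℝ) := Nat.cast_pos.2 (NeZero.pos d)
  set K₁ := T₁.closedInterior with hK₁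
  set K₂ := T₂.closedInterior with hK₂
  have hFK₁ : F ⊆ K₁ := hinter ▸ Set.inter_subset_left
  have hFK₂ : F ⊆ K₂ := hinter ▸ Set.inter_subset_right
  have hc₁ : Convex ℝ K₁ := by
    rw [hK₁, ← T₁.convexHull_eq_closedInterior]; exact convex_convexHull ℝ _
  have hc₂ : Convex ℝ K₂ := by
    rw [hK₂, ← T₂.convexHull_eq_closedInterior]; exact convex_convexHull ℝ _
  have hl0 : ∀ k, ∀ x ∈ K₁, 0 ≤ l k x := fun k x hx => (hlK x).1 hx k
  have hm0 : ∀ k, ∀ x ∈ K₂, 0 ≤ m k x := fun k x hx => (hmK x).1 hx k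
  have hl1 : ∀ k, ∀ x ∈ K₁, l k x ≤ 1 := fun k x hx =>
    (Finset.single_le_sum (f := fun k => l k x) (fun k _ => hl0 k x hx) (Finset.mem_univ k)).trans
      (hlsum x).le
  have hm1 : ∀ k, ∀ x ∈ K₂, m k x ≤ 1 := fun k x hx =>
    (Finset.single_le_sum (f := fun k => m k x) (fun k _ => hm0 k x hx) (Finset.mem_univ k)).trans
      (hmsum x).le
  -- The midpoint avoids matching the vertices of the face as seen from the two simplices: each
  -- relevant coordinate is `1 / d` at one end and nonnegative at the other.
  set z := midpoint ℝ z₁ z₂ with hz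
  have hmid : ∀ f : EuclideanSpace ℝ (Fin d) →ᵃ[ℝ] ℝ, f z = (f z₁ + f z₂) / 2 := by
    intro f
    rw [hz, f.map_midpoint, midpoint_eq_smul_add, smul_eq_mul, invOf_eq_inv]
    ring
  have hliz : l i z = 0 := by rw [hmid, hlF _ hz₁, hlF _ hz₂]; norm_num
  have hmjz : m j z = 0 := by rw [hmid, hmF _ hz₁, hmF _ hz₂]; norm_num
  have hlz : ∀ k ≠ i, (2 * d : ℝ)⁻¹ ≤ l k z := by
    intro k hk
    have := hl0 k z₂ (hFK₁ hz₂)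
    rw [hmid, hlz₁ k hk, mul_inv]
    linarith
  have hmz : ∀ k ≠ j, (2 * d : ℝ)⁻¹ ≤ m k z := by
    intro k hk
    have := hm0 k z₁ (hFK₂ hz₁)
    rw [hmid, hmz₂ k hk, mul_inv]
    linarith
  have hzK₁ : z ∈ K₁ := hc₁.midpoint_mem (hFK₁ hz₁) (hFK₁ hz₂)
  have hzK₂ : z ∈ K₂ := hc₂.midpoint_mem (hFK₂ hz₁) (hFK₂ hz₂)
  have hρ₁ : 0 < inscribedDiam K₁ := inscribedDiam_pos hint₁ (hl0 i) (hl1 i) (x := a₁) (y := z)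
    (by rw [ha₁, hliz]; exact one_ne_zero)
  have hρ₂ : 0 < inscribedDiam K₂ := inscribedDiam_pos hint₂ (hm0 j) (hm1 j) (x := a₂) (y := z)
    (by rw [ha₂, hmjz]; exact one_ne_zero)
  set ρ := min (inscribedDiam K₁) (inscribedDiam K₂) with hρ
  have hρ0 : 0 < ρ := lt_min hρ₁ hρ₂
  set r := ρ * (2 * d : ℝ)⁻¹ with hr
  have hr0 : 0 < r := by positivity
  have hnear : ∀ (K : Set (EuclideanSpace ℝ (Fin d))) (f : EuclideanSpace ℝ (Fin d) →ᵃ[ℝ] ℝ),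
      (∀ x ∈ K, 0 ≤ f x) → (∀ x ∈ K, f x ≤ 1) → ρ ≤ inscribedDiam K → (2 * d : ℝ)⁻¹ ≤ f z →
      ∀ x, ‖x - z‖ ≤ r → 0 ≤ f x := by
    intro K f hf0 hf1 hρK hfz x hx
    have h1 := abs_sub_mul_inscribedDiam_le hf0 hf1 x z
    have h2 : |f x - f z| * ρ ≤ (2 * d : ℝ)⁻¹ * ρ := by
      calc |f x - f z| * ρ ≤ |f x - f z| * inscribedDiam K := by gcongr
        _ ≤ r := h1.trans hx
        _ = _ := by rw [hr, mul_comm]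
    have h3 := (abs_le.1 (le_of_mul_le_mul_right h2 hρ0)).1
    linarith
  have hnear₁ : ∀ x, ‖x - z‖ ≤ r → 0 ≤ l i x → x ∈ K₁ := by
    intro x hx hlx
    refine (hlK x).2 fun k => ?_
    rcases eq_or_ne k i with rfl | hk
    · exact hlx
    · exact hnear K₁ (l k) (hl0 k) (hl1 k) (min_le_left _ _) (hlz k hk) x hx
  have hnear₂ : ∀ x, ‖x - z‖ ≤ r → 0 ≤ m j x → x ∈ K₂ := by
    intro x hx hmx
    refine (hmK x).2 fun k => ?_
    rcases eq_or_ne k j with rfl | hk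
    · exact hmx
    · exact hnear K₂ (m k) (hm0 k) (hm1 k) (min_le_right _ _) (hmz k hk) x hx
  -- Otherwise, moving from `z` towards `x` within radius `r` reaches a point of both simplices off
  -- the face.
  have hside : ∀ x ∈ K₂, l i x ≤ 0 := by
    intro x hx
    by_contra! hpos
    set t := r / (r + ‖x - z‖) with ht
    have ht0 : 0 < t := by positivity
    have ht1 : t ≤ 1 := by
      rw [ht, div_le_one (by positivity)]
      linarith [norm_nonneg (x - z)]
    set y := AffineMap.lineMap z x t with hy
    have hyK : y ∈ K₂ := hc₂.lineMap_mem hzK₂ hx ⟨ht0.le, ht1⟩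
    have hyn : ‖y - z‖ ≤ r := by
      rw [hy, AffineMap.lineMap_apply, vsub_eq_sub, vadd_eq_add, add_sub_cancel_right, norm_smul,
        Real.norm_of_nonneg ht0.le, ht, div_mul_eq_mul_div, div_le_iff₀ (by positivity)]
      nlinarith [norm_nonneg (x - z)]
    have hly : l i y = t * l i x := by
      rw [hy, AffineMap.apply_lineMap, AffineMap.lineMap_apply, hliz]
      simp
    have hly0 : 0 < l i y := by rw [hly]; positivity
    have hyF : y ∈ F := by
      rw [← hinter]
      exact ⟨hnear₁ y hyn hly0.le, hyK⟩
    exact hly0.ne' (hlF y hyF)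
  obtain ⟨n, hn, k, hk, hkl⟩ := exists_hyperHeight_eq (l i) hliz (a := a₁) (by rw [ha₁]; norm_num)
  have hmul : ∀ x, 0 ≤ hyperHeight z n x ↔ 0 ≤ l i x := fun x => by
    rw [hkl, mul_nonneg_iff_of_pos_left hk]
  have hmul' : ∀ x, hyperHeight z n x ≤ 0 ↔ l i x ≤ 0 := fun x => by
    rw [hkl]
    exact (mul_nonpos_iff_pos_imp_nonpos.trans ⟨fun h => h.1 hk, fun h => ⟨fun _ => h,
      fun h' => by nlinarith⟩⟩).symm
  have hdiam : max (Metric.diam K₁) (Metric.diam K₂) ≤ max 1 (2 * d * σ) * r := by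
    have h1 : max (Metric.diam K₁) (Metric.diam K₂) ≤ σ * ρ := by
      rwa [shapeParam, div_le_iff₀ hρ0] at hσ
    calc max (Metric.diam K₁) (Metric.diam K₂) ≤ σ * ρ := h1
      _ = 2 * d * σ * r := by rw [hr]; field_simp
      _ ≤ _ := mul_le_mul_of_nonneg_right (le_max_right _ _) hr0.le
  refine ⟨z, n, r, hc₁, hc₂, T₁.isClosed_closedInterior, T₂.isClosed_closedInterior, hn, hr0,
    le_max_left _ _, fun x hx => (hmul x).2 (hl0 i x hx), fun x hx => (hmul' x).2 (hside x hx),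
    fun x hx hl => hnear₁ x hx ((hmul x).1 hl), fun x hx hl => ?_, fun x hx => ?_, fun x hx => ?_⟩
  · refine hnear₂ x hx ?_
    -- Reflecting `x` in `z` would give a point of both simplices at which `m j` is positive,
    -- although `m j` vanishes on the face.
    by_contra! hneg
    set y := AffineMap.lineMap z x (-1 : ℝ) with hy
    have hrefl : ∀ f : EuclideanSpace ℝ (Fin d) →ᵃ[ℝ] ℝ, f z = 0 → f y = -f x := by
      intro f hf
      rw [hy, AffineMap.apply_lineMap, AffineMap.lineMap_apply, hf]
      simp
    have hyn : ‖y - z‖ ≤ r := by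
      rw [hy, AffineMap.lineMap_apply, vsub_eq_sub, vadd_eq_add, add_sub_cancel_right, norm_smul]
      simpa using hx
    have hly : 0 ≤ l i y := by
      rw [hrefl _ hliz]
      linarith [(hmul' x).1 hl]
    have hmy : 0 < m j y := by
      rw [hrefl _ hmjz]
      linarith
    have hyF : y ∈ F := by
      rw [← hinter]
      exact ⟨hnear₁ y hyn hly, hnear₂ y hyn hmy.le⟩
    exact hmy.ne' (hmF y hyF)
  · exact (Metric.dist_le_diam_of_mem T₁.isCompact_closedInterior.isBounded hx hzK₁).trans
      ((le_max_left _ _).trans hdiam)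
  · exact (Metric.dist_le_diam_of_mem T₂.isCompact_closedInterior.isBounded hx hzK₂).trans
      ((le_max_right _ _).trans hdiam)

theorem rdNorm_nonneg {d : ℕ} (ε : ℝ) (Ω : Set (EuclideanSpace ℝ (Fin d)))
    (u : EuclideanSpace ℝ (Fin d) → ℝ) : 0 ≤ rdNorm ε Ω u :=
  Real.sqrt_nonneg _

end

theorem theorem6p5 (d : ℕ) [NeZero d] (ℓ : ℕ) (σ : ℝ) :
    ∃ c C : ℝ, 0 < c ∧ 0 < C ∧
      ∀ (T₁ T₂ : Affine.Simplex ℝ (EuclideanSpace ℝ (Fin d)) d)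
        (F : Set (EuclideanSpace ℝ (Fin d))),
        ShareFace T₁ T₂ F →
        shapeParam T₁.closedInterior T₂.closedInterior ≤ σ →
        ∀ ε : ℝ, 0 < ε →
        ∀ u : EuclideanSpace ℝ (Fin d) → ℝ,
          MemH1 (interior (T₁.closedInterior ∪ T₂.closedInterior)) u →
        ∀ P₁ P₂ : EuclideanSpace ℝ (Fin d) → ℝ,
          IsBestApprox ε (interior T₁.closedInterior) (polySpace d ℓ) u P₁ →
          IsBestApprox ε (interior T₂.closedInterior) (polySpace d ℓ) u P₂ →
          c * Real.sqrt
                (faceHeight T₁.closedInterior T₂.closedInterior F * faceNormSq F (P₁ - P₂)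
                  + (rdNorm ε (interior T₁.closedInterior) (u - P₁) ^ 2
                    + rdNorm ε (interior T₂.closedInterior) (u - P₂) ^ 2))
              ≤ bestError ε (interior (T₁.closedInterior ∪ T₂.closedInterior))
                  (pairSpace ℓ T₁.closedInterior T₂.closedInterior) u ∧
            bestError ε (interior (T₁.closedInterior ∪ T₂.closedInterior))
                (pairSpace ℓ T₁.closedInterior T₂.closedInterior) u
              ≤ C * Real.sqrt
                (faceHeight T₁.closedInterior T₂.closedInterior F * faceNormSq F (P₁ - P₂)
                  + (rdNorm ε (interior T₁.closedInterior) (u - P₁) ^ 2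
                    + rdNorm ε (interior T₂.closedInterior) (u - P₂) ^ 2)) := by
  -- `2 * d * σ` bounds the diameters in units of `r`; the maximum with 1 covers arbitrary real `σ`.
  obtain ⟨A, hA, HA⟩ := exists_jump_augmentation_lower d ℓ (max 1 (2 * d * σ))
  obtain ⟨B, hB, HB⟩ := exists_jump_augmentation_upper d ℓ (max 1 (2 * d * σ)) (le_max_left _ _)
  refine ⟨(Real.sqrt A)⁻¹, Real.sqrt B, by positivity, by positivity, ?_⟩
  intro T₁ T₂ F hF hσ ε hε u hu P₁ P₂ hP₁ hP₂
  obtain ⟨z, n, r, hK⟩ := hF.exists_twoSided hσ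
  obtain rfl : T₁.closedInterior ∩ T₂.closedInterior = F := hF.1
  have hlow := HA _ _ z n r hK ε hε u hu P₁ P₂ hP₁ hP₂
  obtain ⟨v, hv, hup⟩ := HB _ _ z n r hK ε hε u hu P₁ P₂ hP₁ hP₂
  set S := faceHeight T₁.closedInterior T₂.closedInterior (T₁.closedInterior ∩ T₂.closedInterior) *
      faceNormSq (T₁.closedInterior ∩ T₂.closedInterior) (P₁ - P₂)
    + (rdNorm ε (interior T₁.closedInterior) (u - P₁) ^ 2
      + rdNorm ε (interior T₂.closedInterior) (u - P₂) ^ 2)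
  -- Needed for the lower bound: an infimum over an empty family would be 0 by default.
  have hne : Nonempty (pairSpace ℓ T₁.closedInterior T₂.closedInterior) := ⟨⟨v, hv⟩⟩
  constructor
  · refine le_ciInf fun Q => ?_
    rw [inv_mul_le_iff₀ (by positivity)]
    have h1 := Real.sqrt_le_sqrt (hlow Q Q.2)
    rwa [Real.sqrt_mul hA.le, Real.sqrt_sq (rdNorm_nonneg _ _ _)] at h1
  · refine (ciInf_le ⟨0, ?_⟩ (⟨v, hv⟩ : pairSpace ℓ T₁.closedInterior T₂.closedInterior)).trans ?_
    · rintro _ ⟨Q, rfl⟩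
      exact Real.sqrt_nonneg _
    · have h1 := Real.sqrt_le_sqrt hup
      rwa [Real.sqrt_mul hB.le, Real.sqrt_sq (rdNorm_nonneg _ _ _)] at h1
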